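/- Let $k$ be a commutative ring and $\mathfrak C$ a generalized $k$-linear Reedy category, that is, a small skeletal $k$-linear category with a function $d$ from $\mathrm{Ob}(\mathfrak C)$ to an ordinal and two $k$-linear subcategories $\mathfrak C^+,\mathfrak C^-$ containing all objects such that: $\mathfrak C^+(x,y)\neq 0$ implies $x=y$ or $d(x)<d(y)$; $\mathfrak C^-(x,y)\neq 0$ implies $x=y$ or $d(x)>d(y)$; $\mathfrak C^+(x,x)=\mathfrak C^-(x,x)=:A_x^0$ for all $x$; and composition induces isomorphisms $\bigoplus_{z}\mathfrak C^+(z,y)\otimes_{A_z^0}\mathfrak C^-(x,z)\to\mathfrak C(x,y)$ for all $x,y$. Put $\mathfrak C^0=\mathfrak C^+\cap\mathfrak C^-$. Suppose that $\mathfrak C^+$ is a projective right $\mathfrak C^0$-module and $\mathfrak C^-$ is a projective left $\mathfrak C^0$-module; equivalently, every $\mathfrak C^+(x,y)$ is a projective right $A_x^0$-module and every $\mathfrak C^-(x,y)$ is a projective left $A_y^0$-module. Let $\mathfrak C\text{-Mod}$ be the abelian category of $k$-linear functors $\mathfrak C\to k\text{-Mod}$. For an ordinal $\alpha$ let $\mathfrak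 C_\alpha$ be the full subcategory of $\mathfrak C$ on the objects of degree less than $\alpha$ and $\mathrm{Res}_\alpha$ the restriction of modules to it. For a $\mathfrak C$-module $Y$ and an object $x$ with $d(x)=\alpha$, let $l_Y(x)\colon \mathfrak C(-,x)\otimes_{\mathfrak C_\alpha}\mathrm{Res}_\alpha Y\to Y(x)$, $f\otimes v\mapsto Y(f)(v)$, and $m_Y(x)\colon Y(x)\to \mathrm{Hom}_{\mathfrak C_\alpha}(\mathfrak C(x,-),\mathrm{Res}_\alpha Y)$, $v\mapsto(f\mapsto Y(f)(v))$, be the latching and the matching map; they are $A_x^0$-linear. For a family $\mathcal S=\{\mathcal S_x\}$ of classes $\mathcal S_x$ of left $A_x^0$-modules, let $\Phi(\mathcal S)$ be the class of all $Y$ such that, for every $x$, $l_Y(x)$ is monic with cokernel in $\mathcal S_x$; let $\Psi(\mathcal S)$ be the class of all $Y$ such that, for every $x$, $m_Y(x)$ is epic with kernel in $\mathcal S_x$; and let $\mathfrak C\text{-Mod}_{\mathcal S}$ be the class of all $Y$ with $Y(x)\in\mathcal S_x$ for every $x$. The family $\mathcal S$ is cocompatible if $S\in\mathcal S_y$ implies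 $\mathfrak C^+(y,x)\otimes_{A_y^0}S\in\mathcal S_x$ for all $x,y$, and compatible if $S\in\mathcal S_y$ implies $\mathrm{Hom}_{A_y^0}(\mathfrak C^-(x,y),S)\in\mathcal S_x$ for all $x,y$. A Hovey triple in an abelian category is a triple $(\mathcal Q,\mathcal W,\mathcal R)$ of classes of objects such that $(\mathcal Q,\mathcal W\cap\mathcal R)$ and $(\mathcal Q\cap\mathcal W,\mathcal R)$ are complete cotorsion pairs and $\mathcal W$ is closed under direct summands, extensions, kernels of epimorphisms and cokernels of monomorphisms. It is hereditary if in both cotorsion pairs the left class is closed under kernels of epimorphisms and the right class is closed under cokernels of monomorphisms. For every $x\in\mathrm{Ob}(\mathfrak C)$ let $(\mathcal Q_x,\mathcal W_x,\mathcal R_x)$ be a Hovey triple in $A_x^0\text{-Mod}$, and suppose that $\{\mathcal Q_x\cap\mathcal W_x\}$ is cocompatible and $\{\mathcal W_x\cap\mathcal R_x\}$ is compatible. Then $(\Phi(\mathcal Q),\ \mathfrak C\text{-Mod}_{\mathcal W},\ \Psi(\mathcal R))$ is a Hovey triple in $\mathfrak C\text{-Mod}$. If moreover every $(\mathcal Q_x,\mathcal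 W_x,\mathcal R_x)$ is hereditary, then so is this Hovey triple. -/

import Mathlib

open CategoryTheory MulOpposite
open scoped TensorProduct DirectSum

universe u v w

noncomputable section

/-! ### Cotorsion pairs and Hovey triples in an abelian category -/

section Hovey

variable {𝒜 : Type w} [Category.{v} 𝒜] [Abelian 𝒜]

/-- `Ext¹(X, Y) = 0`. The universe in which the Ext groups live is immaterial. -/
def ExtOneVanishes (X Y : 𝒜) : Prop :=
  letI := HasExt.standard 𝒜
  Subsingleton (Abelian.Ext.{max w v} X Y 1)

/-- `(𝒞, 𝒟)` is a cotorsion pair: `𝒞^⊥ = 𝒟` and `^⊥𝒟 = 𝒞` with respect to `Ext¹`. -/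
structure IsCotorsionPair (𝒞 𝒟 : ObjectProperty 𝒜) : Prop where
  right_iff (M : 𝒜) : 𝒟 M ↔ ∀ X : 𝒜, 𝒞 X → ExtOneVanishes X M
  left_iff (M : 𝒜) : 𝒞 M ↔ ∀ Y : 𝒜, 𝒟 Y → ExtOneVanishes M Y

/-- A cotorsion pair is complete if every object `M` admits short exact sequences
`0 ⟶ D ⟶ C ⟶ M ⟶ 0` and `0 ⟶ M ⟶ D' ⟶ C' ⟶ 0` with `C, C' ∈ 𝒞` and `D, D' ∈ 𝒟`. -/
structure IsCompleteCotorsionPair (𝒞 𝒟 : ObjectProperty 𝒜) : Prop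
    extends IsCotorsionPair 𝒞 𝒟 where
  exists_left (M : 𝒜) : ∃ (D C : 𝒜) (i : D ⟶ C) (p : C ⟶ M) (h : i ≫ p = 0),
    (ShortComplex.mk i p h).ShortExact ∧ 𝒟 D ∧ 𝒞 C
  exists_right (M : 𝒜) : ∃ (D C : 𝒜) (i : M ⟶ D) (p : D ⟶ C) (h : i ≫ p = 0),
    (ShortComplex.mk i p h).ShortExact ∧ 𝒟 D ∧ 𝒞 C

/-- Closure under kernels of epimorphisms between objects of the class. -/
def ClosedUnderKernelsOfEpis (𝒮 : ObjectProperty 𝒜) : Prop :=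
  ∀ S : ShortComplex 𝒜, S.ShortExact → 𝒮 S.X₂ → 𝒮 S.X₃ → 𝒮 S.X₁

/-- Closure under cokernels of monomorphisms between objects of the class. -/
def ClosedUnderCokernelsOfMonos (𝒮 : ObjectProperty 𝒜) : Prop :=
  ∀ S : ShortComplex 𝒜, S.ShortExact → 𝒮 S.X₁ → 𝒮 S.X₂ → 𝒮 S.X₃

/-- Thick classes of objects: closed under direct summands (that is, retracts), extensions,
kernels of epimorphisms and cokernels of monomorphisms. -/
structure IsThick (𝒲 : ObjectProperty 𝒜) : Prop where
  summand : 𝒲.IsStableUnderRetracts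
  extension : 𝒲.IsClosedUnderExtensions
  kernel : ClosedUnderKernelsOfEpis 𝒲
  cokernel : ClosedUnderCokernelsOfMonos 𝒲

/-- Hovey triples. -/
structure IsHoveyTriple (𝒬 𝒲 ℛ : ObjectProperty 𝒜) : Prop where
  cofibrant : IsCompleteCotorsionPair 𝒬 (𝒲 ⊓ ℛ)
  trivially_cofibrant : IsCompleteCotorsionPair (𝒬 ⊓ 𝒲) ℛ
  thick : IsThick 𝒲

/-- A pair `(𝒞, 𝒟)` is hereditary if it is resolving and coresolving. -/
structure IsHereditaryPair (𝒞 𝒟 : ObjectProperty 𝒜) : Prop where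
  resolving : ClosedUnderKernelsOfEpis 𝒞
  coresolving : ClosedUnderCokernelsOfMonos 𝒟

/-- Hereditary Hovey triples: both cotorsion pairs of the triple are hereditary. -/
structure IsHereditaryHoveyTriple (𝒬 𝒲 ℛ : ObjectProperty 𝒜) : Prop
    extends IsHoveyTriple 𝒬 𝒲 ℛ where
  hereditary_cofibrant : IsHereditaryPair 𝒬 (𝒲 ⊓ ℛ)
  hereditary_trivially_cofibrant : IsHereditaryPair (𝒬 ⊓ 𝒲) ℛ

end Hovey

/-! ### Tensor products over a noncommutative ring -/

section Tensor

variable (B A M N : Type*) [Ring B] [Ring A] [AddCommGroup M] [Module B M] [Module Aᵐᵒᵖ M]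
  [AddCommGroup N] [Module A N]

/-- The relations `(m a) ⊗ n = m ⊗ (a n)` inside `M ⊗_ℤ N`. For a `(B, A)`-bimodule `M` the set of
generators is stable under `B`, so that the `B`-span is just the subgroup they generate. -/
def balancedRel : Submodule B (M ⊗[ℤ] N) :=
  Submodule.span B {t | ∃ (m : M) (a : A) (n : N), t = (op a • m) ⊗ₜ[ℤ] n - m ⊗ₜ[ℤ] (a • n)}

/-- The left `B`-module `M ⊗_A N`, for a `(B, A)`-bimodule `M` and a left `A`-module `N`. -/
def BalancedTensor : Type _ := (M ⊗[ℤ] N) ⧸ balancedRel B A M N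

instance : AddCommGroup (BalancedTensor B A M N) :=
  inferInstanceAs (AddCommGroup ((M ⊗[ℤ] N) ⧸ balancedRel B A M N))

instance : Module B (BalancedTensor B A M N) :=
  inferInstanceAs (Module B ((M ⊗[ℤ] N) ⧸ balancedRel B A M N))

end Tensor

/-! ### The abelian category of `k`-linear functors -/

section Modules

variable (k : Type u) [CommRing k] (C : Type u) [SmallCategory C] [Preadditive C] [Linear k C]

/-- The property of functors `C ⥤ k-Mod` of being `k`-linear. -/
def linearFunctorProp : ObjectProperty (C ⥤ ModuleCat.{u} k) :=
  fun F => F.Additive ∧ F.Linear k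

/-- Left `C`-modules: `k`-linear functors from `C` to `k`-modules. -/
abbrev CMod : Type (u + 1) := (linearFunctorProp k C).FullSubcategory

instance : (linearFunctorProp k C).IsClosedUnderSubobjects where
  prop_of_mono {F G} i _ hG := by
    obtain ⟨_, _⟩ := hG
    refine ⟨⟨fun {X Y f g} => ?_⟩, ⟨fun {X Y} f r => ?_⟩⟩
    · rw [← cancel_mono (i.app Y)]
      simp [Functor.map_add]
    · rw [← cancel_mono (i.app Y)]
      simp [Functor.map_smul]

instance : (linearFunctorProp k C).IsClosedUnderQuotients where
  prop_of_epi {F G} p _ hF := by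
    obtain ⟨_, _⟩ := hF
    refine ⟨⟨fun {X Y f g} => ?_⟩, ⟨fun {X Y} f r => ?_⟩⟩
    · rw [← cancel_epi (p.app X)]
      simp [← NatTrans.naturality, Functor.map_add]
    · rw [← cancel_epi (p.app X)]
      simp [← NatTrans.naturality, Functor.map_smul]

instance : (linearFunctorProp k C).ContainsZero where
  exists_zero := by
    refine ⟨_, Limits.isZero_zero _, ?_, ?_⟩
    · exact ⟨fun {X Y f g} => ((Functor.isZero_iff _).1 (Limits.isZero_zero _) X).eq_of_src _ _⟩
    · exact ⟨fun {X Y} f r => ((Functor.isZero_iff _).1 (Limits.isZero_zero _) X).eq_of_src _ _⟩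

instance : (linearFunctorProp k C).IsClosedUnderFiniteProducts where
  isClosedUnderLimitsOfShape J _ := ⟨by
    rintro F ⟨p⟩
    have hj (Y : C) {Z : ModuleCat k} (a b : Z ⟶ F.obj Y)
        (h : ∀ j, a ≫ (p.π.app j).app Y = b ≫ (p.π.app j).app Y) : a = b :=
      (Limits.isLimitOfPreserves ((evaluation C (ModuleCat k)).obj Y) p.isLimit).hom_ext h
    refine ⟨⟨fun {X Y f g} => hj Y _ _ fun j => ?_⟩, ⟨fun {X Y} f r => hj Y _ _ fun j => ?_⟩⟩
    · have := (p.prop_diag_obj j).1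
      simp [Functor.map_add]
    · have := (p.prop_diag_obj j).2
      simp [Functor.map_smul]⟩

end Modules

/-! ### Generalized `k`-linear Reedy categories -/

section Reedy

variable (k : Type u) [CommRing k] (C : Type u) [SmallCategory C] [Preadditive C] [Linear k C]

/-- A `k`-linear subcategory of `C` containing all objects. -/
structure WideLinearSubcategory where
  hom (x y : C) : Submodule k (x ⟶ y)
  id_mem (x : C) : 𝟙 x ∈ hom x x
  comp_mem {x y z : C} {f : x ⟶ y} {g : y ⟶ z} : f ∈ hom x y → g ∈ hom y z → f ≫ g ∈ hom x z

variable {k C} in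
/-- The endomorphism algebra of `x` in a subcategory, as a subalgebra of `C(x, x)`; the product
of `End x` is `f * g = f ∘ g`. -/
def WideLinearSubcategory.endAlg (D : WideLinearSubcategory k C) (x : C) :
    Subalgebra k (End x) where
  carrier := {f | f ∈ D.hom x x}
  mul_mem' hf hg := D.comp_mem hg hf
  add_mem' hf hg := (D.hom x x).add_mem hf hg
  algebraMap_mem' r := by
    rw [Algebra.algebraMap_eq_smul_one]
    exact (D.hom x x).smul_mem r (D.id_mem x)

/-- A small skeletal `k`-linear category with a degree function and two subcategories
`C⁺` and `C⁻` satisfying all axioms of a generalized `k`-linear Reedy category but the last one.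
(Every function from the small set of objects to ordinals is bounded by some ordinal.) -/
structure PreReedyStructure where
  skeletal : Skeletal C
  deg : C → Ordinal.{u}
  plus : WideLinearSubcategory k C
  minus : WideLinearSubcategory k C
  plus_deg (x y : C) : plus.hom x y ≠ ⊥ → x = y ∨ deg x < deg y
  minus_deg (x y : C) : minus.hom x y ≠ ⊥ → x = y ∨ deg y < deg x
  plus_eq_minus (x : C) : plus.hom x x = minus.hom x x

namespace PreReedyStructure

variable {k C} (R : PreReedyStructure k C)

/-- The algebra `A_x^0 = C⁺(x, x) = C⁻(x, x)`. -/
abbrev A (x : C) : Subalgebra k (End x) := R.plus.endAlg x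

/-- `C⁺(x, y)`. -/
abbrev Plus (x y : C) : Type u := R.plus.hom x y

/-- `C⁻(x, y)`. -/
abbrev Minus (x y : C) : Type u := R.minus.hom x y

variable {R} in
lemma mem_minus {x : C} (a : R.A x) : (a : End x) ∈ R.minus.hom x x :=
  R.plus_eq_minus x ▸ a.2

/-- `C⁺(x, y)` is a left `A_y^0`-module by composition. -/
instance (x y : C) : Module (R.A y) (R.Plus x y) where
  smul a f := ⟨f.1 ≫ a.1, R.plus.comp_mem f.2 a.2⟩
  one_smul f := Subtype.ext (Category.comp_id f.1)
  mul_smul a b f := Subtype.ext (Category.assoc f.1 b.1 a.1).symm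
  smul_zero _ := Subtype.ext Limits.zero_comp
  smul_add a f g := Subtype.ext (Preadditive.add_comp _ _ _ f.1 g.1 a.1)
  add_smul a b f := Subtype.ext (Preadditive.comp_add _ _ _ f.1 a.1 b.1)
  zero_smul _ := Subtype.ext Limits.comp_zero

/-- `C⁺(x, y)` is a right `A_x^0`-module by composition. -/
instance (x y : C) : Module (R.A x)ᵐᵒᵖ (R.Plus x y) where
  smul a f := ⟨a.unop.1 ≫ f.1, R.plus.comp_mem a.unop.2 f.2⟩
  one_smul f := Subtype.ext (Category.id_comp f.1)
  mul_smul a b f := Subtype.ext (Category.assoc a.unop.1 b.unop.1 f.1)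
  smul_zero _ := Subtype.ext Limits.comp_zero
  smul_add a f g := Subtype.ext (Preadditive.comp_add _ _ _ a.unop.1 f.1 g.1)
  add_smul a b f := Subtype.ext (Preadditive.add_comp _ _ _ a.unop.1 b.unop.1 f.1)
  zero_smul _ := Subtype.ext Limits.zero_comp

/-- `C⁻(x, y)` is a left `A_y^0`-module by composition. -/
instance (x y : C) : Module (R.A y) (R.Minus x y) where
  smul a f := ⟨f.1 ≫ a.1, R.minus.comp_mem f.2 (mem_minus a)⟩
  one_smul f := Subtype.ext (Category.comp_id f.1)
  mul_smul a b f := Subtype.ext (Category.assoc f.1 b.1 a.1).symm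
  smul_zero _ := Subtype.ext Limits.zero_comp
  smul_add a f g := Subtype.ext (Preadditive.add_comp _ _ _ f.1 g.1 a.1)
  add_smul a b f := Subtype.ext (Preadditive.comp_add _ _ _ f.1 a.1 b.1)
  zero_smul _ := Subtype.ext Limits.comp_zero

/-- `C⁻(x, y)` is a right `A_x^0`-module by composition. -/
instance (x y : C) : Module (R.A x)ᵐᵒᵖ (R.Minus x y) where
  smul a f := ⟨a.unop.1 ≫ f.1, R.minus.comp_mem (mem_minus a.unop) f.2⟩
  one_smul f := Subtype.ext (Category.id_comp f.1)
  mul_smul a b f := Subtype.ext (Category.assoc a.unop.1 b.unop.1 f.1)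
  smul_zero _ := Subtype.ext Limits.comp_zero
  smul_add a f g := Subtype.ext (Preadditive.comp_add _ _ _ a.unop.1 f.1 g.1)
  add_smul a b f := Subtype.ext (Preadditive.add_comp _ _ _ a.unop.1 b.unop.1 f.1)
  zero_smul _ := Subtype.ext Limits.zero_comp

/-- The composition map `C⁺(z, y) ⊗_{A_z^0} C⁻(x, z) ⟶ C(x, y)`, `f ⊗ g ↦ f ∘ g`. -/
def compTensor (x y z : C) :
    BalancedTensor (R.A y) (R.A z) (R.Plus z y) (R.Minus x z) →ₗ[R.A y] (x ⟶ y) :=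
  (balancedRel (R.A y) (R.A z) (R.Plus z y) (R.Minus x z)).liftQ
    (TensorProduct.AlgebraTensorModule.lift (LinearMap.mk₂' (R.A y) ℤ
      (fun (f : R.Plus z y) (g : R.Minus x z) => g.1 ≫ f.1)
      (fun f f' g => Preadditive.comp_add _ _ _ g.1 f.1 f'.1)
      (fun a f g => (Category.assoc g.1 f.1 a.1).symm)
      (fun f g g' => Preadditive.add_comp _ _ _ g.1 g'.1 f.1)
      (fun n f g => Preadditive.zsmul_comp g.1 f.1 n))) (by
    rw [balancedRel, Submodule.span_le]
    rintro _ ⟨f, a, g, rfl⟩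
    exact (map_sub _ _ _).trans (sub_eq_zero.2 (Category.assoc g.1 a.1 f.1).symm))

open Classical in
/-- The composition map `⨁_z C⁺(z, y) ⊗_{A_z^0} C⁻(x, z) ⟶ C(x, y)`. -/
def compMap (x y : C) :
    (⨁ z, BalancedTensor (R.A y) (R.A z) (R.Plus z y) (R.Minus x z)) →ₗ[R.A y] (x ⟶ y) :=
  DirectSum.toModule (R.A y) C _ fun z => R.compTensor x y z

end PreReedyStructure

/-- A generalized `k`-linear Reedy structure on the small `k`-linear category `C`: the
composition maps `⨁_z C⁺(z, y) ⊗_{A_z^0} C⁻(x, z) ⟶ C(x, y)` are moreover isomorphisms. -/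
structure GeneralizedReedyStructure extends PreReedyStructure k C where
  factorization (x y : C) : Function.Bijective (toPreReedyStructure.compMap x y)

end Reedy

/-! ### Latching and matching objects, and the induced classes of modules -/

namespace PreReedyStructure

variable {k : Type u} [CommRing k] {C : Type u} [SmallCategory C] [Preadditive C] [Linear k C]
  (R : PreReedyStructure k C)

section

variable (Y : CMod k C) (x : C)

/-- The ring homomorphism by which `A_x^0` acts on `Y(x)`. -/
def actionHom : R.A x →+* Module.End k (Y.obj.obj x) :=
  letI := Y.property.1
  { toFun := fun a => (Y.obj.map a.1).hom
    map_one' := by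
      change (Y.obj.map (𝟙 x)).hom = _
      simp
      rfl
    map_mul' := fun a b => by
      change (Y.obj.map (b.1 ≫ a.1)).hom = _
      simp
      rfl
    map_zero' := by
      change (Y.obj.map 0).hom = _
      simp
    map_add' := fun a b => by
      change (Y.obj.map (a.1 + b.1)).hom = _
      rw [Functor.map_add]
      rfl }

/-- The underlying type of `Y(x)`, as an `A_x^0`-module. -/
def Value (_ : PreReedyStructure k C) (Y : CMod k C) (x : C) : Type u := Y.obj.obj x

instance : AddCommGroup (R.Value Y x) := inferInstanceAs (AddCommGroup (Y.obj.obj x))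

/-- `A_x^0` acts on `Y(x)` by `a • v = Y(a)(v)`. -/
instance : Module (R.A x) (R.Value Y x) :=
  Module.compHom (Y.obj.obj x) (R.actionHom Y x)

/-- The objects of the full subcategory `C_α` for `α = d(x)`. -/
abbrev Below : Type u := {y : C // R.deg y < R.deg x}

open Classical in
/-- The relations `(f ∘ g) ⊗ v = f ⊗ Y(g)(v)`, for `g` in `C_α` with `α = d(x)`. The set of
generators is stable under `A_x^0`, so that the span is just the subgroup they generate. -/
def latchingRel : Submodule (R.A x) (⨁ y : R.Below x, (y.1 ⟶ x) ⊗[ℤ] Y.obj.obj y.1) :=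
  Submodule.span (R.A x) {t | ∃ (y y' : R.Below x) (g : y.1 ⟶ y'.1) (f : y'.1 ⟶ x)
    (v : Y.obj.obj y.1),
    t = DirectSum.lof (R.A x) (R.Below x) (fun y => (y.1 ⟶ x) ⊗[ℤ] Y.obj.obj y.1) y
          ((g ≫ f) ⊗ₜ[ℤ] v)
        - DirectSum.lof (R.A x) (R.Below x) (fun y => (y.1 ⟶ x) ⊗[ℤ] Y.obj.obj y.1) y'
          (f ⊗ₜ[ℤ] (Y.obj.map g).hom v)}

/-- The latching object `1_x C ⊗_{C_α} Res_α Y` of `Y` at `x`, where `α = d(x)`. -/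
abbrev Latching : Type u :=
  (⨁ y : R.Below x, (y.1 ⟶ x) ⊗[ℤ] Y.obj.obj y.1) ⧸ R.latchingRel Y x

open Classical in
/-- The latching map `1_x C ⊗_{C_α} Res_α Y ⟶ Y(x)`, `f ⊗ v ↦ Y(f)(v)`. -/
def latchingMap : R.Latching Y x →ₗ[R.A x] R.Value Y x :=
  (R.latchingRel Y x).liftQ
    (DirectSum.toModule (R.A x) (R.Below x) (R.Value Y x) fun y =>
      TensorProduct.AlgebraTensorModule.lift (LinearMap.mk₂' (R.A x) ℤ
        (fun (f : y.1 ⟶ x) (v : Y.obj.obj y.1) => ((Y.obj.map f).hom v : Y.obj.obj x))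
        (fun f f' v => by
          have := Y.property.1
          rw [Functor.map_add]; rfl)
        (fun a f v => by
          change (Y.obj.map (f ≫ a.1)).hom v = (Y.obj.map a.1).hom ((Y.obj.map f).hom v)
          simp)
        (fun f v v' => map_add _ v v')
        (fun n f v => map_zsmul _ n v))) (by
    rw [latchingRel, Submodule.span_le]
    rintro _ ⟨y, y', g, f, v, rfl⟩
    refine (map_sub _ _ _).trans (sub_eq_zero.2 ?_)
    erw [DirectSum.toModule_lof, DirectSum.toModule_lof]
    change (Y.obj.map (g ≫ f)).hom v = (Y.obj.map f).hom ((Y.obj.map g).hom v)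
    simp)

/-- The matching object `Hom_{C_α}(C 1_x, Res_α Y)` of `Y` at `x`, where `α = d(x)`: the `k`-linear
natural transformations from `C(x, -)` to `Y` on `C_α`. -/
def Matching : AddSubgroup (∀ y : R.Below x, (x ⟶ y.1) →ₗ[k] Y.obj.obj y.1) where
  carrier := {φ | ∀ (y y' : R.Below x) (f : x ⟶ y.1) (g : y.1 ⟶ y'.1),
    φ y' (f ≫ g) = (Y.obj.map g).hom (φ y f)}
  zero_mem' y y' f g := (map_zero (Y.obj.map g).hom).symm
  add_mem' {φ ψ} hφ hψ y y' f g := by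
    change φ y' (f ≫ g) + ψ y' (f ≫ g) = (Y.obj.map g).hom (φ y f + ψ y f)
    rw [hφ, hψ, map_add]
  neg_mem' {φ} hφ y y' f g := by
    change - φ y' (f ≫ g) = (Y.obj.map g).hom (- φ y f)
    rw [hφ, map_neg]

/-- `A_x^0` acts on the matching object by `(a • φ)(f) = φ(f ∘ a)`. -/
instance : Module (R.A x) (R.Matching Y x) where
  smul a φ := ⟨fun y => (φ.1 y).comp (Linear.leftComp k y.1 a.1), fun y y' f g => by
    change φ.1 y' (a.1 ≫ f ≫ g) = (Y.obj.map g).hom (φ.1 y (a.1 ≫ f))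
    rw [← φ.2 y y', Category.assoc]⟩
  one_smul φ := Subtype.ext <| funext fun y => LinearMap.ext fun f =>
    congrArg (φ.1 y) (Category.id_comp f)
  mul_smul a b φ := Subtype.ext <| funext fun y => LinearMap.ext fun f =>
    congrArg (φ.1 y) (Category.assoc b.1 a.1 f)
  smul_zero _ := rfl
  smul_add _ _ _ := rfl
  add_smul a b φ := Subtype.ext <| funext fun y => LinearMap.ext fun f =>
    (congrArg (φ.1 y) (Preadditive.add_comp _ _ _ a.1 b.1 f)).trans (map_add (φ.1 y) _ _)
  zero_smul φ := Subtype.ext <| funext fun y => LinearMap.ext fun f =>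
    (congrArg (φ.1 y) (Limits.zero_comp (f := f))).trans (map_zero (φ.1 y))

/-- The matching map `Y(x) ⟶ Hom_{C_α}(C 1_x, Res_α Y)`, `v ↦ (f ↦ Y(f)(v))`. -/
def matchingMap : R.Value Y x →ₗ[R.A x] R.Matching Y x where
  toFun v := ⟨fun y =>
      { toFun := fun f => (Y.obj.map f).hom v
        map_add' := fun f f' => by
          have := Y.property.1
          rw [Functor.map_add]; rfl
        map_smul' := fun r f => by
          have := Y.property.2
          rw [Functor.map_smul]; rfl },
    fun y y' f g => by
      change (Y.obj.map (f ≫ g)).hom v = (Y.obj.map g).hom ((Y.obj.map f).hom v)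
      rw [Functor.map_comp]; rfl⟩
  map_add' v w := Subtype.ext <| funext fun y => LinearMap.ext fun f =>
    map_add (Y.obj.map f).hom v w
  map_smul' a v := Subtype.ext <| funext fun y => LinearMap.ext fun f => by
    change (Y.obj.map f).hom ((Y.obj.map a.1).hom v) = (Y.obj.map (a.1 ≫ f)).hom v
    rw [Functor.map_comp]; rfl

end

/-- Families of classes of objects in the categories `A_x^0-Mod`. -/
abbrev ClassFamily : Type (u + 1) := ∀ x : C, ObjectProperty (ModuleCat.{u} (R.A x))

/-- The class `Φ(𝒮)`: every latching map is monic with cokernel in `𝒮_x`. -/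
def Phi (𝒮 : R.ClassFamily) : ObjectProperty (CMod k C) := fun Y =>
  ∀ x : C, Function.Injective (R.latchingMap Y x) ∧
    𝒮 x (ModuleCat.of (R.A x) (R.Value Y x ⧸ LinearMap.range (R.latchingMap Y x)))

/-- The class `Ψ(𝒮)`: every matching map is epic with kernel in `𝒮_x`. -/
def Psi (𝒮 : R.ClassFamily) : ObjectProperty (CMod k C) := fun Y =>
  ∀ x : C, Function.Surjective (R.matchingMap Y x) ∧
    𝒮 x (ModuleCat.of (R.A x) (LinearMap.ker (R.matchingMap Y x)))

/-- The class `C-Mod_𝒮` of modules `Y` with `Y(x)` in `𝒮_x` for all `x`. -/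
def Pointwise (𝒮 : R.ClassFamily) : ObjectProperty (CMod k C) := fun Y =>
  ∀ x : C, 𝒮 x (ModuleCat.of (R.A x) (R.Value Y x))

/-- The abelian group `Hom_{A_y^0}(C⁻(x, y), S)`. -/
def MinusHom (x y : C) (S : Type u) [AddCommGroup S] [Module (R.A y) S] : Type u :=
  R.Minus x y →ₗ[R.A y] S

section

variable (x y : C) (S : Type u) [AddCommGroup S] [Module (R.A y) S]

instance : AddCommGroup (R.MinusHom x y S) :=
  inferInstanceAs (AddCommGroup (R.Minus x y →ₗ[R.A y] S))

/-- `A_x^0` acts on `Hom_{A_y^0}(C⁻(x, y), S)` by `(a • φ)(f) = φ(f ∘ a)`. -/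
instance : Module (R.A x) (R.MinusHom x y S) where
  smul a φ :=
    { toFun := fun f => φ.toFun (op a • f)
      map_add' := fun f g => by
        rw [smul_add]; exact φ.map_add' _ _
      map_smul' := fun b f =>
        (congrArg φ.toFun (Subtype.ext (Category.assoc a.1 f.1 b.1).symm)).trans
          (φ.map_smul' b (op a • f)) }
  one_smul φ := LinearMap.ext fun f => congrArg φ.toFun (one_smul (R.A x)ᵐᵒᵖ f)
  mul_smul a b φ := LinearMap.ext fun f => congrArg φ.toFun (mul_smul (op b) (op a) f)
  smul_zero _ := rfl
  smul_add _ _ _ := rfl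
  add_smul a b φ := LinearMap.ext fun f =>
    (congrArg φ.toFun (add_smul (op a) (op b) f)).trans (φ.map_add' _ _)
  zero_smul φ := LinearMap.ext fun f =>
    (congrArg φ.toFun (zero_smul (R.A x)ᵐᵒᵖ f)).trans (LinearMap.map_zero φ)

end

/-- `𝒮` is cocompatible: `S ∈ 𝒮_y` implies `C⁺(y, x) ⊗_{A_y^0} S ∈ 𝒮_x`. -/
def Cocompatible (𝒮 : R.ClassFamily) : Prop :=
  ∀ (x y : C) (S : ModuleCat.{u} (R.A y)), 𝒮 y S →
    𝒮 x (ModuleCat.of (R.A x) (BalancedTensor (R.A x) (R.A y) (R.Plus y x) S))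

/-- `𝒮` is compatible: `S ∈ 𝒮_y` implies `Hom_{A_y^0}(C⁻(x, y), S) ∈ 𝒮_x`. -/
def Compatible (𝒮 : R.ClassFamily) : Prop :=
  ∀ (x y : C) (S : ModuleCat.{u} (R.A y)), 𝒮 y S →
    𝒮 x (ModuleCat.of (R.A x) (R.MinusHom x y S))

/-- `C⁺` is a projective right `C⁰`-module. As `C⁰` is the coproduct of the algebras `A_x^0`, this
means that all its components `C⁺(x, y)` are projective right `A_x^0`-modules. -/
def PlusRightProjective : Prop := ∀ x y : C, Module.Projective (R.A x)ᵐᵒᵖ (R.Plus x y)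

/-- `C⁻` is a projective left `C⁰`-module, that is, all its components `C⁻(x, y)` are projective
left `A_y^0`-modules. -/
def MinusLeftProjective : Prop := ∀ x y : C, Module.Projective (R.A y) (R.Minus x y)

end PreReedyStructure

end

/-!
The argument is an induction on the degree, in which everything is expressed through the relative
latching and matching maps.

By the factorization axiom the latching object of `Y` at `x` is the quotient of the sum of the
`C⁺(y, x) ⊗ Y(y)`, for `d(y) < d(x)`, by relations that involve `C⁺` only, and dually the matching
object involves `C⁻` only (`phi_iff`, `psi_iff`). As `C⁺(y, x)` is right projective, the cokernel `S`
of the relative latching map of `i : Y ⟶ X` at `y` contributes the layer `C⁺(y, x) ⊗ S` to the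
cokernel of `L_x Y ⟶ L_x X`. Extending maps over one object `y` at a time shows therefore that maps out of
`L_x X` can be lifted, relatively to `L_x Y`, along a surjection whose kernel is
`Ext¹`-orthogonal to all these layers (`Cone.exists_lift`; dually `Match.exists_lift`). In
particular, for `Y` in `Φ(𝒬 ∩ 𝒲)` the latching objects belong to `𝒬 ∩ 𝒲`, by cocompatibility
(`latch_mem`; dually `match_mem`).

For complete cotorsion pairs `(𝒬_x, 𝒱_x)` the pair `(Φ(𝒬), Ψ(𝒱))` is a complete cotorsion pair, with
no compatibility condition (`isCompleteCotorsionPair_phi_psi`). To give a section of an extension of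
`X` by `Y` at `x`, when it is known below `x`, is to give a diagonal filler for the latching map
of `X` and the relative matching map of the extension, whose kernel is that of the matching map of
`Y`; so the orthogonality of the pair at `x` suffices (`exists_section`). For the
approximation sequences, every morphism `Y ⟶ Z` is factored by recursion on the degree: when the
middle term `X` is known below `x`, its value at `x` is obtained by factoring the canonical map
from the pushout of `L_x X` and `Y(x)` over `L_x Y` to the pullback of `M_x X` and `Z(x)` over
`M_x Z` into an injection with cokernel in `𝒬_x` and a surjection with kernel in `𝒱_x`
(`exists_isStep`, `exists_factorization`). Here the canonical map `L_x X ⟶ M_x X` sends `p ⊗ v` to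
`m ↦ (m ∘ p) v`, and `m ∘ p` acts already below `x`, through its factorization. The factorizations
of `0 ⟶ M` and `M ⟶ 0` are the approximation sequences of `M`.

Applied to `(𝒬, 𝒲 ∩ ℛ)` and to `(𝒬 ∩ 𝒲, ℛ)` this gives both cotorsion pairs of the Hovey triple, as
`Φ(𝒬 ∩ 𝒲)` and `Ψ(𝒲 ∩ ℛ)` are the intersections of `Φ(𝒬)` and `Ψ(ℛ)` with the class of modules with
values in `𝒲` (`phi_inf`, `psi_inf`). Heredity is inherited because a short exact sequence of
modules whose last two terms belong to `Φ(𝒬)` induces short exact sequences of latching objects and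
of cokernels of the latching maps, and dually.
-/

noncomputable section

/-! ### Cotorsion pairs and extensions in an abelian category -/

section ExtOne

variable {𝒜 : Type w} [Category.{v} 𝒜] [Abelian 𝒜]

open HomologicalComplex in
/-- A resolution of `X` in nonpositive degrees ends with an epimorphism onto `X`. -/
lemma epi_f_zero_of_quasiIso_single {X : 𝒜} {K : CochainComplex 𝒜 ℤ}
    (s : K ⟶ (single 𝒜 (ComplexShape.up ℤ) 0).obj X) [K.IsStrictlyLE 0] [QuasiIsoAt s 0] :
    Epi (s.f 0) := by
  let e := K.iCyclesIso 0 1 (by simp)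
    ((K.isZero_of_isStrictlyLE 0 1 (by simp)).eq_of_tgt _ _)
  let α := e.inv ≫ K.homologyπ 0 ≫ homologyMap s 0 ≫ (singleObjHomologySelfIso _ _ _).hom
  have hα : s.f 0 = α ≫ (singleObjXSelf (ComplexShape.up ℤ) 0 X).inv := by
    rw [← cancel_epi e.hom]
    dsimp only [α]
    rw [Category.assoc, Category.assoc, Category.assoc, Iso.hom_inv_id_assoc,
      homologyπ_naturality_assoc, homologyπ_singleObjHomologySelfIso_hom_assoc,
      ← singleObjCyclesSelfIso_inv_iCycles, Iso.hom_inv_id_assoc]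
    exact (cyclesMap_i s 0).symm
  rw [hα]
  infer_instance

open DerivedCategory CochainComplex HomologicalComplex in
/-- Classes in `Ext¹` are effaceable: each one vanishes after pulling back along an epimorphism. -/
lemma exists_epi_comp_ext_one_eq_zero [HasExt.{u} 𝒜] {X Y : 𝒜} (e : Abelian.Ext.{u} X Y 1) :
    ∃ (E : 𝒜) (p : E ⟶ X) (_ : Epi p), (Abelian.Ext.mk₀ p).comp e (zero_add 1) = 0 := by
  -- Write `e` as a fraction `K ⟶ Y[1]` over a quasi-isomorphism `K ⟶ X`, with `K` concentrated in
  -- nonpositive degrees; then `K⁰ ⟶ X` is an epimorphism, and `K⁰ ⟶ K ⟶ Y[1]` is zero.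
  let := HasDerivedCategory.standard 𝒜
  let φ : Q.obj ((CochainComplex.singleFunctor 𝒜 0).obj X) ⟶
      Q.obj ((CochainComplex.singleFunctor 𝒜 (-1)).obj Y) :=
    e.hom ≫ ((DerivedCategory.singleFunctors 𝒜).shiftIso 1 (-1) 0 (by lia)).hom.app _
  obtain ⟨K, _, s, hs, g, hφ⟩ := right_fac_of_isStrictlyLE φ 0
  have hs' := hs
  rw [isIso_Q_map_iff_quasiIso] at hs'
  let s' : K ⟶ (single 𝒜 (ComplexShape.up ℤ) 0).obj X := s
  have : QuasiIso s' := hs'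
  let ι : (single 𝒜 (ComplexShape.up ℤ) 0).obj (K.X 0) ⟶ K :=
    mkHomFromSingle (𝟙 _) (by
      rintro j hj
      simp at hj
      exact (K.isZero_of_isStrictlyLE 0 j (by lia)).eq_of_tgt _ _)
  let p : K.X 0 ⟶ X := s'.f 0 ≫ (singleObjXSelf (ComplexShape.up ℤ) 0 X).hom
  have hp : Epi p := by
    have := epi_f_zero_of_quasiIso_single s'
    exact epi_comp _ _
  refine ⟨K.X 0, p, hp, ?_⟩
  have h1 : (single 𝒜 (ComplexShape.up ℤ) 0).map p = ι ≫ s' := by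
    apply HomologicalComplex.from_single_hom_ext
    rw [comp_f, mkHomFromSingle_f, Category.comp_id, single_map_f_self, Category.assoc,
      Iso.hom_inv_id, Category.comp_id]
  have h2 : (show (CochainComplex.singleFunctor 𝒜 0).obj (K.X 0) ⟶ K from ι) ≫ g = 0 := by
    apply HomologicalComplex.from_single_hom_ext
    apply (((CochainComplex.singleFunctor 𝒜 (-1)).obj Y).isZero_of_isStrictlyLE (-1) 0
      (by lia)).eq_of_tgt
  have h3 : Q.map ((CochainComplex.singleFunctor 𝒜 0).map p) ≫ φ = 0 := by
    have : (CochainComplex.singleFunctor 𝒜 0).map p =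
      (show (CochainComplex.singleFunctor 𝒜 0).obj (K.X 0) ⟶ K from ι) ≫ s := h1
    rw [hφ, this, Q.map_comp, Category.assoc, IsIso.hom_inv_id_assoc, ← Q.map_comp, h2,
      Q.map_zero]
  apply Abelian.Ext.homEquiv.injective
  change ((Abelian.Ext.mk₀ p).comp e (zero_add 1)).hom = Abelian.Ext.hom 0
  rw [← cancel_mono (((DerivedCategory.singleFunctors 𝒜).shiftIso 1 (-1) 0 (by lia)).hom.app Y)]
  rw [Abelian.Ext.comp_hom, Abelian.Ext.zero_hom, Limits.zero_comp, Abelian.Ext.mk₀_hom,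
    ShiftedHom.mk₀_comp, Category.assoc]
  exact h3

lemma ExtOneVanishes.eq_zero {X Y : 𝒜} (h : ExtOneVanishes X Y) :
    letI := HasExt.standard 𝒜
    ∀ e : Abelian.Ext.{max w v} X Y 1, e = 0 := by
  intro e
  exact @Subsingleton.elim _ h _ _

lemma ExtOneVanishes.exists_extension {S : ShortComplex 𝒜} (hS : S.ShortExact) {Y : 𝒜}
    (h : ExtOneVanishes S.X₃ Y) (u : S.X₁ ⟶ Y) : ∃ v : S.X₂ ⟶ Y, S.f ≫ v = u := by
  let := HasExt.standard 𝒜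
  obtain ⟨x, hx⟩ := Abelian.Ext.contravariant_sequence_exact₁ hS Y (Abelian.Ext.mk₀ u)
    (add_zero 1) (h.eq_zero _)
  obtain ⟨v, rfl⟩ := Abelian.Ext.mk₀_bijective _ _ |>.2 x
  exact ⟨v, (Abelian.Ext.mk₀_bijective _ _).1 (by rw [← hx, Abelian.Ext.mk₀_comp_mk₀])⟩

lemma ExtOneVanishes.exists_retraction {S : ShortComplex 𝒜} (hS : S.ShortExact)
    (h : ExtOneVanishes S.X₃ S.X₁) : ∃ r : S.X₂ ⟶ S.X₁, S.f ≫ r = 𝟙 _ :=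
  h.exists_extension hS _

lemma ExtOneVanishes.exists_section {S : ShortComplex 𝒜} (hS : S.ShortExact)
    (h : ExtOneVanishes S.X₃ S.X₁) : ∃ r : S.X₃ ⟶ S.X₂, r ≫ S.g = 𝟙 _ := by
  obtain ⟨r, hr⟩ := h.exists_retraction hS
  have := hS.mono_f
  have := hS.epi_g
  exact ⟨_, (ShortComplex.Splitting.ofExactOfRetraction S hS.exact r hr hS.epi_g).s_g⟩

/-- `Ext¹(X, Y)` vanishes as soon as every extension of `X` by `Y` splits. -/
lemma extOneVanishes_of_split {X Y : 𝒜}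
    (h : ∀ (E : 𝒜) (i : Y ⟶ E) (p : E ⟶ X) (w : i ≫ p = 0),
      (ShortComplex.mk i p w).ShortExact → ∃ s : X ⟶ E, s ≫ p = 𝟙 X) :
    ExtOneVanishes X Y := by
  let := HasExt.standard 𝒜
  refine subsingleton_of_forall_eq (0 : Abelian.Ext.{max w v} X Y 1) fun e => ?_
  -- Write `e` as the image of a map `u` on the kernel of an epimorphism effacing `e`.
  obtain ⟨E, p, _, hp⟩ := exists_epi_comp_ext_one_eq_zero e
  let S : ShortComplex 𝒜 := ShortComplex.mk (Limits.kernel.ι p) p (Limits.kernel.condition p)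
  have hS : S.ShortExact :=
    { exact := ShortComplex.exact_of_f_is_kernel _ (Limits.kernelIsKernel p) }
  obtain ⟨x, hx⟩ := Abelian.Ext.contravariant_sequence_exact₃ hS Y e hp (n₀ := 0) (add_zero 1)
  obtain ⟨u, rfl⟩ := Abelian.Ext.mk₀_bijective _ _ |>.2 x
  -- Pushing out `0 ⟶ ker p ⟶ E ⟶ X ⟶ 0` along `u` gives an extension with class `e`.
  let q : Limits.pushout u S.f ⟶ X := Limits.pushout.desc 0 p (by simp [S])
  have hq : Limits.pushout.inl u S.f ≫ q = 0 := Limits.pushout.inl_desc _ _ _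
  have hq' : Limits.pushout.inr u S.f ≫ q = p := Limits.pushout.inr_desc _ _ _
  have : Epi q := by
    have : Epi (Limits.pushout.inr u S.f ≫ q) := by rw [hq']; infer_instance
    exact epi_of_epi (Limits.pushout.inr u S.f) q
  have hT : (ShortComplex.mk (Limits.pushout.inl u S.f) q hq).ShortExact := by
    have hm : Mono S.f := hS.mono_f
    refine { exact := ShortComplex.exact_of_g_is_cokernel _ ?_, mono_f := ?_, epi_g := this }
    · refine Limits.CokernelCofork.IsColimit.ofπ' _ _ fun {Z} φ hφ => ?_
      have h0 : S.f ≫ Limits.pushout.inr u S.f ≫ φ = 0 := by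
        rw [← Limits.pushout.condition_assoc, hφ, Limits.comp_zero]
      have := hS.epi_g
      refine ⟨hS.exact.desc _ h0, ?_⟩
      apply Limits.pushout.hom_ext
      · rw [reassoc_of% hq, Limits.zero_comp]
        exact hφ.symm
      · rw [reassoc_of% hq']
        exact hS.exact.g_desc _ h0
    · dsimp
      infer_instance
  obtain ⟨s, hs⟩ := h _ _ _ _ hT
  obtain ⟨r, hr⟩ : ∃ r, Limits.pushout.inl u S.f ≫ r = 𝟙 Y :=
    ⟨_, (ShortComplex.Splitting.ofExactOfSection _ hT.exact s hs hT.mono_f).f_r⟩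
  rw [← hx]
  have hu : u = S.f ≫ Limits.pushout.inr u S.f ≫ r := by
    rw [← Limits.pushout.condition_assoc, hr, Category.comp_id]
  rw [hu, ← Abelian.Ext.mk₀_comp_mk₀, ShortComplex.ShortExact.extClass_comp_assoc]

lemma ExtOneVanishes.extension_left {S : ShortComplex 𝒜} (hS : S.ShortExact) {Y : 𝒜}
    (h₁ : ExtOneVanishes S.X₁ Y) (h₃ : ExtOneVanishes S.X₃ Y) : ExtOneVanishes S.X₂ Y := by
  let := HasExt.standard 𝒜
  refine subsingleton_of_forall_eq (0 : Abelian.Ext.{max w v} S.X₂ Y 1) fun e => ?_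
  obtain ⟨x, rfl⟩ := Abelian.Ext.contravariant_sequence_exact₂ hS Y e (h₁.eq_zero _)
  rw [h₃.eq_zero x, Abelian.Ext.comp_zero]

lemma ExtOneVanishes.retract_left {X X' Y : 𝒜} (h : ExtOneVanishes X Y) (r : Retract X' X) :
    ExtOneVanishes X' Y := by
  let := HasExt.standard 𝒜
  refine subsingleton_of_forall_eq (0 : Abelian.Ext.{max w v} X' Y 1) fun e => ?_
  rw [← Abelian.Ext.mk₀_id_comp e, ← r.retract, ← Abelian.Ext.mk₀_comp_mk₀_assoc,
    h.eq_zero ((Abelian.Ext.mk₀ r.r).comp e _), Abelian.Ext.comp_zero]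

lemma ExtOneVanishes.retract_right {X Y Y' : 𝒜} (h : ExtOneVanishes X Y) (r : Retract Y' Y) :
    ExtOneVanishes X Y' := by
  let := HasExt.standard 𝒜
  refine subsingleton_of_forall_eq (0 : Abelian.Ext.{max w v} X Y' 1) fun e => ?_
  rw [← Abelian.Ext.comp_mk₀_id e, ← r.retract, ← Abelian.Ext.mk₀_comp_mk₀,
    ← Abelian.Ext.comp_assoc_of_third_deg_zero, h.eq_zero (e.comp (Abelian.Ext.mk₀ r.i) _),
    Abelian.Ext.zero_comp]

variable {𝒞 𝒟 : ObjectProperty 𝒜}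

lemma IsCotorsionPair.ext_vanishes (h : IsCotorsionPair 𝒞 𝒟) {X Y : 𝒜} (hX : 𝒞 X) (hY : 𝒟 Y) :
    ExtOneVanishes X Y :=
  (h.right_iff Y).1 hY X hX

lemma IsCotorsionPair.left_retract (h : IsCotorsionPair 𝒞 𝒟) : 𝒞.IsStableUnderRetracts where
  of_retract r hY := (h.left_iff _).2 fun Z hZ => ((h.left_iff _).1 hY Z hZ).retract_left r

lemma IsCotorsionPair.right_retract (h : IsCotorsionPair 𝒞 𝒟) : 𝒟.IsStableUnderRetracts where
  of_retract r hY := (h.right_iff _).2 fun Z hZ => ((h.right_iff _).1 hY Z hZ).retract_right r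

lemma IsCotorsionPair.left_extension (h : IsCotorsionPair 𝒞 𝒟) {S : ShortComplex 𝒜}
    (hS : S.ShortExact) (h₁ : 𝒞 S.X₁) (h₃ : 𝒞 S.X₃) : 𝒞 S.X₂ :=
  (h.left_iff _).2 fun _ hZ => .extension_left hS (h.ext_vanishes h₁ hZ) (h.ext_vanishes h₃ hZ)

/-- The retract argument: two classes closed under retracts, orthogonal for `Ext¹` and admitting
approximation sequences on both sides form a complete cotorsion pair. -/
lemma IsCompleteCotorsionPair.of_approximations
    (hC : 𝒞.IsStableUnderRetracts) (hD : 𝒟.IsStableUnderRetracts)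
    (hExt : ∀ X Y, 𝒞 X → 𝒟 Y → ExtOneVanishes X Y)
    (exists_left : ∀ M : 𝒜, ∃ (D C : 𝒜) (i : D ⟶ C) (p : C ⟶ M) (h : i ≫ p = 0),
      (ShortComplex.mk i p h).ShortExact ∧ 𝒟 D ∧ 𝒞 C)
    (exists_right : ∀ M : 𝒜, ∃ (D C : 𝒜) (i : M ⟶ D) (p : D ⟶ C) (h : i ≫ p = 0),
      (ShortComplex.mk i p h).ShortExact ∧ 𝒟 D ∧ 𝒞 C) :
    IsCompleteCotorsionPair 𝒞 𝒟 where
  right_iff M := by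
    refine ⟨fun hM X hX => hExt X M hX hM, fun h => ?_⟩
    obtain ⟨D, C, i, p, hip, hS, hD', hC'⟩ := exists_right M
    obtain ⟨r, hr⟩ := (h C hC').exists_retraction hS
    exact hD.of_retract ⟨i, r, hr⟩ hD'
  left_iff M := by
    refine ⟨fun hM Y hY => hExt M Y hM hY, fun h => ?_⟩
    obtain ⟨D, C, i, p, hip, hS, hD', hC'⟩ := exists_left M
    obtain ⟨s, hs⟩ := (h D hD').exists_section hS
    exact hC.of_retract ⟨s, p, hs⟩ hC'
  exists_left := exists_left
  exists_right := exists_right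

end ExtOne

/-! ### Lifting and factorization for modules over a ring -/

section ModuleExt

variable {A : Type u} [Ring A]

section

variable {N M C K E F : Type u} [AddCommGroup N] [AddCommGroup M] [AddCommGroup C]
  [AddCommGroup K] [AddCommGroup E] [AddCommGroup F] [Module A N] [Module A M] [Module A C]
  [Module A K] [Module A E] [Module A F]

lemma moduleCat_shortExact {i : N →ₗ[A] M} {π : M →ₗ[A] C} (hi : Function.Injective i)
    (hπ : Function.Surjective π) (h : Function.Exact i π) :
    (ShortComplex.mk (ModuleCat.ofHom i) (ModuleCat.ofHom π)
      (by ext x; exact h.apply_apply_eq_zero x)).ShortExact :=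
  ModuleCat.shortComplex_shortExact _ h hi hπ

/-- The lifting lemma for extensions: in a commutative square from an injection with cokernel `C`
to a surjection with kernel `K` there is a diagonal filler, provided that `Ext¹(C, K) = 0`. -/
lemma exists_filler {i : N →ₗ[A] M} {π : M →ₗ[A] C} (hi : Function.Injective i)
    (hπ : Function.Surjective π) (hiπ : Function.Exact i π)
    {κ : K →ₗ[A] E} {p : E →ₗ[A] F} (hκ : Function.Injective κ) (hp : Function.Surjective p)
    (hκp : Function.Exact κ p)
    (hext : ExtOneVanishes (ModuleCat.of A C) (ModuleCat.of A K))
    (u : N →ₗ[A] E) (v : M →ₗ[A] F) (huv : p ∘ₗ u = v ∘ₗ i) :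
    ∃ g : M →ₗ[A] E, g ∘ₗ i = u ∧ p ∘ₗ g = v := by
  -- The pullback `P` of `p` and `v`, divided by the image of `(u, i)`, is an extension of `C`
  -- by `K`.
  let P : Submodule A (E × M) :=
    LinearMap.eqLocus (p ∘ₗ LinearMap.fst A E M) (v ∘ₗ LinearMap.snd A E M)
  let j : N →ₗ[A] P := (u.prod i).codRestrict P fun n => LinearMap.congr_fun huv n
  let Q := P ⧸ LinearMap.range j
  let α : K →ₗ[A] P := (κ.prod 0).codRestrict P fun k => by
    change p (κ k) = v 0
    rw [hκp.apply_apply_eq_zero, map_zero]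
  let a : K →ₗ[A] Q := (LinearMap.range j).mkQ ∘ₗ α
  let b : Q →ₗ[A] C := (LinearMap.range j).liftQ (π ∘ₗ LinearMap.snd A E M ∘ₗ P.subtype) (by
    rintro _ ⟨n, rfl⟩
    exact hiπ.apply_apply_eq_zero n)
  have ha : Function.Injective a := by
    rw [injective_iff_map_eq_zero]
    intro k hk
    obtain ⟨n, hn⟩ := (Submodule.Quotient.mk_eq_zero _).1 hk
    have h1 : u n = κ k := congrArg (fun t : P => t.1.1) hn
    have h2 : i n = 0 := congrArg (fun t : P => t.1.2) hn
    rw [(injective_iff_map_eq_zero i).1 hi n h2, map_zero] at h1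
    exact (injective_iff_map_eq_zero κ).1 hκ k h1.symm
  have hb : Function.Surjective b := by
    intro c
    obtain ⟨m, rfl⟩ := hπ c
    obtain ⟨e, he⟩ := hp (v m)
    exact ⟨(LinearMap.range j).mkQ ⟨(e, m), he⟩, rfl⟩
  have hab : Function.Exact a b := by
    intro q
    constructor
    · obtain ⟨⟨⟨e, m⟩, hem⟩, rfl⟩ := (LinearMap.range j).mkQ_surjective q
      intro hm
      obtain ⟨n, hn⟩ := (hiπ m).1 hm
      have : p (e - u n) = 0 := by
        rw [map_sub, show p (u n) = v (i n) from LinearMap.congr_fun huv n, hn]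
        exact sub_eq_zero.2 hem
      obtain ⟨k, hk⟩ := (hκp _).1 this
      refine ⟨k, ?_⟩
      refine (Submodule.Quotient.eq _).2 ⟨-n, Subtype.ext (Prod.ext ?_ ?_)⟩
      · change u (-n) = κ k - e
        rw [hk, map_neg]; abel
      · change i (-n) = 0 - m
        rw [map_neg, hn]; abel
    · rintro ⟨k, rfl⟩
      exact map_zero π
  obtain ⟨r, hr⟩ := ExtOneVanishes.exists_retraction (moduleCat_shortExact ha hb hab) hext
  let r' : Q →ₗ[A] K := r.hom
  have hr' : ∀ k, r' (a k) = k := fun k => congrArg (fun f => f.hom k) hr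
  -- The value of the filler at `m` is `γ (e, m)`, for any `e` with `p e = v m`.
  let γ : P →ₗ[A] E := LinearMap.fst A E M ∘ₗ P.subtype - κ ∘ₗ r' ∘ₗ (LinearMap.range j).mkQ
  have hγ : ∀ s t : P, s.1.2 = t.1.2 → γ s = γ t := by
    intro s t hst
    have hpst : p (s.1.1 - t.1.1) = 0 := by
      rw [map_sub, show p s.1.1 = v s.1.2 from s.2, show p t.1.1 = v t.1.2 from t.2, hst, sub_self]
    obtain ⟨k, hk⟩ := (hκp _).1 hpst
    have hs : s - t = α k := Subtype.ext (Prod.ext hk.symm (sub_eq_zero.2 hst))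
    rw [← sub_eq_zero, ← map_sub, hs]
    change κ k - κ (r' (a k)) = 0
    rw [hr', sub_self]
  have hsurj : ∀ m, ∃ t : P, t.1.2 = m := fun m => by
    obtain ⟨e, he⟩ := hp (v m)
    exact ⟨⟨(e, m), he⟩, rfl⟩
  choose σ hσ using hsurj
  refine ⟨{ toFun := fun m => γ (σ m), map_add' := fun m m' => ?_, map_smul' := fun c m => ?_ },
    ?_, ?_⟩
  · rw [← map_add]
    exact hγ _ _ (by rw [hσ]; exact (congrArg₂ (· + ·) (hσ m) (hσ m')).symm)
  · rw [RingHom.id_apply, ← map_smul]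
    exact hγ _ _ (by rw [hσ]; exact (congrArg (c • ·) (hσ m)).symm)
  · ext n
    refine (hγ _ (j n) (hσ _)).trans ?_
    change u n - κ (r' ((LinearMap.range j).mkQ (j n))) = u n
    rw [show (LinearMap.range j).mkQ (j n) = 0 from
      (Submodule.Quotient.mk_eq_zero _).2 ⟨n, rfl⟩, map_zero, map_zero, sub_zero]
  · ext m
    change p ((σ m).1.1 - κ _) = v m
    rw [map_sub, hκp.apply_apply_eq_zero, sub_zero, show p (σ m).1.1 = v (σ m).1.2 from (σ m).2,
      hσ]

end

lemma extOneVanishes_of_linear_split {X Y : Type u} [AddCommGroup X] [AddCommGroup Y]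
    [Module A X] [Module A Y]
    (h : ∀ (E : ModuleCat.{u} A) (i : Y →ₗ[A] E) (p : E →ₗ[A] X), Function.Injective i →
      Function.Surjective p → Function.Exact i p → ∃ s : X →ₗ[A] E, p ∘ₗ s = LinearMap.id) :
    ExtOneVanishes (ModuleCat.of A X) (ModuleCat.of A Y) := by
  refine extOneVanishes_of_split fun E i p w hS => ?_
  obtain ⟨s, hs⟩ := h E i.hom p.hom hS.moduleCat_injective_f hS.moduleCat_surjective_g
    ((ShortComplex.ShortExact.moduleCat_exact_iff_function_exact _).1 hS.exact)
  exact ⟨ModuleCat.ofHom s, ModuleCat.hom_ext hs⟩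

variable {𝒞 𝒟 : ObjectProperty (ModuleCat.{u} A)}

lemma ObjectProperty.IsStableUnderRetracts.of_linearEquiv (h : 𝒞.IsStableUnderRetracts)
    {X Y : Type u} [AddCommGroup X] [AddCommGroup Y] [Module A X] [Module A Y] (e : X ≃ₗ[A] Y)
    (hX : 𝒞 (ModuleCat.of A X)) : 𝒞 (ModuleCat.of A Y) :=
  h.of_retract (X := ModuleCat.of A Y) (Y := ModuleCat.of A X)
    ⟨ModuleCat.ofHom e.symm.toLinearMap, ModuleCat.ofHom e.toLinearMap, by ext x; simp⟩ hX

lemma ObjectProperty.IsStableUnderRetracts.of_linear_retract (h : 𝒞.IsStableUnderRetracts)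
    {X Y : Type u} [AddCommGroup X] [AddCommGroup Y] [Module A X] [Module A Y]
    (i : Y →ₗ[A] X) (r : X →ₗ[A] Y) (hir : ∀ y, r (i y) = y)
    (hX : 𝒞 (ModuleCat.of A X)) : 𝒞 (ModuleCat.of A Y) :=
  h.of_retract (X := ModuleCat.of A Y) (Y := ModuleCat.of A X)
    ⟨ModuleCat.ofHom i, ModuleCat.ofHom r, by ext x; simp [hir]⟩ hX

/-- Hovey's factorization: for a complete cotorsion pair `(𝒞, 𝒟)`, every linear map is an injection
with cokernel in `𝒞` followed by a surjection with kernel in `𝒟`. -/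
lemma IsCompleteCotorsionPair.exists_factorization (h : IsCompleteCotorsionPair 𝒞 𝒟)
    {P W : Type u} [AddCommGroup P] [AddCommGroup W] [Module A P] [Module A W] (c : P →ₗ[A] W) :
    ∃ (T : ModuleCat.{u} A) (i : P →ₗ[A] T) (q : T →ₗ[A] W), q ∘ₗ i = c ∧
      Function.Injective i ∧ 𝒞 (ModuleCat.of A (T ⧸ LinearMap.range i)) ∧
      Function.Surjective q ∧ 𝒟 (ModuleCat.of A (LinearMap.ker q)) := by
  -- `p : C ⟶ W` is a special precover, and `j` a special preenvelope of the kernel `K` of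
  -- `(c, p) : P × C ⟶ W`; the middle term is the pushout of `P × C` and `D'` over `K`.
  obtain ⟨D, C, a, p, hap, hS, hD, hC⟩ := h.exists_left (ModuleCat.of A W)
  let s : (P × C) →ₗ[A] W := c.coprod p.hom
  have hp : Function.Surjective p.hom := hS.moduleCat_surjective_g
  let K := LinearMap.ker s
  obtain ⟨D', C', j, g, hjg, hS', hD', hC'⟩ := h.exists_right (ModuleCat.of A K)
  have hj : Function.Injective j.hom := hS'.moduleCat_injective_f
  have hg : Function.Surjective g.hom := hS'.moduleCat_surjective_g
  have hjg' := (ShortComplex.ShortExact.moduleCat_exact_iff_function_exact _).1 hS'.exact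
  let δ : K →ₗ[A] (P × C) × D' := K.subtype.prod (-j.hom)
  let T := ((P × C) × D') ⧸ LinearMap.range δ
  let mk : ((P × C) × D') →ₗ[A] T := (LinearMap.range δ).mkQ
  have hmk : ∀ x, mk x = 0 ↔ ∃ k : K, (k.1, - j.hom k) = x := fun x =>
    (Submodule.Quotient.mk_eq_zero _).trans Iff.rfl
  have hmkδ : ∀ k : K, mk (k.1, 0) = mk (0, j.hom k) := fun k => by
    rw [← sub_eq_zero, ← map_sub, hmk]
    exact ⟨k, by simp⟩
  let iPC : (P × C) →ₗ[A] T := mk ∘ₗ LinearMap.inl A _ _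
  let i : P →ₗ[A] T := iPC ∘ₗ LinearMap.inl A _ _
  let q : T →ₗ[A] W := (LinearMap.range δ).liftQ (s ∘ₗ LinearMap.fst A _ _) (by
    rintro _ ⟨k, rfl⟩
    exact k.2)
  have hiPC : Function.Injective iPC := by
    rw [injective_iff_map_eq_zero]
    intro x hx
    obtain ⟨k, hk⟩ := (hmk _).1 hx
    have h2 : j.hom k = 0 := neg_eq_zero.1 (congrArg Prod.snd hk)
    have h1 := congrArg Prod.fst hk
    rw [(injective_iff_map_eq_zero j.hom).1 hj k h2] at h1
    exact h1.symm
  have hi : Function.Injective i := hiPC.comp (fun x y hxy => congrArg Prod.fst hxy)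
  -- The cokernel of `i` is an extension of `C'` by `C`.
  let α : C →ₗ[A] (T ⧸ LinearMap.range i) :=
    (LinearMap.range i).mkQ ∘ₗ iPC ∘ₗ LinearMap.inr A _ _
  let β : (T ⧸ LinearMap.range i) →ₗ[A] C' := (LinearMap.range i).liftQ
    ((LinearMap.range δ).liftQ (g.hom ∘ₗ LinearMap.snd A _ _) (by
      rintro _ ⟨k, rfl⟩
      change g.hom (-j.hom k) = 0
      rw [map_neg, neg_eq_zero]
      exact hjg'.apply_apply_eq_zero k)) (by
      rintro _ ⟨k, rfl⟩
      exact map_zero g.hom)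
  have hα : Function.Injective α := by
    rw [injective_iff_map_eq_zero]
    intro x hx
    obtain ⟨y, hy⟩ := (Submodule.Quotient.mk_eq_zero _).1 hx
    have := hiPC (a₁ := (y, 0)) (a₂ := (0, x)) hy
    exact (congrArg Prod.snd this).symm
  have hβ : Function.Surjective β := by
    intro x
    obtain ⟨y, rfl⟩ := hg x
    exact ⟨(LinearMap.range i).mkQ (mk (0, y)), rfl⟩
  have hαβ : Function.Exact α β := by
    intro x
    constructor
    · obtain ⟨x, rfl⟩ := (LinearMap.range i).mkQ_surjective x
      obtain ⟨⟨⟨x, y⟩, z⟩, rfl⟩ := (LinearMap.range δ).mkQ_surjective x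
      intro hz
      obtain ⟨k, rfl⟩ := (hjg' z).1 hz
      refine ⟨y + k.1.2, (Submodule.Quotient.eq _).2 ⟨-x - k.1.1, ?_⟩⟩
      change mk ((-x - k.1.1, 0), 0) = mk ((0, y + k.1.2), 0) - mk ((x, y), j.hom k)
      have : mk ((x, y), j.hom k) = mk ((x, y), 0) + mk (k.1, 0) := by
        rw [hmkδ, ← map_add]; simp
      rw [this, ← map_add, ← map_sub]
      congr 1
      refine Prod.ext (Prod.ext ?_ ?_) ?_
      · change -x - k.1.1 = 0 - (x + k.1.1); abel
      · change 0 = (y + k.1.2) - (y + k.1.2); abel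
      · change (0 : D') = 0 - (0 + 0); abel
    · rintro ⟨y, rfl⟩
      exact map_zero g.hom
  have hq : Function.Surjective q := by
    intro x
    obtain ⟨y, rfl⟩ := hp x
    exact ⟨mk ((0, y), 0), by change c 0 + p.hom y = _; rw [map_zero, zero_add]⟩
  -- The kernel of `q` is `D'`.
  let η : D' →ₗ[A] LinearMap.ker q := (mk ∘ₗ LinearMap.inr A _ _).codRestrict _ fun z => by
    change c 0 + p.hom 0 = 0
    rw [map_zero, map_zero, zero_add]
  have hη : Function.Bijective η := by
    constructor
    · rw [injective_iff_map_eq_zero]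
      intro z hz
      obtain ⟨k, hk⟩ := (hmk _).1 (congrArg Subtype.val hz)
      have h1 : k = 0 := Subtype.ext (congrArg Prod.fst hk)
      have h2 : -j.hom k = z := congrArg Prod.snd hk
      rw [← h2, h1, map_zero, neg_zero]
    · rintro ⟨x, hx⟩
      obtain ⟨⟨x, z⟩, rfl⟩ := (LinearMap.range δ).mkQ_surjective x
      refine ⟨z + j.hom ⟨x, hx⟩, Subtype.ext ?_⟩
      change mk (0, z + j.hom ⟨x, hx⟩) = mk (x, z)
      have h1 : mk (x, z) = mk (x, 0) + mk (0, z) := by rw [← map_add]; simp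
      rw [h1, hmkδ ⟨x, hx⟩, ← map_add]
      congr 1
      refine Prod.ext ?_ ?_
      · change (0 : P × C) = 0 + 0; abel
      · change z + _ = _ + z; abel
  refine ⟨ModuleCat.of A T, i, q, ?_, hi, ?_, hq, ?_⟩
  · ext x
    change c x + p.hom 0 = c x
    rw [map_zero, add_zero]
  · exact h.toIsCotorsionPair.left_extension (moduleCat_shortExact hα hβ hαβ) hC hC'
  · exact ObjectProperty.IsStableUnderRetracts.of_linearEquiv
      h.toIsCotorsionPair.right_retract (LinearEquiv.ofBijective η hη) hD'

end ModuleExt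

/-! ### The balanced tensor product -/

namespace BalancedTensor

section

variable {B A M N E : Type*} [Ring B] [Ring A] [AddCommGroup M] [Module B M] [Module Aᵐᵒᵖ M]
  [AddCommGroup N] [Module A N] [AddCommGroup E] [Module B E]

variable (B A) in
/-- The pure tensor `m ⊗ n` in `M ⊗_A N`. -/
def tmul (m : M) (n : N) : BalancedTensor B A M N :=
  (balancedRel B A M N).mkQ (m ⊗ₜ[ℤ] n)

lemma tmul_add (m : M) (n n' : N) : tmul B A m (n + n') = tmul B A m n + tmul B A m n' := by
  rw [tmul, TensorProduct.tmul_add, map_add]; rfl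

lemma add_tmul (m m' : M) (n : N) : tmul B A (m + m') n = tmul B A m n + tmul B A m' n := by
  rw [tmul, TensorProduct.add_tmul, map_add]; rfl

lemma smul_tmul (b : B) (m : M) (n : N) : tmul B A (b • m) n = b • tmul B A m n := by
  rw [tmul, ← TensorProduct.smul_tmul', map_smul]; rfl

lemma op_smul_tmul (m : M) (a : A) (n : N) : tmul B A (op a • m) n = tmul B A m (a • n) :=
  (Submodule.Quotient.eq _).2 (Submodule.subset_span ⟨m, a, n, rfl⟩)

variable (B A M N) in
/-- `m ⊗ n` as a biadditive map. -/
def tmulHom : M →+ N →+ BalancedTensor B A M N :=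
  AddMonoidHom.mk' (fun m => AddMonoidHom.mk' (tmul B A m) (tmul_add m))
    fun m m' => AddMonoidHom.ext (add_tmul m m')

@[simp] lemma tmul_zero (m : M) : tmul B A m (0 : N) = 0 := map_zero (tmulHom B A M N m)

@[elab_as_elim]
lemma induction_on {P : BalancedTensor B A M N → Prop} (t : BalancedTensor B A M N)
    (zero : P 0) (tmul : ∀ m n, P (tmul B A m n)) (add : ∀ s t, P s → P t → P (s + t)) : P t := by
  obtain ⟨t, rfl⟩ := (balancedRel B A M N).mkQ_surjective t
  induction t with
  | zero => rw [map_zero]; exact zero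
  | tmul m n => exact tmul m n
  | add s t hs ht => rw [map_add]; exact add _ _ hs ht

lemma hom_ext {G F : Type*} [AddCommMonoid G] [FunLike F (BalancedTensor B A M N) G]
    [AddMonoidHomClass F (BalancedTensor B A M N) G] {f g : F}
    (h : ∀ m n, f (tmul B A m n) = g (tmul B A m n)) : f = g :=
  DFunLike.ext _ _ fun t => by
    induction t using induction_on with
    | zero => rw [map_zero, map_zero]
    | tmul m n => exact h m n
    | add s t hs ht => rw [map_add, map_add, hs, ht]

/-- The linear map out of `M ⊗_A N` induced by a balanced map. -/
def lift (φ : M →+ N →+ E) (hB : ∀ (b : B) m n, φ (b • m) n = b • φ m n)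
    (hA : ∀ m (a : A) n, φ (op a • m) n = φ m (a • n)) : BalancedTensor B A M N →ₗ[B] E :=
  (balancedRel B A M N).liftQ (TensorProduct.AlgebraTensorModule.lift (LinearMap.mk₂' B ℤ
    (fun m n => φ m n) (fun m m' n => by rw [map_add]; rfl) (fun b m n => hB b m n)
    (fun m n n' => map_add _ n n') (fun c m n => map_zsmul (φ m) c n))) (by
    rw [balancedRel, Submodule.span_le]
    rintro _ ⟨m, a, n, rfl⟩
    exact (map_sub _ _ _).trans (sub_eq_zero.2 (hA m a n)))

@[simp] lemma lift_tmul (φ : M →+ N →+ E) (hB hA) (m : M) (n : N) :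
    lift (B := B) (A := A) φ hB hA (tmul B A m n) = φ m n := rfl

variable {N' : Type*} [AddCommGroup N'] [Module A N']

variable (B M) in
/-- Functoriality of `M ⊗_A N` in `N`. -/
def map (f : N →ₗ[A] N') : BalancedTensor B A M N →ₗ[B] BalancedTensor B A M N' :=
  lift (AddMonoidHom.mk' (fun m => (tmulHom B A M N' m).comp f.toAddMonoidHom)
      fun m m' => by ext n; exact add_tmul m m' (f n))
    (fun b m n => smul_tmul b m (f n))
    (fun m a n => (op_smul_tmul m a (f n)).trans (congrArg (tmul B A m) (map_smul f a n).symm))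

@[simp] lemma map_tmul (f : N →ₗ[A] N') (m : M) (n : N) :
    map B M f (tmul B A m n) = tmul B A m (f n) := rfl

lemma map_surjective {f : N →ₗ[A] N'} (hf : Function.Surjective f) :
    Function.Surjective (map B M f) := by
  intro t
  induction t using induction_on with
  | zero => exact ⟨0, map_zero _⟩
  | tmul m n =>
    obtain ⟨n, rfl⟩ := hf n
    exact ⟨tmul B A m n, rfl⟩
  | add s t hs ht =>
    obtain ⟨s, rfl⟩ := hs
    obtain ⟨t, rfl⟩ := ht
    exact ⟨s + t, map_add _ s t⟩

/-- The additive map out of `M ⊗_A N` induced by a balanced map into an abelian group, for a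
bimodule `M`. -/
def liftAddHom {E : Type*} [AddCommGroup E] [SMulCommClass B Aᵐᵒᵖ M] (φ : M →+ N →+ E)
    (hA : ∀ m (a : A) n, φ (op a • m) n = φ m (a • n)) : BalancedTensor B A M N →+ E :=
  QuotientAddGroup.lift (balancedRel B A M N).toAddSubgroup
    (TensorProduct.liftAddHom φ fun c m n => by simp) (by
    intro t ht
    suffices ∀ b : B, TensorProduct.liftAddHom φ (fun c m n => by simp) (b • t) = 0 by
      simpa using this 1
    induction ht using Submodule.span_induction with
    | mem t ht =>
      obtain ⟨m, a, n, rfl⟩ := ht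
      intro b
      rw [smul_sub, TensorProduct.smul_tmul', TensorProduct.smul_tmul', smul_comm b, map_sub,
        TensorProduct.liftAddHom_tmul, TensorProduct.liftAddHom_tmul, hA, sub_self]
    | zero => intro b; rw [smul_zero, map_zero]
    | add s t _ _ hs ht => intro b; rw [smul_add, map_add, hs, ht, add_zero]
    | smul c t _ ht => intro b; rw [smul_smul, ht])

end

/-- Projective right modules are flat. -/
lemma map_injective {B A M N N' : Type*} [Ring B] [Ring A] [AddCommGroup M] [Module B M]
    [Module Aᵐᵒᵖ M] [AddCommGroup N] [Module A N] [AddCommGroup N'] [Module A N']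
    [SMulCommClass B Aᵐᵒᵖ M] [hM : Module.Projective Aᵐᵒᵖ M] {f : N →ₗ[A] N'}
    (hf : Function.Injective f) : Function.Injective (map B M f) := by
  classical
  obtain ⟨s, hs⟩ := hM.out
  -- A section `s` of `A^(M) ⟶ M` embeds `M ⊗_A L` naturally, by `m ⊗ n ↦ ∑ q, s(m)_q n`, into the
  -- direct sum of copies of `L` indexed by `M`.
  let θN : BalancedTensor B A M N →+ (M →₀ N) :=
    liftAddHom (AddMonoidHom.mk' (fun m => AddMonoidHom.mk'
        (fun n => (s m).mapRange (fun a => a.unop • n) (by simp))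
        (fun n n' => by ext q; simp [smul_add]))
      (fun m m' => by ext n q; simp [add_smul]))
      (fun m a n => by ext q; simp [mul_smul])
  let θN' : BalancedTensor B A M N' →+ (M →₀ N') :=
    liftAddHom (AddMonoidHom.mk' (fun m => AddMonoidHom.mk'
        (fun n => (s m).mapRange (fun a => a.unop • n) (by simp))
        (fun n n' => by ext q; simp [smul_add]))
      (fun m m' => by ext n q; simp [add_smul]))
      (fun m a n => by ext q; simp [mul_smul])
  let ψ : (M →₀ N) →+ BalancedTensor B A M N := Finsupp.liftAddHom fun q => tmulHom B A M N q
  have hψ : ∀ t, ψ (θN t) = t := by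
    intro t
    refine DFunLike.congr_fun (hom_ext (f := ψ.comp θN) (g := AddMonoidHom.id _) fun m n => ?_) t
    change ψ ((s m).mapRange (fun a => a.unop • n) (by simp)) = tmul B A m n
    conv_rhs => rw [← hs m]
    rw [Finsupp.linearCombination_apply, Finsupp.liftAddHom_apply,
      Finsupp.sum_mapRange_index (by simp)]
    change _ = (tmulHom B A M N).flip n _
    rw [Finsupp.sum, Finsupp.sum, map_sum]
    exact Finset.sum_congr rfl fun q _ => (op_smul_tmul q ((s m) q).unop n).symm
  have hθ : ∀ t, θN' (map B M f t) = (θN t).mapRange f (map_zero f) := by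
    intro t
    refine DFunLike.congr_fun (hom_ext (f := θN'.comp (map B M f).toAddMonoidHom)
      (g := (Finsupp.mapRange.addMonoidHom f.toAddMonoidHom).comp θN) fun m n => ?_) t
    ext q
    exact (map_smul f _ n).symm
  intro t t' h
  rw [← hψ t, ← hψ t', Finsupp.mapRange_injective f (map_zero f) hf
    ((hθ t).symm.trans ((congrArg θN' h).trans (hθ t')))]

/-- Right exactness of the tensor product. -/
lemma map_exact {B A M N N' N'' : Type*} [Ring B] [Ring A] [AddCommGroup M] [Module B M]
    [Module Aᵐᵒᵖ M] [AddCommGroup N] [Module A N] [AddCommGroup N'] [Module A N']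
    [AddCommGroup N''] [Module A N''] {f : N →ₗ[A] N'} {g : N' →ₗ[A] N''}
    (hg : Function.Surjective g) (hfg : Function.Exact f g) :
    Function.Exact (map B M f) (map B M g) := by
  have h0 : ∀ t, map B M g (map B M f t) = 0 := by
    intro t
    refine DFunLike.congr_fun (hom_ext (f := map B M g ∘ₗ map B M f)
      (g := (0 : BalancedTensor B A M N →ₗ[B] _)) fun m n => ?_) t
    change tmul B A m (g (f n)) = 0
    rw [hfg.apply_apply_eq_zero, tmul_zero]
  -- `ρ` is the inverse of `(M ⊗ N') / im ⟶ M ⊗ N''`.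
  let π := (LinearMap.range (map B M f)).mkQ
  choose σ hσ using hg
  have key : ∀ m n' n'', g n' = g n'' → π (tmul B A m n') = π (tmul B A m n'') := by
    intro m n' n'' h
    obtain ⟨n, hn⟩ := (hfg (n' - n'')).1 (by rw [map_sub, h, sub_self])
    refine (Submodule.Quotient.eq _).2 ⟨tmul B A m n, ?_⟩
    rw [map_tmul, hn]
    exact map_sub (tmulHom B A M N' m) n' n''
  let ρ : BalancedTensor B A M N'' →ₗ[B] (BalancedTensor B A M N' ⧸ LinearMap.range (map B M f)) :=
    lift (AddMonoidHom.mk' (fun m => AddMonoidHom.mk' (fun n => π (tmul B A m (σ n)))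
        (fun n n' => by
          rw [← map_add, ← tmul_add]
          exact key _ _ _ (by rw [map_add, hσ, hσ, hσ])))
        (fun m m' => by ext n; exact (congrArg π (add_tmul m m' _)).trans (map_add π _ _)))
      (fun b m n => (congrArg π (smul_tmul b m _)).trans (map_smul π b _))
      (fun m a n => (congrArg π (op_smul_tmul m a _)).trans
        (key _ _ _ (by rw [map_smul, hσ, hσ])))
  have hρ : ∀ t, ρ (map B M g t) = π t := by
    intro t
    exact DFunLike.congr_fun (hom_ext (f := ρ ∘ₗ map B M g) (g := π) fun m n =>
      key _ _ _ (hσ (g n))) t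
  intro t
  constructor
  · intro ht
    have := hρ t
    rw [ht, map_zero] at this
    exact (Submodule.Quotient.mk_eq_zero _).1 this.symm
  · rintro ⟨t, rfl⟩
    exact h0 t

end BalancedTensor

/-! ### The bimodules of a Reedy category and the action on values -/

namespace PreReedyStructure

variable {k : Type u} [CommRing k] {C : Type u} [SmallCategory C] [Preadditive C] [Linear k C]
  (R : PreReedyStructure k C)

/-- The algebra `A_x^0`. Like `Pl` and `Mi` below, this is a type of its own and not a type of
elements of a submodule, so that instance search does not see the structure on `C(x, x)`. -/
def Alg (x : C) : Type u := R.A x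

/-- The bimodule `C⁺(x, y)`, as a type of its own. -/
def Pl (x y : C) : Type u := R.Plus x y

/-- The bimodule `C⁻(x, y)`, as a type of its own. -/
def Mi (x y : C) : Type u := R.Minus x y

instance (x : C) : Ring (R.Alg x) := inferInstanceAs (Ring (R.A x))

section

variable (x y : C)

instance : AddCommGroup (R.Pl x y) := inferInstanceAs (AddCommGroup (R.Plus x y))

instance : AddCommGroup (R.Mi x y) := inferInstanceAs (AddCommGroup (R.Minus x y))

instance : Module (R.Alg y) (R.Pl x y) := inferInstanceAs (Module (R.A y) (R.Plus x y))

instance : Module (R.Alg x)ᵐᵒᵖ (R.Pl x y) := inferInstanceAs (Module (R.A x)ᵐᵒᵖ (R.Plus x y))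

instance : Module (R.Alg y) (R.Mi x y) := inferInstanceAs (Module (R.A y) (R.Minus x y))

instance : Module (R.Alg x)ᵐᵒᵖ (R.Mi x y) := inferInstanceAs (Module (R.A x)ᵐᵒᵖ (R.Minus x y))

end

instance (Y : CMod k C) (x : C) : Module (R.Alg x) (R.Value Y x) :=
  inferInstanceAs (Module (R.A x) (R.Value Y x))

variable {R}

/-- The underlying endomorphism of an element of `A_x^0`. -/
def Alg.hom {x : C} : R.Alg x →+ (x ⟶ x) :=
  AddMonoidHom.mk' (fun a => Subtype.val (show R.A x from a)) fun _ _ => rfl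

/-- The underlying morphism of an element of `C⁺(x, y)`. -/
def Pl.hom {x y : C} : R.Pl x y →+ (x ⟶ y) :=
  AddMonoidHom.mk' (fun f => Subtype.val (show R.Plus x y from f)) fun _ _ => rfl

/-- The underlying morphism of an element of `C⁻(x, y)`. -/
def Mi.hom {x y : C} : R.Mi x y →+ (x ⟶ y) :=
  AddMonoidHom.mk' (fun f => Subtype.val (show R.Minus x y from f)) fun _ _ => rfl

lemma Pl.hom_injective {x y : C} : Function.Injective (Pl.hom (R := R) (x := x) (y := y)) :=
  fun _ _ h => Subtype.ext h

lemma Mi.hom_injective {x y : C} : Function.Injective (Mi.hom (R := R) (x := x) (y := y)) :=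
  fun _ _ h => Subtype.ext h

section

variable {x y z : C}

lemma Pl.hom_smul (a : R.Alg y) (f : R.Pl x y) : (a • f).hom = f.hom ≫ a.hom := rfl

lemma Pl.hom_op_smul (a : R.Alg x) (f : R.Pl x y) : (op a • f).hom = a.hom ≫ f.hom := rfl

/-- Composition in `C⁺`. -/
def Pl.comp (f : R.Pl x y) (g : R.Pl y z) : R.Pl x z :=
  show R.Plus x z from ⟨f.hom ≫ g.hom, R.plus.comp_mem f.2 g.2⟩

/-- Composition in `C⁻`. -/
def Mi.comp (f : R.Mi x y) (g : R.Mi y z) : R.Mi x z :=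
  show R.Minus x z from ⟨f.hom ≫ g.hom, R.minus.comp_mem f.2 g.2⟩

lemma Pl.hom_comp (f : R.Pl x y) (g : R.Pl y z) : (f.comp g).hom = f.hom ≫ g.hom := rfl

lemma Mi.hom_comp (f : R.Mi x y) (g : R.Mi y z) : (f.comp g).hom = f.hom ≫ g.hom := rfl

instance : SMulCommClass (R.Alg y) (R.Alg x)ᵐᵒᵖ (R.Pl x y) where
  smul_comm a b f := Pl.hom_injective (Category.assoc b.unop.hom f.hom a.hom)

instance : SMulCommClass (R.Alg y) (R.Alg x)ᵐᵒᵖ (R.Mi x y) where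
  smul_comm a b f := Mi.hom_injective (Category.assoc b.unop.hom f.hom a.hom)

/-- The elements of `C⁺(x, x)` are those of `A_x^0`. -/
def Pl.toAlg : R.Pl x x →+ R.Alg x := AddMonoidHom.mk' (fun f => f) fun _ _ => rfl

/-- The elements of `C⁻(x, x)` are those of `A_x^0`. -/
def Mi.toAlg : R.Mi x x →+ R.Alg x :=
  AddMonoidHom.mk' (fun f => show R.A x from ⟨f.hom, show f.hom ∈ R.plus.hom x x by
    rw [R.plus_eq_minus x]; exact f.2⟩) fun _ _ => rfl

variable (R x) in
/-- The identity of `x` in `C⁺`. -/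
def Pl.id : R.Pl x x := show R.Plus x x from ⟨𝟙 x, R.plus.id_mem x⟩

variable (R x) in
/-- The identity of `x` in `C⁻`. -/
def Mi.id : R.Mi x x := show R.Minus x x from ⟨𝟙 x, R.minus.id_mem x⟩

lemma Pl.hom_id : (Pl.id R x).hom = 𝟙 x := rfl

lemma Mi.hom_id : (Mi.id R x).hom = 𝟙 x := rfl

end

lemma Pl.eq_or_lt {x y : C} {f : R.Pl x y} (hf : f ≠ 0) : x = y ∨ R.deg x < R.deg y :=
  R.plus_deg x y fun h => hf (Subtype.ext ((Submodule.mem_bot k).1 (h ▸ f.2)))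

lemma Mi.eq_or_lt {x y : C} {f : R.Mi x y} (hf : f ≠ 0) : x = y ∨ R.deg y < R.deg x :=
  R.minus_deg x y fun h => hf (Subtype.ext ((Submodule.mem_bot k).1 (h ▸ f.2)))

variable (R) in
/-- The action `Y(x) ⟶ Y(y)` of a morphism of `C`. -/
def act (Y : CMod k C) {x y : C} (f : x ⟶ y) : R.Value Y x →+ R.Value Y y :=
  (Y.obj.map f).hom.toAddMonoidHom

section act

variable (Y : CMod k C) {x y z : C}

lemma act_comp (f : x ⟶ y) (g : y ⟶ z) (v : R.Value Y x) :
    R.act Y (f ≫ g) v = R.act Y g (R.act Y f v) := by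
  change (Y.obj.map (f ≫ g)).hom v = (Y.obj.map g).hom ((Y.obj.map f).hom v)
  rw [Functor.map_comp]; rfl

lemma act_id (v : R.Value Y x) : R.act Y (𝟙 x) v = v := by
  change (Y.obj.map (𝟙 x)).hom v = v
  rw [CategoryTheory.Functor.map_id]; rfl

lemma act_add (f g : x ⟶ y) (v : R.Value Y x) :
    R.act Y (f + g) v = R.act Y f v + R.act Y g v := by
  have := Y.property.1
  change (Y.obj.map (f + g)).hom v = (Y.obj.map f).hom v + (Y.obj.map g).hom v
  rw [Functor.map_add]; rfl

variable (R) in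
/-- The action of the morphisms of `C` as a biadditive map. -/
def actHom (x y : C) : (x ⟶ y) →+ R.Value Y x →+ R.Value Y y :=
  AddMonoidHom.mk' (fun f => R.act Y f) fun f g => AddMonoidHom.ext (act_add Y f g)

lemma act_zero (v : R.Value Y x) : R.act Y (0 : x ⟶ y) v = 0 :=
  DFunLike.congr_fun (map_zero (R.actHom Y x y)) v

lemma act_algebraMap (r : k) (v : R.Value Y x) :
    R.act Y (r • 𝟙 x) v = (r • (show Y.obj.obj x from v) : Y.obj.obj x) := by
  have := Y.property.2
  change (Y.obj.map (r • 𝟙 x)).hom v = _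
  rw [Functor.map_smul, CategoryTheory.Functor.map_id]; rfl

variable {Y} {Z : CMod k C}

variable (R) in
/-- The `A_x^0`-linear component at `x` of a morphism of `C`-modules. -/
def valueMap (φ : Y ⟶ Z) (x : C) : R.Value Y x →ₗ[R.Alg x] R.Value Z x where
  toFun v := (φ.hom.app x).hom v
  map_add' v w := map_add (φ.hom.app x).hom v w
  map_smul' a v := by
    exact congrArg (fun f => f.hom v) (φ.hom.naturality a.hom)

lemma valueMap_act (φ : Y ⟶ Z) (f : x ⟶ y) (v : R.Value Y x) :
    R.valueMap φ y (R.act Y f v) = R.act Z f (R.valueMap φ x v) :=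
  congrArg (fun f => f.hom v) (φ.hom.naturality f)

/-- A natural family of `A_x^0`-linear maps is a morphism of `C`-modules. -/
def homMk (φ : ∀ x, R.Value Y x →ₗ[R.Alg x] R.Value Z x)
    (hφ : ∀ (x y : C) (f : x ⟶ y) v, φ y (R.act Y f v) = R.act Z f (φ x v)) : Y ⟶ Z :=
  ObjectProperty.homMk
    { app := fun x => ModuleCat.ofHom (X := Y.obj.obj x) (Y := Z.obj.obj x)
        { toFun := fun v => φ x v
          map_add' := fun v w => map_add (φ x) v w
          map_smul' := fun r v =>
            (congrArg (φ x) (act_algebraMap (R := R) Y r v).symm).trans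
              ((hφ x x _ v).trans (act_algebraMap (R := R) Z r _)) }
      naturality := fun x y f => by
        ext v
        exact hφ x y f v }

end act

end PreReedyStructure

namespace GeneralizedReedyStructure

open PreReedyStructure

variable {k : Type u} [CommRing k] {C : Type u} [SmallCategory C] [Preadditive C] [Linear k C]
  (R : GeneralizedReedyStructure k C)

lemma compTensor_tmul {x y u : C} (p : R.Plus u y) (m : R.Minus x u) :
    R.compTensor x y u (BalancedTensor.tmul (R.A y) (R.A u) p m) = m.1 ≫ p.1 := rfl

open Classical in
lemma compMap_lof {x y u : C} (t : BalancedTensor (R.A y) (R.A u) (R.Plus u y) (R.Minus x u)) :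
    R.compMap x y (DirectSum.lof (R.A y) C
      (fun u => BalancedTensor (R.A y) (R.A u) (R.Plus u y) (R.Minus x u)) u t) =
      R.compTensor x y u t :=
  DirectSum.toModule_lof _ _ _

/-- Every morphism is a sum of morphisms of `C⁻` followed by morphisms of `C⁺`. -/
@[elab_as_elim]
lemma hom_induction {x y : C} {P : (x ⟶ y) → Prop} (f : x ⟶ y) (zero : P 0)
    (add : ∀ f g, P f → P g → P (f + g))
    (comp : ∀ (u : C) (_ : x = u ∨ R.deg u < R.deg x) (_ : u = y ∨ R.deg u < R.deg y)
      (m : R.Mi x u) (p : R.Pl u y), P (m.hom ≫ p.hom)) : P f := by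
  classical
  obtain ⟨t, rfl⟩ := (R.factorization x y).2 f
  induction t using DirectSum.induction_on with
  | zero => rw [map_zero]; exact zero
  | add s t hs ht => rw [map_add]; exact add _ _ hs ht
  | of u t =>
    change P (R.compMap x y (DirectSum.lof (R.A y) C _ u t))
    rw [compMap_lof]
    induction t using BalancedTensor.induction_on with
    | zero => rw [map_zero]; exact zero
    | add s t hs ht => rw [map_add]; exact add _ _ hs ht
    | tmul p m =>
      rw [compTensor_tmul]
      by_cases hm : m = 0
      · subst hm
        change P (0 ≫ p.1)
        rw [Limits.zero_comp]; exact zero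
      by_cases hp : p = 0
      · subst hp
        change P (m.1 ≫ 0)
        rw [Limits.comp_zero]; exact zero
      exact comp u (Mi.eq_or_lt (R := R.toPreReedyStructure) hm)
        (Pl.eq_or_lt (R := R.toPreReedyStructure) hp) m p

section homLift

variable {E : Type*} [AddCommGroup E] {x y : C}
  (B : ∀ u, R.deg u ≤ R.deg x → R.deg u ≤ R.deg y → R.Pl u y →+ R.Mi x u →+ E)
  (hB : ∀ u hx hy p (a : R.Alg u) m, B u hx hy (op a • p) m = B u hx hy p (a • m))

open Classical in
/-- By the factorization axiom, an additive map out of `C(x, y)` is given by a family of balanced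
maps on `C⁺(u, y) × C⁻(x, u)`; only objects `u` of degree at most `d(x)` and `d(y)` matter. -/
def homLift : (x ⟶ y) →+ E :=
  (DirectSum.toAddMonoid fun u =>
    if h : R.deg u ≤ R.deg x ∧ R.deg u ≤ R.deg y then
      BalancedTensor.liftAddHom (B := R.Alg y) (A := R.Alg u) (M := R.Pl u y) (N := R.Mi x u)
        (B u h.1 h.2) (hB u h.1 h.2)
    else 0).comp
    (LinearEquiv.ofBijective _ (R.factorization x y)).symm.toAddMonoidHom

lemma homLift_comp {u : C} (hx : R.deg u ≤ R.deg x) (hy : R.deg u ≤ R.deg y)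
    (m : R.Mi x u) (p : R.Pl u y) : R.homLift B hB (m.hom ≫ p.hom) = B u hx hy p m := by
  classical
  have : (LinearEquiv.ofBijective _ (R.factorization x y)).symm (m.hom ≫ p.hom) =
      DirectSum.lof (R.A y) C
        (fun u => BalancedTensor (R.A y) (R.A u) (R.Plus u y) (R.Minus x u)) u
        (BalancedTensor.tmul _ _ p m) := by
    rw [LinearEquiv.symm_apply_eq, LinearEquiv.ofBijective_apply, compMap_lof]
    rfl
  change DirectSum.toAddMonoid _ ((LinearEquiv.ofBijective _ (R.factorization x y)).symm _) = _
  rw [this]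
  refine (DirectSum.toAddMonoid_of _ _ _).trans ?_
  rw [dif_pos ⟨hx, hy⟩]
  rfl

end homLift

end GeneralizedReedyStructure

/-! ### Modules given by generators and relations -/

/-- The `A`-module with generators `G` and relations `g = ∑ aᵢ gᵢ`, for all `rel g [(aᵢ, gᵢ)]`. -/
def PresentedModule (A : Type*) [Ring A] {G : Type*} (rel : G → List (A × G) → Prop) : Type _ :=
  (G →₀ A) ⧸ Submodule.span A {t : G →₀ A | ∃ g L, rel g L ∧
    t = .single g 1 - (L.map fun c => Finsupp.single c.2 c.1).sum}

namespace PresentedModule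

variable {A : Type*} [Ring A] {G : Type*} {rel : G → List (A × G) → Prop}

instance : AddCommGroup (PresentedModule A rel) := inferInstanceAs (AddCommGroup (_ ⧸ _))

instance : Module A (PresentedModule A rel) := inferInstanceAs (Module A (_ ⧸ _))

variable (rel) in
/-- The generators of a presented module. -/
def gen (g : G) : PresentedModule A rel := Submodule.mkQ _ (Finsupp.single g (1 : A))

lemma gen_eq {g : G} {L : List (A × G)} (h : rel g L) :
    gen rel g = (L.map fun c => c.1 • gen rel c.2).sum := by
  have h1 : ∀ L : List (A × G), (L.map fun c => c.1 • gen rel c.2).sum = Submodule.mkQ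
      (Submodule.span A {t : G →₀ A | ∃ g L, rel g L ∧
        t = .single g 1 - (L.map fun c => Finsupp.single c.2 c.1).sum})
      (L.map fun c => Finsupp.single c.2 c.1).sum := by
    intro L
    induction L with
    | nil => exact (map_zero _).symm
    | cons c L ih =>
      rw [List.map_cons, List.sum_cons, ih, List.map_cons, List.sum_cons, map_add, gen]
      congr 1
      refine (map_smul (Submodule.mkQ _) c.1 _).symm.trans ?_
      rw [Finsupp.smul_single, smul_eq_mul, mul_one]
  rw [h1]
  exact (Submodule.Quotient.eq _).2 (Submodule.subset_span ⟨g, L, h, rfl⟩)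

@[elab_as_elim]
lemma induction_on {P : PresentedModule A rel → Prop} (t : PresentedModule A rel) (zero : P 0)
    (add : ∀ s t, P s → P t → P (s + t)) (smul_gen : ∀ (a : A) g, P (a • gen rel g)) : P t := by
  obtain ⟨t, rfl⟩ := Submodule.mkQ_surjective _ t
  induction t using Finsupp.induction_linear with
  | zero => rw [map_zero]; exact zero
  | add s t hs ht => rw [map_add]; exact add _ _ hs ht
  | single g a =>
    rw [← mul_one a, ← smul_eq_mul, ← Finsupp.smul_single]
    exact smul_gen a g

variable {E : Type*} [AddCommGroup E] [Module A E]

/-- The linear map out of a presented module given by its values on the generators. -/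
def lift (f : G → E) (h : ∀ g L, rel g L → f g = (L.map fun c => c.1 • f c.2).sum) :
    PresentedModule A rel →ₗ[A] E :=
  Submodule.liftQ _ (Finsupp.linearCombination A f) (by
    rw [Submodule.span_le]
    rintro _ ⟨g, L, hg, rfl⟩
    have h1 : ∀ L : List (A × G), Finsupp.linearCombination A f
        (L.map fun c => Finsupp.single c.2 c.1).sum = (L.map fun c => c.1 • f c.2).sum := by
      intro L
      induction L with
      | nil => simp
      | cons c L ih => simp [ih]
    change Finsupp.linearCombination A f _ = 0
    rw [map_sub, h1, Finsupp.linearCombination_single, one_smul, h g L hg, sub_self])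

@[simp] lemma lift_gen (f : G → E) (h) (g : G) : lift (rel := rel) f h (gen rel g) = f g := by
  refine (Finsupp.linearCombination_single A 1 g).trans (one_smul A _)

end PresentedModule

namespace PreReedyStructure

variable {k : Type u} [CommRing k] {C : Type u} [SmallCategory C] [Preadditive C] [Linear k C]

/-- The data of a module on the objects of degree less than `α`: an `A_y^0`-module for every such
object `y`, and the actions of the degree-raising part of `C⁺` and the degree-lowering part
of `C⁻`. No axioms are imposed: stages also serve as the raw data from which modules are built by
recursion on the degree. -/
structure Stage (R : PreReedyStructure k C) (α : Ordinal.{u}) where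
  obj : ∀ y, R.deg y < α → ModuleCat.{u} (R.Alg y)
  pl : ∀ (z y : C) (h : R.deg z < R.deg y) (hy : R.deg y < α),
    R.Pl z y →+ obj z (h.trans hy) →+ obj y hy
  mi : ∀ (y z : C) (h : R.deg z < R.deg y) (hy : R.deg y < α),
    R.Mi y z →+ obj y hy →+ obj z (h.trans hy)

variable {R : PreReedyStructure k C}

/-- Morphisms of stages. -/
structure Stage.Hom {α : Ordinal.{u}} (S S' : R.Stage α) where
  app : ∀ y hy, S.obj y hy →ₗ[R.Alg y] S'.obj y hy
  pl_app : ∀ z y h hy (p : R.Pl z y) v,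
    app y hy (S.pl z y h hy p v) = S'.pl z y h hy p (app z (h.trans hy) v)
  mi_app : ∀ y z h hy (m : R.Mi y z) v,
    app z (h.trans hy) (S.mi y z h hy m v) = S'.mi y z h hy m (app y hy v)

/-- The composition of morphisms of stages. -/
def Stage.Hom.comp {α : Ordinal.{u}} {S S' S'' : R.Stage α} (f : S.Hom S') (g : S'.Hom S'') :
    S.Hom S'' where
  app y hy := g.app y hy ∘ₗ f.app y hy
  pl_app _ _ _ _ _ _v := (congrArg _ (f.pl_app ..)).trans (g.pl_app ..)
  mi_app _ _ _ _ _ _v := (congrArg _ (f.mi_app ..)).trans (g.mi_app ..)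

variable (R) in
/-- The restriction of a `C`-module to the objects of degree less than `α`. -/
abbrev stage (Y : CMod k C) (α : Ordinal.{u}) : R.Stage α where
  obj y _ := ModuleCat.of (R.Alg y) (R.Value Y y)
  pl z y _ _ := (R.actHom Y z y).comp Pl.hom
  mi y z _ _ := (R.actHom Y y z).comp Mi.hom

variable (R) in
/-- The restriction of a morphism of `C`-modules. -/
def stageMap {Y Z : CMod k C} (f : Y ⟶ Z) (α : Ordinal.{u}) :
    (R.stage Y α).Hom (R.stage Z α) where
  app y _ := R.valueMap f y
  pl_app _ _ _ _ p v := valueMap_act f p.hom v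
  mi_app _ _ _ _ m v := valueMap_act f m.hom v

variable {x : C}

/-! ### The latching object -/

/-- Families of maps `C⁺(y, x) × S(y) ⟶ E`, for `y` of degree less than `d(x)`, compatible with the
action of `C⁺`: the same as linear maps from the latching object to `E`. -/
structure Cone (S : R.Stage (R.deg x)) (E : Type*) [AddCommGroup E] [Module (R.Alg x) E] where
  φ : ∀ (y : C) (hy : R.deg y < R.deg x), R.Pl y x →+ S.obj y hy →+ E
  smul : ∀ y hy (a : R.Alg x) p v, φ y hy (a • p) v = a • φ y hy p v
  bal : ∀ y hy (a : R.Alg y) p v, φ y hy (op a • p) v = φ y hy p (a • v)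
  comp : ∀ z y (h : R.deg z < R.deg y) (hy : R.deg y < R.deg x) (q : R.Pl z y) (p : R.Pl y x) v,
    φ z (h.trans hy) (q.comp p) v = φ y hy p (S.pl z y h hy q v)

section Latch

variable (S : R.Stage (R.deg x))

/-- The relations of the latching object between the generators `p ⊗ v`. -/
inductive LatchRel : (Σ y : R.Below x, R.Pl y.1 x × S.obj y.1 y.2) →
    List (R.Alg x × Σ y : R.Below x, R.Pl y.1 x × S.obj y.1 y.2) → Prop
  | add_left (y : R.Below x) (p p' : R.Pl y.1 x) (v : S.obj y.1 y.2) :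
    LatchRel ⟨y, p + p', v⟩ [(1, ⟨y, p, v⟩), (1, ⟨y, p', v⟩)]
  | add_right (y : R.Below x) (p : R.Pl y.1 x) (v v' : S.obj y.1 y.2) :
    LatchRel ⟨y, p, v + v'⟩ [(1, ⟨y, p, v⟩), (1, ⟨y, p, v'⟩)]
  | smul (y : R.Below x) (a : R.Alg x) (p : R.Pl y.1 x) (v : S.obj y.1 y.2) :
    LatchRel ⟨y, a • p, v⟩ [(a, ⟨y, p, v⟩)]
  | bal (y : R.Below x) (a : R.Alg y.1) (p : R.Pl y.1 x) (v : S.obj y.1 y.2) :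
    LatchRel ⟨y, op a • p, v⟩ [(1, ⟨y, p, a • v⟩)]
  | comp (z y : R.Below x) (h : R.deg z.1 < R.deg y.1) (q : R.Pl z.1 y.1) (p : R.Pl y.1 x)
    (v : S.obj z.1 z.2) :
    LatchRel ⟨z, q.comp p, v⟩ [(1, ⟨y, p, S.pl z.1 y.1 h y.2 q v⟩)]

/-- The latching object at `x`, presented in terms of `C⁺` only: the quotient of the sum of the
`C⁺(y, x) ⊗ S(y)`, for `d(y) < d(x)`, by the relations `p q ⊗ v = p ⊗ q v` with `q` in `C⁺`. -/
def Latch : Type u := PresentedModule (R.Alg x) (LatchRel S)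

instance : AddCommGroup (Latch S) := inferInstanceAs (AddCommGroup (PresentedModule _ _))

instance : Module (R.Alg x) (Latch S) := inferInstanceAs (Module (R.Alg x) (PresentedModule _ _))

namespace Latch

/-- The universal compatible family, given by the generators `p ⊗ v`. -/
def cone : Cone S (Latch S) where
  φ y hy := AddMonoidHom.mk' (fun p => AddMonoidHom.mk'
      (fun v => (PresentedModule.gen (LatchRel S) ⟨⟨y, hy⟩, p, v⟩ : PresentedModule _ _))
      fun v v' => (PresentedModule.gen_eq (LatchRel.add_right ⟨y, hy⟩ p v v')).trans (by simp; rfl))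
    fun p p' => AddMonoidHom.ext fun v =>
      (PresentedModule.gen_eq (LatchRel.add_left ⟨y, hy⟩ p p' v)).trans (by simp; rfl)
  smul y hy a p v := (PresentedModule.gen_eq (LatchRel.smul ⟨y, hy⟩ a p v)).trans (by simp; rfl)
  bal y hy a p v := (PresentedModule.gen_eq (LatchRel.bal ⟨y, hy⟩ a p v)).trans (by simp; rfl)
  comp z y h hy q p v := (PresentedModule.gen_eq
    (LatchRel.comp ⟨z, h.trans hy⟩ ⟨y, hy⟩ h q p v)).trans (by simp; rfl)

variable {S} {E : Type*} [AddCommGroup E] [Module (R.Alg x) E]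

/-- The linear map out of the latching object given by a compatible family. -/
def lift (c : Cone S E) : Latch S →ₗ[R.Alg x] E :=
  PresentedModule.lift (fun g => c.φ g.1.1 g.1.2 g.2.1 g.2.2) (by
    intro g L h
    induction h with
    | add_left y p p' v => simp
    | add_right y p v v' => simp
    | smul y a p v => simp [c.smul]
    | bal y a p v => simp [c.bal]
    | comp z y h q p v => simp [c.comp z.1 y.1 h y.2])

@[simp] lemma lift_cone (c : Cone S E) {y : C} (hy : R.deg y < R.deg x) (p : R.Pl y x)
    (v : S.obj y hy) : lift c ((cone S).φ y hy p v) = c.φ y hy p v :=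
  PresentedModule.lift_gen _ _ _

@[elab_as_elim]
lemma induction_on {P : Latch S → Prop} (t : Latch S) (zero : P 0)
    (add : ∀ s t, P s → P t → P (s + t))
    (cone : ∀ y hy p v, P ((cone S).φ y hy p v)) : P t := by
  induction t using PresentedModule.induction_on with
  | zero => exact zero
  | add s t hs ht => exact add _ _ hs ht
  | smul_gen a g =>
    have := cone g.1.1 g.1.2 (a • g.2.1) g.2.2
    rw [(Latch.cone S).smul] at this
    exact this

lemma hom_ext {G F : Type*} [AddCommMonoid G] [FunLike F (Latch S) G]
    [AddMonoidHomClass F (Latch S) G] {f g : F}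
    (h : ∀ y hy p v, f ((cone S).φ y hy p v) = g ((cone S).φ y hy p v)) : f = g :=
  DFunLike.ext _ _ fun t => by
    induction t using induction_on with
    | zero => rw [map_zero, map_zero]
    | add s t hs ht => rw [map_add, map_add, hs, ht]
    | cone y hy p v => exact h y hy p v

end Latch

variable {S} {S' : R.Stage (R.deg x)}

/-- Precomposition of a compatible family with a morphism of stages. -/
def Cone.precomp {E : Type*} [AddCommGroup E] [Module (R.Alg x) E] (c : Cone S' E) (f : S.Hom S') :
    Cone S E where
  φ y hy := AddMonoidHom.mk' (fun p => (c.φ y hy p).comp (f.app y hy).toAddMonoidHom)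
    fun p p' => by ext v; simp
  smul y hy a p v := c.smul y hy a p _
  bal y hy a p v := (c.bal y hy a p _).trans (congrArg _ (map_smul (f.app y hy) a v).symm)
  comp z y h hy q p v := (c.comp z y h hy q p _).trans (congrArg _ (f.pl_app z y h hy q v).symm)

/-- Postcomposition of a compatible family with a linear map. -/
def Cone.postcomp {E E' : Type*} [AddCommGroup E] [Module (R.Alg x) E] [AddCommGroup E']
    [Module (R.Alg x) E'] (c : Cone S E) (f : E →ₗ[R.Alg x] E') : Cone S E' where
  φ y hy := AddMonoidHom.mk' (fun p => f.toAddMonoidHom.comp (c.φ y hy p))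
    fun p p' => by ext v; simp
  smul y hy a p v := (congrArg f (c.smul y hy a p v)).trans (map_smul f a _)
  bal y hy a p v := congrArg f (c.bal y hy a p v)
  comp z y h hy q p v := congrArg f (c.comp z y h hy q p v)

/-- Functoriality of the latching object. -/
def Latch.map (f : S.Hom S') : Latch S →ₗ[R.Alg x] Latch S' :=
  Latch.lift ((Latch.cone S').precomp f)

@[simp] lemma Latch.map_cone (f : S.Hom S') {y : C} (hy : R.deg y < R.deg x) (p : R.Pl y x)
    (v : S.obj y hy) :
    Latch.map f ((Latch.cone S).φ y hy p v) = (Latch.cone S').φ y hy p (f.app y hy v) := by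
  rw [Latch.map, Latch.lift_cone]; rfl

end Latch

variable (R) in
/-- The action of `C⁺` on a `C`-module, as a compatible family. -/
def actCone (Y : CMod k C) (x : C) : Cone (R.stage Y (R.deg x)) (R.Value Y x) where
  φ y _ := (R.actHom Y y x).comp Pl.hom
  smul _ _ a p v := act_comp Y p.hom a.hom v
  bal _ _ a p v := act_comp Y a.hom p.hom v
  comp _ _ _ _ q p v := act_comp Y q.hom p.hom v

variable (R) in
/-- The latching map `p ⊗ v ↦ Y(p)(v)`. -/
def latch (Y : CMod k C) (x : C) : Latch (R.stage Y (R.deg x)) →ₗ[R.Alg x] R.Value Y x :=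
  Latch.lift (R.actCone Y x)

lemma latch_cone (Y : CMod k C) {y : C} (hy : R.deg y < R.deg x) (p : R.Pl y x)
    (v : (R.stage Y (R.deg x)).obj y hy) :
    R.latch Y x ((Latch.cone (R.stage Y (R.deg x))).φ y hy p v) = R.act Y p.hom v := by
  rw [latch, Latch.lift_cone]
  rfl

lemma latch_map {Y Z : CMod k C} (f : Y ⟶ Z) (t : Latch (R.stage Y (R.deg x))) :
    R.latch Z x (Latch.map (R.stageMap f _) t) = R.valueMap f x (R.latch Y x t) := by
  induction t using Latch.induction_on with
  | zero => simp
  | add s t hs ht => simp only [map_add, hs, ht]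
  | cone y hy p v =>
    rw [Latch.map_cone, latch_cone, latch_cone]
    exact (valueMap_act f p.hom v).symm

/-! ### The matching object -/

section Match

variable (S : R.Stage (R.deg x))

/-- The families of `A_y^0`-linear maps `φ_y : C⁻(x, y) ⟶ S(y)`, for `d(y) < d(x)`, such that
`φ(n m) = n φ(m)` for `n` in `C⁻`. -/
def matchSubgroup : AddSubgroup (∀ y : R.Below x, R.Mi x y.1 →+ S.obj y.1 y.2) where
  carrier := {φ | (∀ y (a : R.Alg y.1) m, φ y (a • m) = a • φ y m) ∧
    ∀ (y z : R.Below x) (h : R.deg z.1 < R.deg y.1) (m : R.Mi x y.1) (n : R.Mi y.1 z.1),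
      φ z (m.comp n) = S.mi y.1 z.1 h y.2 n (φ y m)}
  zero_mem' := ⟨fun _ _ _ => (smul_zero _).symm, fun _ _ _ _ _ => (map_zero _).symm⟩
  add_mem' {φ ψ} hφ hψ :=
    ⟨fun y a m => by
      change φ y (a • m) + ψ y (a • m) = a • (φ y m + ψ y m)
      rw [hφ.1, hψ.1, smul_add],
    fun y z h m n => by
      change φ z (m.comp n) + ψ z (m.comp n) = S.mi y.1 z.1 h y.2 n (φ y m + ψ y m)
      rw [hφ.2 y z h, hψ.2 y z h, map_add]⟩
  neg_mem' {φ} hφ :=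
    ⟨fun y a m => by
      change - φ y (a • m) = a • (- φ y m)
      rw [hφ.1, smul_neg],
    fun y z h m n => by
      change - φ z (m.comp n) = S.mi y.1 z.1 h y.2 n (- φ y m)
      rw [hφ.2 y z h, map_neg]⟩

/-- The matching object at `x`, in terms of `C⁻` only. -/
def Match : Type u := matchSubgroup S

instance : AddCommGroup (Match S) := inferInstanceAs (AddCommGroup (matchSubgroup S))

variable {S}

/-- The value `φ(m)` of an element of the matching object at a morphism `m` of `C⁻`. -/
def Match.eval (φ : Match S) {y : C} (hy : R.deg y < R.deg x) : R.Mi x y →+ S.obj y hy :=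
  φ.1 ⟨y, hy⟩

lemma Match.ext {φ ψ : Match S} (h : ∀ y hy m, φ.eval (y := y) hy m = ψ.eval hy m) : φ = ψ :=
  Subtype.ext (funext fun y => AddMonoidHom.ext (h y.1 y.2))

lemma Match.eval_smul (φ : Match S) {y : C} (hy : R.deg y < R.deg x) (a : R.Alg y)
    (m : R.Mi x y) : φ.eval hy (a • m) = a • φ.eval hy m := φ.2.1 ⟨y, hy⟩ a m

lemma Match.eval_comp (φ : Match S) {y z : C} (h : R.deg z < R.deg y) (hy : R.deg y < R.deg x)
    (m : R.Mi x y) (n : R.Mi y z) :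
    φ.eval (h.trans hy) (m.comp n) = S.mi y z h hy n (φ.eval hy m) :=
  φ.2.2 ⟨y, hy⟩ ⟨z, h.trans hy⟩ h m n

/-- Elements of the matching object from their values. -/
def Match.mk (φ : ∀ (y : C) (hy : R.deg y < R.deg x), R.Mi x y →+ S.obj y hy)
    (smul : ∀ y hy (a : R.Alg y) m, φ y hy (a • m) = a • φ y hy m)
    (comp : ∀ y z (h : R.deg z < R.deg y) (hy : R.deg y < R.deg x) (m : R.Mi x y) (n : R.Mi y z),
      φ z (h.trans hy) (m.comp n) = S.mi y z h hy n (φ y hy m)) : Match S :=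
  ⟨fun y => φ y.1 y.2, fun y => smul y.1 y.2, fun y z h => comp y.1 z.1 h y.2⟩

/-- `A_x^0` acts on the matching object by `(a • φ)(m) = φ(m ∘ a)`. -/
instance : Module (R.Alg x) (Match S) where
  smul a φ := Match.mk (fun _ hy => (φ.eval hy).comp (DistribSMul.toAddMonoidHom _ (op a)))
    (fun _ hy b m => (congrArg (φ.eval hy) (smul_comm b (op a) m).symm).trans (φ.eval_smul hy b _))
    (fun _ _ h hy m n =>
      (congrArg (φ.eval _) (Mi.hom_injective (Category.assoc a.hom m.hom n.hom).symm)).trans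
      (φ.eval_comp h hy (op a • m) n))
  one_smul φ := Match.ext fun _ hy m => congrArg (φ.eval hy) (one_smul _ m)
  mul_smul a b φ := Match.ext fun _ hy m => congrArg (φ.eval hy) (mul_smul (op b) (op a) m)
  smul_zero _ := rfl
  smul_add _ _ _ := rfl
  add_smul a b φ := Match.ext fun _ hy m =>
    (congrArg (φ.eval hy) (add_smul (op a) (op b) m)).trans (map_add (φ.eval hy) _ _)
  zero_smul φ := Match.ext fun _ hy m =>
    (congrArg (φ.eval hy) (zero_smul _ m)).trans (map_zero (φ.eval hy))

lemma Match.add_eval (φ ψ : Match S) {y : C} (hy : R.deg y < R.deg x)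
    (m : R.Mi x y) : (φ + ψ).eval hy m = φ.eval hy m + ψ.eval hy m := rfl

/-- Functoriality of the matching object. -/
def Match.map {S' : R.Stage (R.deg x)} (f : S.Hom S') : Match S →ₗ[R.Alg x] Match S' where
  toFun φ := Match.mk (fun y hy => (f.app y hy).toAddMonoidHom.comp (φ.eval hy))
    (fun y hy a m => (congrArg (f.app y hy) (φ.eval_smul hy a m)).trans (map_smul (f.app y hy) a _))
    (fun y z h hy m n => (congrArg (f.app z _) (φ.eval_comp h hy m n)).trans
      (f.mi_app y z h hy n _))
  map_add' _ _ψ := Match.ext fun y hy _ => map_add (f.app y hy) _ _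
  map_smul' _ _ := rfl

lemma Match.map_eval {S' : R.Stage (R.deg x)} (f : S.Hom S') (φ : Match S) {y : C}
    (hy : R.deg y < R.deg x) (m : R.Mi x y) :
    (Match.map f φ).eval hy m = f.app y hy (φ.eval hy m) := rfl

end Match

variable (R) in
/-- The matching map `v ↦ (m ↦ Y(m)(v))`. -/
def matching (Y : CMod k C) (x : C) : R.Value Y x →ₗ[R.Alg x] Match (R.stage Y (R.deg x)) where
  toFun v := Match.mk (fun y _ => ((R.actHom Y x y).comp Mi.hom).flip v)
    (fun _ _ a m => act_comp Y m.hom a.hom v) (fun _ _ _ _ m n => act_comp Y m.hom n.hom v)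
  map_add' v w := Match.ext fun _ _ m => map_add (R.act Y m.hom) v w
  map_smul' a v := Match.ext fun _ _ m => (act_comp Y a.hom m.hom v).symm

lemma matching_eval (Y : CMod k C) {y : C} (hy : R.deg y < R.deg x) (m : R.Mi x y)
    (v : R.Value Y x) : (R.matching Y x v).eval hy m = R.act Y m.hom v := rfl

lemma matching_map {Y Z : CMod k C} (f : Y ⟶ Z) (v : R.Value Y x) :
    Match.map (R.stageMap f _) (R.matching Y x v) = R.matching Z x (R.valueMap f x v) :=
  Match.ext fun _ _ m => valueMap_act f m.hom v

end PreReedyStructure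

namespace GeneralizedReedyStructure

open PreReedyStructure

variable {k : Type u} [CommRing k] {C : Type u} [SmallCategory C] [Preadditive C] [Linear k C]
  (R : GeneralizedReedyStructure k C)

/-! ### Comparison with the latching and matching maps over `C` -/

section Latching

variable (Y : CMod k C) (x : C)

instance : Module (R.Alg x) (R.Latching Y x) := inferInstanceAs (Module (R.A x) (R.Latching Y x))

instance (S : R.Stage (R.deg x)) : Module (R.A x) (Latch S) :=
  inferInstanceAs (Module (R.Alg x) (Latch S))

open Classical in
/-- The class of `f ⊗ v` in the latching object `1_x C ⊗_{C_α} Res_α Y`. -/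
def latchingTmul {y : C} (hy : R.deg y < R.deg x) : (y ⟶ x) →+ R.Value Y y →+ R.Latching Y x :=
  AddMonoidHom.mk' (fun f => AddMonoidHom.mk' (fun v => (R.latchingRel Y x).mkQ
      (DirectSum.lof (R.A x) (R.Below x) (fun y => (y.1 ⟶ x) ⊗[ℤ] Y.obj.obj y.1) ⟨y, hy⟩
        (f ⊗ₜ[ℤ] v)))
      (fun v v' => by
        rw [← map_add, ← map_add]
        exact congrArg _ (congrArg _ (TensorProduct.tmul_add _ _ _))))
    (fun f f' => by
      ext v
      refine Eq.trans ?_ (map_add (R.latchingRel Y x).mkQ _ _)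
      refine congrArg (R.latchingRel Y x).mkQ (Eq.trans ?_ (map_add _ _ _))
      exact congrArg _ (TensorProduct.add_tmul _ _ _))

lemma latchingTmul_comp {y z : C} (hy : R.deg y < R.deg x) (hz : R.deg z < R.deg x)
    (g : z ⟶ y) (f : y ⟶ x) (v : R.Value Y z) :
    R.latchingTmul Y x hz (g ≫ f) v = R.latchingTmul Y x hy f (R.act Y g v) :=
  (Submodule.Quotient.eq _).2 (Submodule.subset_span ⟨⟨z, hz⟩, ⟨y, hy⟩, g, f, v, rfl⟩)

lemma latchingTmul_smul {y : C} (hy : R.deg y < R.deg x) (f : y ⟶ x) (a : R.Alg x)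
    (v : R.Value Y y) :
    R.latchingTmul Y x hy (f ≫ a.hom) v = a • R.latchingTmul Y x hy f v := by
  classical
  refine Eq.trans ?_ (map_smul (R.latchingRel Y x).mkQ (show R.A x from a)
    (DirectSum.lof (R.A x) (R.Below x) (fun y => (y.1 ⟶ x) ⊗[ℤ] Y.obj.obj y.1) ⟨y, hy⟩
        (f ⊗ₜ[ℤ] v)))
  rw [← map_smul]
  rfl

lemma latchingMap_tmul {y : C} (hy : R.deg y < R.deg x) (f : y ⟶ x) (v : R.Value Y y) :
    R.latchingMap Y x (R.latchingTmul Y x hy f v) = R.act Y f v := by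
  classical
  refine (Submodule.liftQ_apply _ _ _).trans ?_
  erw [DirectSum.toModule_lof]
  rfl

/-- The comparison map from the latching object in terms of `C⁺` to the latching object in terms
of `C`. -/
def latchToLatching : Latch (R.stage Y (R.deg x)) →ₗ[R.Alg x] R.Latching Y x :=
  Latch.lift
    { φ := fun _ hy => (R.latchingTmul Y x hy).comp Pl.hom
      smul := fun _ hy a p v => R.latchingTmul_smul Y x hy p.hom a v
      bal := fun _ hy a p v => R.latchingTmul_comp Y x hy hy a.hom p.hom v
      comp := fun _ _ h hy q p v => R.latchingTmul_comp Y x hy (h.trans hy) q.hom p.hom v }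

lemma latchToLatching_cone {y : C} (hy : R.deg y < R.deg x) (p : R.Pl y x) (v) :
    R.latchToLatching Y x ((Latch.cone (R.stage Y (R.deg x))).φ y hy p v) =
      R.latchingTmul Y x hy p.hom v := by
  rw [latchToLatching, Latch.lift_cone]; rfl

lemma latchingMap_latchToLatching (t : Latch (R.stage Y (R.deg x))) :
    R.latchingMap Y x (R.latchToLatching Y x t) = R.latch Y x t := by
  induction t using Latch.induction_on with
  | zero => simp only [map_zero]
  | add s t hs ht => simp only [map_add, hs, ht]
  | cone y hy p v =>
    exact (congrArg _ (R.latchToLatching_cone Y x hy p v)).trans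
      ((R.latchingMap_tmul Y x hy p.hom v).trans (latch_cone Y hy p v).symm)

lemma latchToLatching_surjective : Function.Surjective (R.latchToLatching Y x) := by
  classical
  intro t
  obtain ⟨t, rfl⟩ := (R.latchingRel Y x).mkQ_surjective t
  induction t using DirectSum.induction_on with
  | zero => exact ⟨0, by rw [map_zero, map_zero]⟩
  | add s t hs ht =>
    obtain ⟨s', hs⟩ := hs
    obtain ⟨t', ht⟩ := ht
    exact ⟨s' + t', by rw [map_add, map_add, hs, ht]⟩
  | of y t =>
    induction t using TensorProduct.induction_on with
    | zero => exact ⟨0, by rw [map_zero, map_zero, map_zero]⟩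
    | add s t hs ht =>
      obtain ⟨s', hs⟩ := hs
      obtain ⟨t', ht⟩ := ht
      exact ⟨s' + t', by rw [map_add, map_add, map_add, hs, ht]⟩
    | tmul f v =>
      change ∃ s, _ = R.latchingTmul Y x y.2 f v
      induction f using R.hom_induction with
      | zero => exact ⟨0, by rw [map_zero, map_zero]; rfl⟩
      | add f g hf hg =>
        obtain ⟨s', hs⟩ := hf
        obtain ⟨t', ht⟩ := hg
        exact ⟨s' + t', by rw [map_add, map_add, hs, ht]; rfl⟩
      | comp u h h' m p =>
        have hu : R.deg u < R.deg x := by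
          rcases h with rfl | h
          exacts [y.2, h.trans y.2]
        refine ⟨(Latch.cone (R.stage Y (R.deg x))).φ u hu p (R.act Y m.hom v), ?_⟩
        refine (R.latchToLatching_cone Y x hu p _).trans ?_
        exact (R.latchingTmul_comp Y x hu y.2 m.hom p.hom v).symm

/-- The map `C(y, x) × Y(y) ⟶ L_x Y`, for `d(y) < d(x)`, into the latching object in terms
of `C⁺`: it sends `(p ∘ m, v)`, with `p` in `C⁺` and `m` in `C⁻`, to `p ⊗ m v`. -/
def latchHom {y : C} (hy : R.deg y < R.deg x) :
    (y ⟶ x) →+ R.Value Y y →+ Latch (R.stage Y (R.deg x)) :=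
  R.homLift (E := R.Value Y y →+ Latch (R.stage Y (R.deg x)))
    (fun u hu _ => AddMonoidHom.mk' (fun p =>
      (AddMonoidHom.compHom ((Latch.cone (R.stage Y (R.deg x))).φ u (hu.trans_lt hy) p)).comp
        ((R.actHom Y y u).comp Mi.hom)) fun p p' => by
      ext m v
      exact DFunLike.congr_fun
        (map_add ((Latch.cone (R.stage Y (R.deg x))).φ u (hu.trans_lt hy)) p p') _)
    (fun u hu _ p a m => by
      ext v
      refine ((Latch.cone (R.stage Y (R.deg x))).bal u (hu.trans_lt hy) a p _).trans ?_
      exact congrArg _ (act_comp Y m.hom a.hom v).symm)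

lemma latchHom_comp {y u : C} (hy : R.deg y < R.deg x) (hu : R.deg u < R.deg x)
    (hu' : R.deg u ≤ R.deg y) (m : R.Mi y u) (p : R.Pl u x) (v : R.Value Y y) :
    R.latchHom Y x hy (m.hom ≫ p.hom) v =
      (Latch.cone (R.stage Y (R.deg x))).φ u hu p (R.act Y m.hom v) := by
  rw [latchHom, R.homLift_comp _ _ hu' hu.le]
  rfl

/-- The relation `p q ⊗ v = p ⊗ q v` holds for all `q` in `C⁺`. -/
lemma latch_cone_comp {y u : C} (hy : R.deg y < R.deg x) (hu : u = y ∨ R.deg u < R.deg y)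
    (q : R.Pl u y) (p : R.Pl y x) (hux : R.deg u < R.deg x) (v : R.Value Y u) :
    (Latch.cone (R.stage Y (R.deg x))).φ u hux (q.comp p) v =
      (Latch.cone (R.stage Y (R.deg x))).φ y hy p (R.act Y q.hom v) := by
  rcases hu with rfl | h
  · exact (Latch.cone (R.stage Y (R.deg x))).bal u hux q.toAlg p v
  · exact (Latch.cone (R.stage Y (R.deg x))).comp u y h hy q p v

lemma latchHom_pl {y u : C} (hy : R.deg y < R.deg x) (hu : R.deg u < R.deg x)
    (f : y ⟶ u) (p : R.Pl u x) (v : R.Value Y y) :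
    R.latchHom Y x hy (f ≫ p.hom) v =
      (Latch.cone (R.stage Y (R.deg x))).φ u hu p (R.act Y f v) := by
  induction f using R.hom_induction with
  | zero =>
    rw [Limits.zero_comp, map_zero, act_zero]
    exact (map_zero _).symm
  | add f g hf hg =>
    rw [Preadditive.add_comp, map_add, act_add]
    refine (congrArg₂ (· + ·) hf hg).trans (map_add _ _ _).symm
  | comp w h h' m q =>
    have hw : R.deg w < R.deg x := by
      rcases h' with rfl | h'
      exacts [hu, h'.trans hu]
    have hw' : R.deg w ≤ R.deg y := by
      rcases h with rfl | h
      exacts [le_rfl, h.le]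
    rw [Category.assoc, ← Pl.hom_comp, R.latchHom_comp Y x hy hw hw', act_comp]
    exact R.latch_cone_comp Y x hu h' q p hw _

lemma latchHom_natural {y z : C} (hy : R.deg y < R.deg x) (hz : R.deg z < R.deg x)
    (g : z ⟶ y) (f : y ⟶ x) (v : R.Value Y z) :
    R.latchHom Y x hz (g ≫ f) v = R.latchHom Y x hy f (R.act Y g v) := by
  induction f using R.hom_induction with
  | zero => rw [Limits.comp_zero, map_zero, map_zero]; rfl
  | add f f' hf hf' =>
    rw [Preadditive.comp_add, map_add, map_add]
    exact congrArg₂ (· + ·) hf hf'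
  | comp u h h' m p =>
    have hu : R.deg u < R.deg x := by
      rcases h with rfl | h
      exacts [hy, h.trans hy]
    rw [← Category.assoc, R.latchHom_pl Y x hz hu, R.latchHom_pl Y x hy hu, act_comp]

lemma latchHom_smul {y : C} (hy : R.deg y < R.deg x) (f : y ⟶ x) (a : R.Alg x)
    (v : R.Value Y y) : R.latchHom Y x hy (f ≫ a.hom) v = a • R.latchHom Y x hy f v := by
  induction f using R.hom_induction with
  | zero => rw [Limits.zero_comp, map_zero]; exact (smul_zero _).symm
  | add f f' hf hf' =>
    rw [Preadditive.add_comp, map_add, map_add]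
    exact (congrArg₂ (· + ·) hf hf').trans (smul_add _ _ _).symm
  | comp u h h' m p =>
    have hu : R.deg u < R.deg x := by
      rcases h with rfl | h
      exacts [hy, h.trans hy]
    rw [Category.assoc, ← Pl.hom_smul, R.latchHom_pl Y x hy hu, R.latchHom_pl Y x hy hu]
    exact (Latch.cone (R.stage Y (R.deg x))).smul u hu a p _

open Classical in
/-- The inverse of the comparison map of latching objects. -/
def latchingToLatch : R.Latching Y x →ₗ[R.A x] Latch (R.stage Y (R.deg x)) :=
  (R.latchingRel Y x).liftQ
    (DirectSum.toModule (R.A x) (R.Below x) _ fun y =>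
      TensorProduct.AlgebraTensorModule.lift (LinearMap.mk₂' (R.A x) ℤ
        (fun (f : y.1 ⟶ x) (v : Y.obj.obj y.1) => R.latchHom Y x y.2 f v)
        (fun f f' v => by rw [map_add]; rfl)
        (fun a f v => R.latchHom_smul Y x y.2 f a v)
        (fun f v v' => map_add (R.latchHom Y x y.2 f) v v')
        (fun n f v => map_zsmul (R.latchHom Y x y.2 f) n v))) (by
    rw [latchingRel, Submodule.span_le]
    rintro _ ⟨y, y', g, f, v, rfl⟩
    refine (map_sub _ _ _).trans (sub_eq_zero.2 ?_)
    erw [DirectSum.toModule_lof, DirectSum.toModule_lof]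
    exact R.latchHom_natural Y x y'.2 y.2 g f v)

lemma latchingToLatch_tmul {y : C} (hy : R.deg y < R.deg x) (f : y ⟶ x) (v : R.Value Y y) :
    R.latchingToLatch Y x (R.latchingTmul Y x hy f v) = R.latchHom Y x hy f v := by
  classical
  refine (Submodule.liftQ_apply _ _ _).trans ?_
  erw [DirectSum.toModule_lof]
  rfl

lemma latchToLatching_injective : Function.Injective (R.latchToLatching Y x) := by
  have : ∀ t, R.latchingToLatch Y x (R.latchToLatching Y x t) = t := by
    intro t
    induction t using Latch.induction_on with
    | zero => simp only [map_zero]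
    | add s t hs ht => simp only [map_add, hs, ht]
    | cone y hy p v =>
      rw [latchToLatching_cone, latchingToLatch_tmul, ← Category.id_comp p.hom,
        R.latchHom_pl Y x hy hy]
      exact congrArg _ (act_id Y v)
  exact Function.LeftInverse.injective this

lemma latchingMap_injective_iff :
    Function.Injective (R.latchingMap Y x) ↔ Function.Injective (R.latch Y x) := by
  have : (R.latch Y x : Latch (R.stage Y (R.deg x)) → R.Value Y x) =
      R.latchingMap Y x ∘ R.latchToLatching Y x :=
    funext fun t => (R.latchingMap_latchToLatching Y x t).symm
  rw [this]
  exact ((Equiv.ofBijective _ ⟨R.latchToLatching_injective Y x,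
    R.latchToLatching_surjective Y x⟩).injective_comp _).symm

lemma mem_range_latchingMap_iff (v : R.Value Y x) :
    v ∈ LinearMap.range (R.latchingMap Y x) ↔ v ∈ LinearMap.range (R.latch Y x) := by
  constructor
  · rintro ⟨t, rfl⟩
    obtain ⟨t, rfl⟩ := R.latchToLatching_surjective Y x t
    exact ⟨t, (R.latchingMap_latchToLatching Y x t).symm⟩
  · rintro ⟨t, rfl⟩
    exact ⟨_, R.latchingMap_latchToLatching Y x t⟩

end Latching

section Matching

variable (Y : CMod k C) (x : C)

/-- The restriction of an element of the matching object to `C⁻`. -/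
def matchingToMatch (φ : R.Matching Y x) : Match (R.stage Y (R.deg x)) :=
  Match.mk (fun y hy => (φ.1 ⟨y, hy⟩).toAddMonoidHom.comp Mi.hom)
    (fun y hy a m => φ.2 ⟨y, hy⟩ ⟨y, hy⟩ m.hom a.hom)
    (fun y z h hy m n => φ.2 ⟨y, hy⟩ ⟨z, h.trans hy⟩ m.hom n.hom)

lemma matchingToMatch_injective : Function.Injective (R.matchingToMatch Y x) := by
  intro φ ψ h
  refine Subtype.ext (funext fun y => LinearMap.ext fun f => ?_)
  induction f using R.hom_induction with
  | zero => rw [map_zero, map_zero]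
  | add f g hf hg => rw [map_add, map_add, hf, hg]
  | comp u h1 h2 m p =>
    have hu : R.deg u < R.deg x := by
      rcases h2 with rfl | h2
      exacts [y.2, h2.trans y.2]
    have := congrArg (fun φ : Match (R.stage Y (R.deg x)) => φ.eval hu m) h
    refine (φ.2 ⟨u, hu⟩ y m.hom p.hom).trans (Eq.trans ?_ (ψ.2 ⟨u, hu⟩ y m.hom p.hom).symm)
    exact congrArg (Y.obj.map p.hom).hom this

variable {Y x}

/-- The extension `C(x, y) ⟶ Y(y)` of an element `φ` of the matching object in terms of `C⁻`,
with `p ∘ m ↦ p φ(m)` for `p` in `C⁺` and `m` in `C⁻`. -/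
def matchHom (φ : Match (R.stage Y (R.deg x))) {y : C} (hy : R.deg y < R.deg x) :
    (x ⟶ y) →+ R.Value Y y :=
  R.homLift (fun u _ hu => AddMonoidHom.mk' (fun p =>
      AddMonoidHom.comp (R.act Y p.hom) (φ.eval (hu.trans_lt hy)))
      fun p p' => by ext m; exact (congrFun (congrArg DFunLike.coe (congrArg (R.actHom Y u y)
        (map_add Pl.hom p p'))) _).trans (act_add Y p.hom p'.hom _))
    (fun u _ hu p a m => by
      refine (act_comp Y a.hom p.hom _).trans ?_
      exact congrArg (R.act Y p.hom) (φ.eval_smul (hu.trans_lt hy) a m).symm)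

lemma matchHom_comp (φ : Match (R.stage Y (R.deg x))) {y u : C} (hy : R.deg y < R.deg x)
    (hu : R.deg u < R.deg x) (hu' : R.deg u ≤ R.deg y) (m : R.Mi x u) (p : R.Pl u y) :
    R.matchHom φ hy (m.hom ≫ p.hom) = R.act Y p.hom (φ.eval hu m) :=
  R.homLift_comp _ _ hu.le hu' m p

lemma matchHom_mi (φ : Match (R.stage Y (R.deg x))) {y u : C} (hy : R.deg y < R.deg x)
    (hu : R.deg u < R.deg x) (m : R.Mi x u) (f : u ⟶ y) :
    R.matchHom φ hy (m.hom ≫ f) = R.act Y f (φ.eval hu m) := by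
  induction f using R.hom_induction with
  | zero => rw [Limits.comp_zero, map_zero, act_zero]
  | add f g hf hg => rw [Preadditive.comp_add, map_add, act_add, hf, hg]
  | comp w h h' n p =>
    have hw : R.deg w < R.deg x := by
      rcases h with rfl | h
      exacts [hu, h.trans hu]
    have hw' : R.deg w ≤ R.deg y := by
      rcases h' with rfl | h'
      exacts [le_rfl, h'.le]
    rw [← Category.assoc, ← Mi.hom_comp, R.matchHom_comp φ hy hw hw', act_comp]
    refine congrArg (R.act Y p.hom) ?_
    rcases h with rfl | h
    · exact φ.eval_smul hu n.toAlg m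
    · exact φ.eval_comp h hu m n

lemma matchHom_natural (φ : Match (R.stage Y (R.deg x))) {y z : C} (hy : R.deg y < R.deg x)
    (hz : R.deg z < R.deg x) (f : x ⟶ y) (g : y ⟶ z) :
    R.matchHom φ hz (f ≫ g) = R.act Y g (R.matchHom φ hy f) := by
  induction f using R.hom_induction with
  | zero => rw [Limits.zero_comp, map_zero, map_zero, map_zero]
  | add f f' hf hf' => rw [Preadditive.add_comp, map_add, map_add, map_add, hf, hf']
  | comp u h h' m p =>
    have hu : R.deg u < R.deg x := by
      rcases h' with rfl | h'
      exacts [hy, h'.trans hy]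
    rw [Category.assoc, R.matchHom_mi φ hz hu, R.matchHom_mi φ hy hu, act_comp]

lemma matchingToMatch_surjective : Function.Surjective (R.matchingToMatch Y x) := by
  intro φ
  refine ⟨⟨fun y => { toFun := fun f => R.matchHom φ y.2 f
                      map_add' := fun f g => map_add (R.matchHom φ y.2) f g
                      map_smul' := fun r f => ?_ },
    fun y y' f g => R.matchHom_natural φ y.2 y'.2 f g⟩, Match.ext fun y hy m => ?_⟩
  · rw [← Category.comp_id f, ← Linear.comp_smul, R.matchHom_natural φ y.2 y.2 f,
      Category.comp_id]
    exact act_algebraMap Y r _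
  · change R.matchHom φ hy m.hom = _
    rw [← Category.comp_id m.hom, R.matchHom_mi φ hy hy, act_id]

variable (Y x)

lemma matchingMap_surjective_iff :
    Function.Surjective (R.matchingMap Y x) ↔ Function.Surjective (R.matching Y x) := by
  have : (R.matching Y x : R.Value Y x → _) = R.matchingToMatch Y x ∘ R.matchingMap Y x := rfl
  rw [this]
  exact ((Equiv.ofBijective _ ⟨R.matchingToMatch_injective Y x,
    R.matchingToMatch_surjective⟩).comp_surjective _).symm

lemma mem_ker_matchingMap_iff (v : R.Value Y x) :
    v ∈ LinearMap.ker (R.matchingMap Y x) ↔ v ∈ LinearMap.ker (R.matching Y x) :=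
  ((R.matchingToMatch_injective Y x).eq_iff (b := 0)).symm

end Matching

section Classes

/-- The class `Φ(𝒮)` in terms of `C⁺` only. -/
lemma phi_iff (𝒮 : R.ClassFamily) (Y : CMod k C) :
    R.Phi 𝒮 Y ↔ ∀ x, Function.Injective (R.latch Y x) ∧
      𝒮 x (ModuleCat.of (R.Alg x) (R.Value Y x ⧸ LinearMap.range (R.latch Y x))) := by
  refine forall_congr' fun x => and_congr (R.latchingMap_injective_iff Y x) ?_
  have : LinearMap.range (R.latchingMap Y x) =
      (show Submodule (R.A x) (R.Value Y x) from
        (LinearMap.range (R.latch Y x) : Submodule (R.Alg x) (R.Value Y x))) :=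
    Submodule.ext (R.mem_range_latchingMap_iff Y x)
  rw [this]
  rfl

/-- The class `Ψ(𝒮)` in terms of `C⁻` only. -/
lemma psi_iff (𝒮 : R.ClassFamily) (Y : CMod k C) :
    R.Psi 𝒮 Y ↔ ∀ x, Function.Surjective (R.matching Y x) ∧
      𝒮 x (ModuleCat.of (R.Alg x) (LinearMap.ker (R.matching Y x))) := by
  refine forall_congr' fun x => and_congr (R.matchingMap_surjective_iff Y x) ?_
  have : LinearMap.ker (R.matchingMap Y x) =
      (show Submodule (R.A x) (R.Value Y x) from
        (LinearMap.ker (R.matching Y x) : Submodule (R.Alg x) (R.Value Y x))) :=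
    Submodule.ext (R.mem_ker_matchingMap_iff Y x)
  rw [this]
  rfl

end Classes

end GeneralizedReedyStructure

/-! ### Recursion on the degree -/

/-- A choice of elements `t x`, each related to the previous ones, exists as soon as every such
choice below `x` extends to `x`. -/
lemma exists_forall_of_exists_extension {C : Type*} {α : Type*} [Preorder α] [WellFoundedLT α]
    (deg : C → α) {T : C → Type*} [∀ x, Nonempty (T x)]
    (P : ∀ x, (∀ y, deg y < deg x → T y) → T x → Prop)
    (step : ∀ x (t : ∀ y, deg y < deg x → T y),
      (∀ y hy, P y (fun z hz => t z (hz.trans hy)) (t y hy)) → ∃ s, P x t s) :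
    ∃ t : ∀ x, T x, ∀ x, P x (fun y _ => t y) (t x) := by
  classical
  have wf : WellFounded fun y x : C => deg y < deg x := InvImage.wf deg wellFounded_lt
  let t : ∀ x, T x := wf.fix fun x ih =>
    if h : ∃ s, P x ih s then h.choose else Classical.arbitrary _
  refine ⟨t, fun x => wf.induction (C := fun x => P x (fun y _ => t y) (t x)) x fun x ih => ?_⟩
  obtain h := step x (fun y _ => t y) ih
  have : t x = h.choose := by
    change wf.fix _ x = _
    rw [wf.fix_eq]
    exact dif_pos h
  rw [this]
  exact h.choose_spec

lemma LinearMap.exists_comp_rangeRestrict {A : Type*} [Ring A] {L M G : Type*} [AddCommGroup L]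
    [AddCommGroup M] [AddCommGroup G] [Module A L] [Module A M] [Module A G] (τ : L →ₗ[A] M)
    (σ : L →ₗ[A] G) (h : ∀ t, τ t = 0 → σ t = 0) :
    ∃ g : LinearMap.range τ →ₗ[A] G, ∀ t, g (τ.rangeRestrict t) = σ t := by
  refine ⟨(LinearMap.ker τ).liftQ σ h ∘ₗ τ.quotKerEquivRange.symm.toLinearMap, fun t => ?_⟩
  have : τ.quotKerEquivRange.symm (τ.rangeRestrict t) = (LinearMap.ker τ).mkQ t := by
    rw [LinearEquiv.symm_apply_eq]; rfl
  change (LinearMap.ker τ).liftQ σ h (τ.quotKerEquivRange.symm _) = _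
  rw [this]; rfl

/-! ### Modules of homomorphisms out of a bimodule -/

/-- The left `A`-module `Hom_B(M, E)`, for a `(B, A)`-bimodule `M`, with `(a • φ)(m) = φ(m a)`. -/
def HomModule (B A M E : Type*) [Ring B] [Ring A] [AddCommGroup M] [Module B M] [Module Aᵐᵒᵖ M]
    [SMulCommClass B Aᵐᵒᵖ M] [AddCommGroup E] [Module B E] : Type _ := M →ₗ[B] E

namespace HomModule

variable {B A M E E' : Type*} [Ring B] [Ring A] [AddCommGroup M] [Module B M] [Module Aᵐᵒᵖ M]
    [SMulCommClass B Aᵐᵒᵖ M] [AddCommGroup E] [Module B E] [AddCommGroup E'] [Module B E']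

instance : AddCommGroup (HomModule B A M E) := inferInstanceAs (AddCommGroup (M →ₗ[B] E))

instance : FunLike (HomModule B A M E) M E := inferInstanceAs (FunLike (M →ₗ[B] E) M E)

instance : LinearMapClass (HomModule B A M E) B M E :=
  inferInstanceAs (LinearMapClass (M →ₗ[B] E) B M E)

lemma ext {φ ψ : HomModule B A M E} (h : ∀ m, φ m = ψ m) : φ = ψ := DFunLike.ext _ _ h

lemma add_apply (φ ψ : HomModule B A M E) (m : M) : (φ + ψ) m = φ m + ψ m := rfl

instance : Module A (HomModule B A M E) where
  smul a φ :=
    { toFun := fun m => φ (op a • m)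
      map_add' := fun m m' => by rw [smul_add, map_add]
      map_smul' := fun b m => by
        rw [← smul_comm b (op a) m, map_smul, RingHom.id_apply] }
  one_smul φ := ext fun m => congrArg φ (one_smul _ m)
  mul_smul a b φ := ext fun m => congrArg φ (mul_smul (op b) (op a) m)
  smul_zero _ := rfl
  smul_add _ _ _ := rfl
  add_smul a b φ := ext fun m => (congrArg φ (add_smul (op a) (op b) m)).trans (map_add φ _ _)
  zero_smul φ := ext fun m => (congrArg φ (zero_smul _ m)).trans (map_zero φ)

/-- An additive map to `Hom_B(M, E)` from a biadditive map. -/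
def mkHom {N : Type*} [AddCommGroup N] (f : N →+ M →+ E)
    (hB : ∀ n (b : B) m, f n (b • m) = b • f n m) : N →+ HomModule B A M E where
  toFun n := { toFun := f n, map_add' := map_add (f n), map_smul' := hB n }
  map_zero' := ext fun m => DFunLike.congr_fun (map_zero f) m
  map_add' n n' := ext fun m => DFunLike.congr_fun (map_add f n n') m

/-- A linear map to `Hom_B(M, E)` from a biadditive map. -/
def mk {N : Type*} [AddCommGroup N] [Module A N] (f : N →+ M →+ E)
    (hB : ∀ n (b : B) m, f n (b • m) = b • f n m)
    (hA : ∀ (a : A) n m, f (a • n) m = f n (op a • m)) :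
    N →ₗ[A] HomModule B A M E where
  __ := mkHom f hB
  map_smul' a n := ext fun m => hA a n m

/-- The adjunction between `M ⊗_A -` and `Hom_B(M, -)`. -/
def uncurry {N : Type*} [AddCommGroup N] [Module A N] (f : N →ₗ[A] HomModule B A M E) :
    BalancedTensor B A M N →ₗ[B] E :=
  BalancedTensor.lift (AddMonoidHom.mk' (fun m => AddMonoidHom.mk' (fun n => f n m)
      fun n n' => by rw [map_add, add_apply]) fun m m' => by ext n; exact map_add (f n) m m')
    (fun b m n => map_smul (f n) b m) (fun m a n => by
      exact (DFunLike.congr_fun (map_smul f a n) m).symm)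

@[simp] lemma uncurry_tmul {N : Type*} [AddCommGroup N] [Module A N]
    (f : N →ₗ[A] HomModule B A M E) (m : M) (n : N) :
    uncurry f (BalancedTensor.tmul B A m n) = f n m := rfl

variable (A M) in
/-- Functoriality of `Hom_B(M, -)`. -/
def map (f : E →ₗ[B] E') : HomModule B A M E →ₗ[A] HomModule B A M E' where
  toFun φ := (f ∘ₗ (show M →ₗ[B] E from φ) : M →ₗ[B] E')
  map_add' φ ψ := ext fun m => map_add f (φ m) (ψ m)
  map_smul' _ _ := rfl

lemma map_injective {f : E →ₗ[B] E'} (hf : Function.Injective f) :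
    Function.Injective (map A M f) := fun _ _ h => ext fun m => hf (DFunLike.congr_fun h m)

lemma map_surjective [Module.Projective B M] {f : E →ₗ[B] E'} (hf : Function.Surjective f) :
    Function.Surjective (map A M f) := fun φ => Module.projective_lifting_property f φ hf

lemma map_exact {K : Type*} [AddCommGroup K] [Module B K] {κ : K →ₗ[B] E} {f : E →ₗ[B] E'}
    (hκ : Function.Injective κ) (h : Function.Exact κ f) :
    Function.Exact (map A M κ) (map A M f) := by
  intro φ
  constructor
  · intro hφ
    have h' : ∀ m, ∃ c, κ c = φ m := fun m => (h (φ m)).1 (DFunLike.congr_fun hφ m)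
    choose g hg using h'
    refine ⟨{ toFun := g, map_add' := fun m m' => hκ ?_, map_smul' := fun b m => hκ ?_ }, ext hg⟩
    · rw [map_add, hg, hg, hg, map_add]
    · rw [map_smul, hg, hg, map_smul, RingHom.id_apply]
  · rintro ⟨ψ, rfl⟩
    exact ext fun m => h.apply_apply_eq_zero _

end HomModule

namespace PreReedyStructure

variable {k : Type u} [CommRing k] {C : Type u} [SmallCategory C] [Preadditive C] [Linear k C]
  (R : PreReedyStructure k C)

/-! ### Relative latching and matching maps, and lifting -/

section relative

variable {Y X Z : CMod k C}

/-- The relative latching map `(b, a) ↦ l_X(b) + i(a)` of `i : Y ⟶ X`, before dividing its source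
by the image of `L_x Y`. -/
def relLatch (i : Y ⟶ X) (x : C) :
    (Latch (R.stage X (R.deg x)) × R.Value Y x) →ₗ[R.Alg x] R.Value X x :=
  (R.latch X x).coprod (R.valueMap i x)

/-- The relative latching map of `i`, from the pushout of `L_x X` and `Y(x)` over `L_x Y`, is
injective. -/
def RelLatchInjective (i : Y ⟶ X) (x : C) : Prop :=
  ∀ b a, R.latch X x b + R.valueMap i x a = 0 →
    ∃ b', Latch.map (R.stageMap i _) b' = b ∧ R.latch Y x b' = -a

/-- The relative matching map `v ↦ (m_X(v), q(v))` of `q : X ⟶ Z`. -/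
def relMatch (q : X ⟶ Z) (x : C) :
    R.Value X x →ₗ[R.Alg x] Match (R.stage X (R.deg x)) × R.Value Z x :=
  (R.matching X x).prod (R.valueMap q x)

/-- The relative matching map of `q`, to the pullback of `M_x X` and `Z(x)` over `M_x Z`, is
surjective. -/
def RelMatchSurjective (q : X ⟶ Z) (x : C) : Prop :=
  ∀ φ z, Match.map (R.stageMap q _) φ = R.matching Z x z →
    ∃ v, R.matching X x v = φ ∧ R.valueMap q x v = z

end relative

variable {R}

lemma Pl.comp_add {x y z : C} (q : R.Pl z y) (p p' : R.Pl y x) :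
    q.comp (p + p') = q.comp p + q.comp p' :=
  Pl.hom_injective (Preadditive.comp_add _ _ _ q.hom p.hom p'.hom)

lemma Pl.add_comp {x y z : C} (q q' : R.Pl z y) (p : R.Pl y x) :
    (q + q').comp p = q.comp p + q'.comp p :=
  Pl.hom_injective (Preadditive.add_comp _ _ _ q.hom q'.hom p.hom)

lemma Mi.comp_add {x y z : C} (q : R.Mi z y) (p p' : R.Mi y x) :
    q.comp (p + p') = q.comp p + q.comp p' :=
  Mi.hom_injective (Preadditive.comp_add _ _ _ q.hom p.hom p'.hom)

lemma Mi.add_comp {x y z : C} (q q' : R.Mi z y) (p : R.Mi y x) :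
    (q + q').comp p = q.comp p + q'.comp p :=
  Mi.hom_injective (Preadditive.add_comp _ _ _ q.hom q'.hom p.hom)

/-- Composition of `q` with morphisms of `C⁺`, as a biadditive map. -/
def Pl.compHom {x y z : C} : R.Pl z y →+ R.Pl y x →+ R.Pl z x :=
  AddMonoidHom.mk' (fun q => AddMonoidHom.mk' (fun p => q.comp p) (Pl.comp_add q))
    fun q q' => AddMonoidHom.ext (Pl.add_comp q q')

/-- Composition in `C⁻` as a biadditive map. -/
def Mi.compHom {x y z : C} : R.Mi z y →+ R.Mi y x →+ R.Mi z x :=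
  AddMonoidHom.mk' (fun q => AddMonoidHom.mk' (fun p => q.comp p) (Mi.comp_add q))
    fun q q' => AddMonoidHom.ext (Mi.add_comp q q')

section LatchLift

variable {Y X : CMod k C} (i : Y ⟶ X) {x : C}

/-- Compatible families lift along a surjection `p` with kernel `K`, relatively to `i : Y ⟶ X`,
if `K` is `Ext¹`-orthogonal to the modules induced up along `C⁺` from the cokernels of the
relative latching maps of `i` below `x`. -/
theorem Cone.exists_lift (hproj : ∀ y, Module.Projective (R.Alg y)ᵐᵒᵖ (R.Pl y x))
    (hi : ∀ y, R.deg y < R.deg x → R.RelLatchInjective i y)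
    {E F K : Type u} [AddCommGroup E] [AddCommGroup F] [AddCommGroup K] [Module (R.Alg x) E]
    [Module (R.Alg x) F] [Module (R.Alg x) K] {κ : K →ₗ[R.Alg x] E} {p : E →ₗ[R.Alg x] F}
    (hκ : Function.Injective κ) (hp : Function.Surjective p) (hκp : Function.Exact κ p)
    (hext : ∀ y, R.deg y < R.deg x → ExtOneVanishes
      (ModuleCat.of (R.Alg x) (BalancedTensor (R.Alg x) (R.Alg y) (R.Pl y x)
        (R.Value X y ⧸ LinearMap.range (R.relLatch i y)))) (ModuleCat.of (R.Alg x) K))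
    (φ : Cone (R.stage X (R.deg x)) F) (ψ : Cone (R.stage Y (R.deg x)) E)
    (h : ∀ y hy q v, p (ψ.φ y hy q v) = φ.φ y hy q (R.valueMap i y v)) :
    ∃ Φ : Cone (R.stage X (R.deg x)) E, (∀ y hy q v, p (Φ.φ y hy q v) = φ.φ y hy q v) ∧
      ∀ y hy q v, Φ.φ y hy q (R.valueMap i y v) = ψ.φ y hy q v := by
  refine Exists.elim (exists_forall_of_exists_extension R.deg
    (T := fun y => R.Pl y x →+ R.Value X y →+ E)
    (fun y t s => ∀ hy : R.deg y < R.deg x,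
      ((∀ (a : R.Alg x) q v, s (a • q) v = a • s q v) ∧
      (∀ (a : R.Alg y) q v, s (op a • q) v = s q (a • v)) ∧
      (∀ z (hz : R.deg z < R.deg y) (q : R.Pl z y) (q' : R.Pl y x) v,
        t z hz (q.comp q') v = s q' (R.act X q.hom v))) ∧
      (∀ q v, p (s q v) = φ.φ y hy q v) ∧ ∀ q v, s q (R.valueMap i y v) = ψ.φ y hy q v)
      ?_) fun t ht =>
    ⟨{ φ := fun y _ => t y
       smul := fun y hy => (ht y hy).1.1
       bal := fun y hy => (ht y hy).1.2.1
       comp := fun z y hz hy => (ht y hy).1.2.2 z hz },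
      fun y hy => (ht y hy).2.1, fun y hy => (ht y hy).2.2⟩
  intro y t ht
  by_cases hy : R.deg y < R.deg x
  swap
  · exact ⟨0, fun h => (hy h).elim⟩
  replace ht := fun z hz => ht z hz (hz.trans hy)
  -- The values below `y` and the given values on `Y(y)` define `g` on the image `N` of the relative
  -- latching map at `y`.
  let G := HomModule (R.Alg x) (R.Alg y) (R.Pl y x) E
  let c : Cone (R.stage X (R.deg y)) G :=
    { φ := fun z hz => AddMonoidHom.mk'
        (fun q => HomModule.mkHom ((t z hz).comp (Pl.compHom q)).flip
          fun v b m => (congrArg (fun q => t z hz q v) (Pl.hom_injective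
            (Category.assoc q.hom m.hom b.hom).symm)).trans ((ht z hz).1.1 b (q.comp m) v))
        fun q q' => by
          ext v
          exact HomModule.ext fun m => DFunLike.congr_fun ((congrArg (t z hz)
            (Pl.add_comp q q' m)).trans (map_add (t z hz) _ _)) v
      smul := fun z hz a q v => HomModule.ext fun m => congrArg (fun q => t z hz q v)
        (Pl.hom_injective (Category.assoc q.hom a.hom m.hom))
      bal := fun z hz a q v => HomModule.ext fun m =>
        (congrArg (fun q => t z hz q v) (Pl.hom_injective
          (Category.assoc a.hom q.hom m.hom))).trans ((ht z hz).1.2.1 a (q.comp m) v)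
      comp := fun w z hw hz q q' v => HomModule.ext fun m =>
        (congrArg (fun q => t w _ q v) (Pl.hom_injective
          (Category.assoc q.hom q'.hom m.hom))).trans ((ht z hz).1.2.2 w hw q (q'.comp m) v) }
  let μ : R.Value Y y →ₗ[R.Alg y] G := HomModule.mk (ψ.φ y hy).flip
    (fun v a q => ψ.smul y hy a q v) (fun a v q => (ψ.bal y hy a q v).symm)
  obtain ⟨g, hg⟩ := (R.relLatch i y).exists_comp_rangeRestrict ((Latch.lift c).coprod μ) (by
    rintro ⟨b, a⟩ hba
    obtain ⟨b', rfl, ha⟩ := hi y hy b a hba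
    rw [eq_neg_iff_add_eq_zero, add_comm, ← eq_neg_iff_add_eq_zero] at ha
    subst ha
    rw [LinearMap.coprod_apply, map_neg, ← sub_eq_add_neg, sub_eq_zero]
    suffices Latch.lift c ∘ₗ Latch.map (R.stageMap i _) = μ ∘ₗ R.latch Y y from
      LinearMap.congr_fun this b'
    refine Latch.hom_ext fun z hz q v => ?_
    rw [LinearMap.comp_apply, LinearMap.comp_apply, Latch.map_cone, Latch.lift_cone, latch_cone]
    exact HomModule.ext fun m => ((ht z hz).2.2 (q.comp m) v).trans (ψ.comp z y hz hy q m v))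
  have hgc : ∀ z (hz : R.deg z < R.deg y) (q : R.Pl z y) (v : R.Value X z),
      ∃ h, g ⟨R.act X q.hom v, h⟩ = c.φ z hz q v := by
    intro z hz q v
    have h1 : R.relLatch i y ((Latch.cone _).φ z hz q v, 0) = R.act X q.hom v := by
      rw [relLatch, LinearMap.coprod_apply, map_zero, add_zero, latch_cone]
    have h2 := hg ((Latch.cone _).φ z hz q v, 0)
    rw [LinearMap.coprod_apply, map_zero, add_zero, Latch.lift_cone] at h2
    exact ⟨⟨_, h1⟩, by rw [← h2]; exact congrArg g (Subtype.ext h1.symm)⟩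
  have hgμ : ∀ v : R.Value Y y, ∃ h, g ⟨R.valueMap i y v, h⟩ = μ v := by
    intro v
    have h1 : R.relLatch i y (0, v) = R.valueMap i y v := by
      rw [relLatch, LinearMap.coprod_apply, map_zero, zero_add]
    have h2 := hg (0, v)
    rw [LinearMap.coprod_apply, map_zero, zero_add] at h2
    exact ⟨⟨_, h1⟩, by rw [← h2]; exact congrArg g (Subtype.ext h1.symm)⟩
  -- Extend `g` over `X(y)`.
  have := hproj y
  let V : BalancedTensor (R.Alg x) (R.Alg y) (R.Pl y x) (R.Value X y) →ₗ[R.Alg x] F :=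
    BalancedTensor.lift (φ.φ y hy) (fun a q v => φ.smul y hy a q v)
      (fun q a v => φ.bal y hy a q v)
  have hcomp : p ∘ₗ HomModule.uncurry g =
      V ∘ₗ BalancedTensor.map (R.Alg x) (R.Pl y x) (LinearMap.range (R.relLatch i y)).subtype := by
    refine BalancedTensor.hom_ext fun q n => ?_
    obtain ⟨n, rfl⟩ := (R.relLatch i y).surjective_rangeRestrict n
    rw [LinearMap.comp_apply, LinearMap.comp_apply, HomModule.uncurry_tmul, hg,
      BalancedTensor.map_tmul, BalancedTensor.lift_tmul]
    obtain ⟨b, a⟩ := n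
    change p ((Latch.lift c b + μ a) q) = φ.φ y hy q (R.latch X y b + R.valueMap i y a)
    rw [HomModule.add_apply, map_add, map_add]
    congr 1
    · induction b using Latch.induction_on with
      | zero => simp only [map_zero]; exact map_zero p
      | add s t hs ht =>
        simp only [map_add]
        exact (map_add p _ _).trans (congrArg₂ (· + ·) hs ht)
      | cone z hz q' v =>
        rw [Latch.lift_cone, latch_cone]
        exact ((ht z hz).2.1 (q'.comp q) v).trans (φ.comp z y hz hy q' q v)
    · exact h y hy q a
  obtain ⟨s, hs, hs'⟩ := exists_filler
    (BalancedTensor.map_injective (B := R.Alg x) (M := R.Pl y x) (Submodule.subtype_injective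
      (LinearMap.range (R.relLatch i y))))
    (BalancedTensor.map_surjective (Submodule.mkQ_surjective _))
    (BalancedTensor.map_exact (Submodule.mkQ_surjective _)
      (LinearMap.exact_subtype_mkQ (LinearMap.range (R.relLatch i y))))
    hκ hp hκp (hext y hy) (HomModule.uncurry g) V hcomp
  refine ⟨s.toAddMonoidHom.compHom.comp (BalancedTensor.tmulHom _ _ _ _), fun _ =>
    ⟨⟨fun a q v => ?_, fun a q v => ?_, fun z hz q q' v => ?_⟩, fun q v => ?_, fun q v => ?_⟩⟩
  · exact (congrArg s (BalancedTensor.smul_tmul a q v)).trans (map_smul s a _)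
  · exact congrArg s (BalancedTensor.op_smul_tmul q a v)
  · obtain ⟨h1, h2⟩ := hgc z hz q v
    have h3 := LinearMap.congr_fun hs (BalancedTensor.tmul _ _ q' ⟨_, h1⟩)
    rw [HomModule.uncurry_tmul, h2] at h3
    exact h3.symm
  · exact LinearMap.congr_fun hs' (BalancedTensor.tmul _ _ q v)
  · obtain ⟨h1, h2⟩ := hgμ v
    have h3 := LinearMap.congr_fun hs (BalancedTensor.tmul _ _ q ⟨_, h1⟩)
    rw [HomModule.uncurry_tmul, h2] at h3
    exact h3

end LatchLift

section MatchLift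

variable {X Z : CMod k C} (q : X ⟶ Z) {x : C}

/-- Maps to the matching objects at `x` extend along an injection `j` with cokernel `K`, relatively
to `q : X ⟶ Z`, if `K` is `Ext¹`-orthogonal to the modules coinduced along `C⁻` from the kernels of
the relative matching maps of `q` below `x`. -/
theorem Match.exists_lift (hproj : ∀ y, Module.Projective (R.Alg y) (R.Mi x y))
    (hq : ∀ y, R.deg y < R.deg x → R.RelMatchSurjective q y)
    {E F K : Type u} [AddCommGroup E] [AddCommGroup F] [AddCommGroup K] [Module (R.Alg x) E]
    [Module (R.Alg x) F] [Module (R.Alg x) K] {j : E →ₗ[R.Alg x] F} {π : F →ₗ[R.Alg x] K}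
    (hj : Function.Injective j) (hπ : Function.Surjective π) (hjπ : Function.Exact j π)
    (hext : ∀ y, R.deg y < R.deg x → ExtOneVanishes (ModuleCat.of (R.Alg x) K)
      (ModuleCat.of (R.Alg x) (HomModule (R.Alg y) (R.Alg x) (R.Mi x y)
        (LinearMap.ker (R.relMatch q y)))))
    (e : E →ₗ[R.Alg x] Match (R.stage X (R.deg x))) (f : F →ₗ[R.Alg x] Match (R.stage Z (R.deg x)))
    (h : ∀ w, Match.map (R.stageMap q _) (e w) = f (j w)) :
    ∃ g : F →ₗ[R.Alg x] Match (R.stage X (R.deg x)),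
      (∀ w, Match.map (R.stageMap q _) (g w) = f w) ∧ ∀ w, g (j w) = e w := by
  refine Exists.elim (exists_forall_of_exists_extension R.deg
    (T := fun y => F →+ R.Mi x y →+ R.Value X y)
    (fun y t s => ∀ hy : R.deg y < R.deg x,
      ((∀ (a : R.Alg x) w m, s (a • w) m = s w (op a • m)) ∧
      (∀ (a : R.Alg y) w m, s w (a • m) = a • s w m) ∧
      (∀ z (hz : R.deg z < R.deg y) (m : R.Mi x y) (n : R.Mi y z) w,
        t z hz w (m.comp n) = R.act X n.hom (s w m))) ∧
      (∀ w m, R.valueMap q y (s w m) = (f w).eval hy m) ∧ ∀ w m, s (j w) m = (e w).eval hy m)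
      ?_) fun t ht =>
    ⟨{ toFun := fun w => Match.mk (fun y _ => t y w) (fun y hy a m => (ht y hy).1.2.1 a w m)
          (fun y z hz hy m n => (ht y hy).1.2.2 z hz m n w)
       map_add' := fun w w' => Match.ext fun y hy m => DFunLike.congr_fun (map_add (t y) w w') m
       map_smul' := fun a w => Match.ext fun y hy m => (ht y hy).1.1 a w m },
      fun w => Match.ext fun y hy m => (ht y hy).2.1 w m,
      fun w => Match.ext fun y hy m => (ht y hy).2.2 w m⟩
  intro y t ht
  by_cases hy : R.deg y < R.deg x
  swap
  · exact ⟨0, fun h => (hy h).elim⟩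
  replace ht := fun z hz => ht z hz (hz.trans hy)
  -- The values below `y` and the given map `f` define a map `V` to the pullback at `y`.
  let G := HomModule (R.Alg y) (R.Alg x) (R.Mi x y) (LinearMap.range (R.relMatch q y))
  let c (w : F) (m : R.Mi x y) : Match (R.stage X (R.deg y)) :=
    Match.mk (fun z hz => (t z hz w).comp (Mi.compHom m))
      (fun z hz a n => (congrArg (t z hz w) (Mi.hom_injective
        (Category.assoc m.hom n.hom a.hom).symm)).trans ((ht z hz).1.2.1 a w (m.comp n)))
      (fun z z' hz' hz n n' => (congrArg (t z' _ w) (Mi.hom_injective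
        (Category.assoc m.hom n.hom n'.hom).symm)).trans ((ht z hz).1.2.2 z' hz' (m.comp n) n' w))
  have hrange : ∀ w m, (c w m, (f w).eval hy m) ∈ LinearMap.range (R.relMatch q y) := by
    intro w m
    obtain ⟨v, hv, hv'⟩ := hq y hy (c w m) ((f w).eval hy m) (Match.ext fun z hz n =>
      ((ht z hz).2.1 w (m.comp n)).trans ((f w).eval_comp hz hy m n))
    exact ⟨v, Prod.ext hv hv'⟩
  let V : F →ₗ[R.Alg x] G := HomModule.mk
    (AddMonoidHom.mk' (fun w => AddMonoidHom.mk' (fun m => ⟨_, hrange w m⟩) fun m m' =>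
      Subtype.ext (Prod.ext (Match.ext fun z hz n =>
        (congrArg (t z hz w) (Mi.add_comp m m' n)).trans (map_add (t z hz w) _ _))
        (map_add ((f w).eval hy) m m')))
      fun w w' => AddMonoidHom.ext fun m => Subtype.ext (Prod.ext (Match.ext fun z hz n =>
        DFunLike.congr_fun (map_add (t z hz) w w') (m.comp n))
        (congrArg (fun f => Match.eval f hy m) (map_add f w w'))))
    (fun w a m => Subtype.ext (Prod.ext (Match.ext fun z hz n =>
      congrArg (t z hz w) (Mi.hom_injective (Category.assoc m.hom a.hom n.hom)))
      ((f w).eval_smul hy a m)))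
    (fun a w m => Subtype.ext (Prod.ext (Match.ext fun z hz n =>
      ((ht z hz).1.1 a w (m.comp n)).trans (congrArg (t z hz w) (Mi.hom_injective
        (Category.assoc a.hom m.hom n.hom).symm)))
      (congrArg (fun f => Match.eval f hy m) (map_smul f a w))))
  let U : E →ₗ[R.Alg x] HomModule (R.Alg y) (R.Alg x) (R.Mi x y) (R.Value X y) := HomModule.mk
    (AddMonoidHom.mk' (fun w => (e w).eval hy) fun w w' => by rw [map_add]; rfl)
    (fun w a m => (e w).eval_smul hy a m)
    (fun a w m => congrArg (fun f => Match.eval f hy m) (map_smul e a w))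
  have := hproj y
  -- Lift `V` to a map to `X(y)`.
  obtain ⟨s, hs, hs'⟩ := exists_filler hj hπ hjπ
    (HomModule.map_injective (A := R.Alg x) (M := R.Mi x y) (Submodule.subtype_injective
      (LinearMap.ker (R.relMatch q y))))
    (HomModule.map_surjective (A := R.Alg x) (M := R.Mi x y)
      (R.relMatch q y).surjective_rangeRestrict)
    (HomModule.map_exact (Submodule.subtype_injective _) (fun v => by
      rw [← LinearMap.mem_ker, LinearMap.ker_rangeRestrict, Submodule.coe_subtype,
        Subtype.range_coe]; rfl))
    (hext y hy) U V (LinearMap.ext fun w => HomModule.ext fun m => Subtype.ext (Prod.ext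
      (Match.ext fun z hz n =>
        (((ht z hz).2.2 w (m.comp n)).trans ((e w).eval_comp hz hy m n)).symm)
      (congrArg (fun f => Match.eval f hy m) (h w))))
  have hs'' : ∀ w m, R.relMatch q y (s w m) = (c w m, (f w).eval hy m) := fun w m =>
    congrArg Subtype.val (DFunLike.congr_fun (LinearMap.congr_fun hs' w) m)
  refine ⟨AddMonoidHom.mk' (fun w => AddMonoidHom.mk' (s w) (map_add (s w)))
      fun w w' => AddMonoidHom.ext fun m => DFunLike.congr_fun (map_add s w w') m, fun _ =>
    ⟨⟨fun a w m => ?_, fun a w m => ?_, fun z hz m n w => ?_⟩, fun w m => ?_, fun w m => ?_⟩⟩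
  · exact DFunLike.congr_fun (map_smul s a w) m
  · exact map_smul (s w) a m
  · exact congrArg (fun φ => Match.eval φ.1 hz n) (hs'' w m).symm
  · exact congrArg Prod.snd (hs'' w m)
  · exact DFunLike.congr_fun (LinearMap.congr_fun hs w) m

end MatchLift

end PreReedyStructure

/-! ### Exactness of sequences of `C`-modules -/

section Exactness

variable {k : Type u} [CommRing k] {C : Type u} [SmallCategory C] [Preadditive C] [Linear k C]

instance : Limits.PreservesFiniteLimits (linearFunctorProp k C).ι :=
  have := (linearFunctorProp k C).preservesKernels_ι
  Functor.preservesFiniteLimits_of_preservesKernels _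

instance : Limits.PreservesFiniteColimits (linearFunctorProp k C).ι :=
  have := (linearFunctorProp k C).preservesCokernels_ι
  Functor.preservesFiniteColimits_of_preservesCokernels _

/-- Exactness in the functor category is exactness at all objects. -/
lemma functor_shortExact_iff {J : Type u} [SmallCategory J]
    (S : ShortComplex (J ⥤ ModuleCat.{u} k)) :
    S.ShortExact ↔ ∀ j, (S.map ((evaluation J (ModuleCat.{u} k)).obj j)).ShortExact := by
  refine ⟨fun h j => h.map_of_exact _, fun h => ?_⟩
  have hm : ∀ j, Mono (S.f.app j) := fun j => (h j).mono_f
  have he : ∀ j, Epi (S.g.app j) := fun j => (h j).epi_g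
  refine { exact := ?_, mono_f := NatTrans.mono_of_mono_app _, epi_g := NatTrans.epi_of_epi_app _ }
  rw [ShortComplex.exact_iff_isZero_homology, Functor.isZero_iff]
  intro j
  exact ((ShortComplex.exact_iff_isZero_homology _).1 (h j).exact).of_iso
    (S.mapHomologyIso ((evaluation J (ModuleCat.{u} k)).obj j)).symm

namespace PreReedyStructure

variable (R : PreReedyStructure k C)

/-- Short exactness is detected by the `A_x^0`-modules of values. -/
lemma shortExact_iff (S : ShortComplex (CMod k C)) :
    S.ShortExact ↔ ∀ x, Function.Injective (R.valueMap S.f x) ∧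
      Function.Surjective (R.valueMap S.g x) ∧
      Function.Exact (R.valueMap S.f x) (R.valueMap S.g x) := by
  rw [← ShortExact.shortExact_map_iff (linearFunctorProp k C).ι, functor_shortExact_iff]
  refine forall_congr' fun x => ⟨fun h => ⟨h.moduleCat_injective_f, h.moduleCat_surjective_g,
    (ShortComplex.ShortExact.moduleCat_exact_iff_function_exact _).1 h.exact⟩, fun h =>
      ModuleCat.shortComplex_shortExact _ h.2.2 h.1 h.2.1⟩

variable {R}

lemma valueMap_comp {X Y Z : CMod k C} (f : X ⟶ Y) (g : Y ⟶ Z) (x : C) (v : R.Value X x) :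
    R.valueMap (f ≫ g) x v = R.valueMap g x (R.valueMap f x v) := rfl

lemma valueMap_id {X : CMod k C} (x : C) (v : R.Value X x) : R.valueMap (𝟙 X) x v = v := rfl

lemma hom_ext {X Y : CMod k C} {f g : X ⟶ Y} (h : ∀ x v, R.valueMap f x v = R.valueMap g x v) :
    f = g := by
  ext x v
  exact h x v

lemma eq_zero_of_isZero {X : CMod k C} (h : Limits.IsZero X) (x : C) (v : R.Value X x) : v = 0 :=
  congrArg (fun f => R.valueMap f x v) ((Limits.IsZero.iff_id_eq_zero X).1 h)

end PreReedyStructure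

end Exactness

lemma extOneVanishes_of_projective {A : Type u} [Ring A] (X Y : ModuleCat.{u} A) [Projective X] :
    ExtOneVanishes X Y :=
  letI := HasExt.standard (ModuleCat.{u} A)
  Abelian.Ext.subsingleton_of_projective X Y 0

lemma extOneVanishes_of_injective {A : Type u} [Ring A] (X Y : ModuleCat.{u} A) [Injective Y] :
    ExtOneVanishes X Y :=
  letI := HasExt.standard (ModuleCat.{u} A)
  Abelian.Ext.subsingleton_of_injective X Y 0

namespace PreReedyStructure

variable {k : Type u} [CommRing k] {C : Type u} [SmallCategory C] [Preadditive C] [Linear k C]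
  {R : PreReedyStructure k C}

/-! ### Consequences of the lifting properties -/

section

variable {Y X Z : CMod k C} {x : C}

/-- If the relative latching maps of `i : Y ⟶ X` below `x` are injective, so is `L_x Y ⟶ L_x X`:
maps from `L_x Y` to an injective module extend to `L_x X`. -/
lemma latch_map_injective (i : Y ⟶ X)
    (hproj : ∀ y, Module.Projective (R.Alg y)ᵐᵒᵖ (R.Pl y x))
    (hi : ∀ y, R.deg y < R.deg x → R.RelLatchInjective i y) :
    Function.Injective (Latch.map (R.stageMap i (R.deg x))) := by
  let E := Injective.under (ModuleCat.of (R.Alg x) (Latch (R.stage Y (R.deg x))))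
  let ι : Latch (R.stage Y (R.deg x)) →ₗ[R.Alg x] E :=
    (Injective.ι (ModuleCat.of (R.Alg x) (Latch (R.stage Y (R.deg x))))).hom
  have hι : Function.Injective ι := (ModuleCat.mono_iff_injective _).1
    (inferInstance : Mono (Injective.ι
      (ModuleCat.of (R.Alg x) (Latch (R.stage Y (R.deg x))))))
  obtain ⟨Φ, -, hΦ⟩ := Cone.exists_lift i hproj hi (F := PUnit.{u+1})
    (κ := (LinearMap.id : E →ₗ[R.Alg x] E)) (p := 0) Function.injective_id
    (fun _ => ⟨0, rfl⟩) (fun v => ⟨fun _ => ⟨v, rfl⟩, fun _ => rfl⟩)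
    (fun y hy => extOneVanishes_of_injective _ E)
    ((Latch.cone _).postcomp 0) ((Latch.cone _).postcomp ι) (fun _ _ _ _ => rfl)
  have : Latch.lift Φ ∘ₗ Latch.map (R.stageMap i (R.deg x)) = ι := by
    refine Latch.hom_ext fun y hy p v => ?_
    rw [LinearMap.comp_apply, Latch.map_cone, Latch.lift_cone]
    exact hΦ y hy p v
  refine Function.Injective.of_comp (f := Latch.lift Φ) ?_
  rw [← LinearMap.coe_comp, this]
  exact hι

lemma valueMap_injective (i : Y ⟶ X)
    (hproj : ∀ y, Module.Projective (R.Alg y)ᵐᵒᵖ (R.Pl y x))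
    (hi : ∀ y, R.RelLatchInjective i y) : Function.Injective (R.valueMap i x) := by
  rw [injective_iff_map_eq_zero]
  intro a ha
  obtain ⟨b, hb, hba⟩ := hi x 0 a (by rw [map_zero, ha, zero_add])
  rw [map_eq_zero_iff _ (latch_map_injective i hproj fun y _ => hi y)] at hb
  rw [hb, map_zero, eq_comm, neg_eq_zero] at hba
  exact hba

/-- If the relative matching maps of `q : X ⟶ Z` below `x` are surjective, so is `M_x X ⟶ M_x Z`:
maps from `A_x^0` to `M_x Z` lift to `M_x X`. -/
lemma match_map_surjective (q : X ⟶ Z)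
    (hproj : ∀ y, Module.Projective (R.Alg y) (R.Mi x y))
    (hq : ∀ y, R.deg y < R.deg x → R.RelMatchSurjective q y) :
    Function.Surjective (Match.map (R.stageMap q (R.deg x))) := by
  intro φ
  obtain ⟨g, hg, -⟩ := Match.exists_lift q hproj hq (E := PUnit.{u+1}) (F := R.Alg x)
    (j := 0) (π := (LinearMap.id : R.Alg x →ₗ[R.Alg x] R.Alg x))
    (fun _ _ _ => rfl) Function.surjective_id
    (fun v => ⟨fun h => ⟨0, h.symm⟩, fun ⟨_, h⟩ => h.symm⟩)
    (fun y hy => by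
      have : Projective (ModuleCat.of (R.Alg x) (R.Alg x)) :=
        (IsProjective.iff_projective (R := R.Alg x) (R.Alg x)).1 inferInstance
      exact extOneVanishes_of_projective _ _)
    0 (LinearMap.toSpanSingleton _ _ φ) (fun w => by simp)
  exact ⟨g 1, (hg 1).trans (one_smul _ φ)⟩

lemma valueMap_surjective (q : X ⟶ Z)
    (hproj : ∀ y, Module.Projective (R.Alg y) (R.Mi x y))
    (hq : ∀ y, R.RelMatchSurjective q y) : Function.Surjective (R.valueMap q x) := by
  intro z
  obtain ⟨φ, hφ⟩ := match_map_surjective q hproj (fun y _ => hq y) (R.matching Z x z)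
  obtain ⟨v, -, hv⟩ := hq x φ z hφ
  exact ⟨v, hv⟩

lemma relLatchInjective_of_isZero (hY : Limits.IsZero Y) (i : Y ⟶ X)
    (h : Function.Injective (R.latch X x)) : R.RelLatchInjective i x := by
  intro b a hba
  rw [eq_zero_of_isZero hY x a, map_zero, add_zero, map_eq_zero_iff _ h] at hba
  exact ⟨0, by rw [map_zero, hba],
    (eq_zero_of_isZero hY _ _).trans (eq_zero_of_isZero hY _ _).symm⟩

lemma injective_latch_of_isZero (hY : Limits.IsZero Y) (i : Y ⟶ X)
    (h : R.RelLatchInjective i x) : Function.Injective (R.latch X x) := by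
  rw [injective_iff_map_eq_zero]
  intro b hb
  obtain ⟨b', rfl, -⟩ := h b 0 (by rw [hb, map_zero, zero_add])
  have : Latch.map (R.stageMap i (R.deg x)) = 0 := Latch.hom_ext fun y hy p v => by
    rw [Latch.map_cone, show v = 0 from eq_zero_of_isZero hY y v, map_zero, map_zero]
    rfl
  rw [this, LinearMap.zero_apply]

lemma range_relLatch_of_isZero (hY : Limits.IsZero Y) (i : Y ⟶ X) :
    LinearMap.range (R.relLatch i x) = LinearMap.range (R.latch X x) := by
  ext v
  constructor
  · rintro ⟨⟨b, a⟩, rfl⟩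
    refine ⟨b, ?_⟩
    rw [relLatch, LinearMap.coprod_apply, eq_zero_of_isZero hY x a, map_zero, add_zero]
  · rintro ⟨b, rfl⟩
    refine ⟨(b, 0), ?_⟩
    rw [relLatch, LinearMap.coprod_apply, map_zero, add_zero]

lemma relMatchSurjective_of_isZero (hZ : Limits.IsZero Z) (q : X ⟶ Z)
    (h : Function.Surjective (R.matching X x)) : R.RelMatchSurjective q x := by
  intro φ z hz
  obtain ⟨v, rfl⟩ := h φ
  exact ⟨v, rfl, (eq_zero_of_isZero hZ x _).trans (eq_zero_of_isZero hZ x z).symm⟩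

lemma surjective_matching_of_isZero (hZ : Limits.IsZero Z) (q : X ⟶ Z)
    (h : R.RelMatchSurjective q x) : Function.Surjective (R.matching X x) := by
  intro φ
  obtain ⟨v, hv, -⟩ := h φ 0 (Match.ext fun y hy m =>
    (eq_zero_of_isZero (R := R) hZ y _).trans (eq_zero_of_isZero hZ y _).symm)
  exact ⟨v, hv⟩

lemma ker_relMatch_of_isZero (hZ : Limits.IsZero Z) (q : X ⟶ Z) :
    LinearMap.ker (R.relMatch q x) = LinearMap.ker (R.matching X x) := by
  ext v
  rw [relMatch, LinearMap.ker_prod, Submodule.mem_inf, and_iff_left]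
  exact eq_zero_of_isZero hZ x _

end

section

variable (Y : CMod k C) {x : C}

/-- The latching object belongs to the left class of a cotorsion pair at `x` if the cokernels of
the latching maps below `x` belong to a class that is carried there by `C⁺ ⊗ -`. -/
lemma latch_mem (hproj : ∀ y, Module.Projective (R.Alg y)ᵐᵒᵖ (R.Pl y x)) (𝒮 : R.ClassFamily)
    {𝒟 : ObjectProperty (ModuleCat.{u} (R.A x))} (h𝒮 : R.Cocompatible 𝒮)
    (hcot : IsCotorsionPair (𝒮 x) 𝒟)
    (hY : ∀ y, R.deg y < R.deg x → Function.Injective (R.latch Y y) ∧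
      𝒮 y (ModuleCat.of (R.Alg y) (R.Value Y y ⧸ LinearMap.range (R.latch Y y)))) :
    𝒮 x (ModuleCat.of (R.Alg x) (Latch (R.stage Y (R.deg x)))) := by
  obtain ⟨O, h0⟩ := Limits.HasZeroObject.zero (C := CMod k C)
  refine (hcot.left_iff _).2 fun (D : ModuleCat.{u} (R.Alg x)) hD => ?_
  refine extOneVanishes_of_linear_split (A := R.Alg x) (Y := D) fun E j p hj hp hjp => ?_
  obtain ⟨Φ, hΦ, -⟩ := Cone.exists_lift (0 : O ⟶ Y) hproj
    (fun y hy => relLatchInjective_of_isZero h0 _ (hY y hy).1) hj hp hjp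
    (fun y hy => by
      rw [range_relLatch_of_isZero h0]
      exact hcot.ext_vanishes (h𝒮 x y _ (hY y hy).2) hD)
    (Latch.cone _) ((Latch.cone _).postcomp 0)
    (fun y hy q v => by
      rw [show v = 0 from eq_zero_of_isZero h0 y v, map_zero, map_zero, map_zero, map_zero])
  refine ⟨Latch.lift Φ, Latch.hom_ext fun y hy q v => ?_⟩
  rw [LinearMap.comp_apply, Latch.lift_cone, hΦ]
  rfl

/-- The matching object belongs to the right class of a cotorsion pair at `x` if the kernels of
the matching maps below `x` belong to a class that is carried there by `Hom(C⁻, -)`. -/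
lemma match_mem (hproj : ∀ y, Module.Projective (R.Alg y) (R.Mi x y)) (𝒮 : R.ClassFamily)
    {𝒟 : ObjectProperty (ModuleCat.{u} (R.A x))} (h𝒮 : R.Compatible 𝒮)
    (hcot : IsCotorsionPair 𝒟 (𝒮 x))
    (hY : ∀ y, R.deg y < R.deg x → Function.Surjective (R.matching Y y) ∧
      𝒮 y (ModuleCat.of (R.Alg y) (LinearMap.ker (R.matching Y y)))) :
    𝒮 x (ModuleCat.of (R.Alg x) (Match (R.stage Y (R.deg x)))) := by
  obtain ⟨O, h0⟩ := Limits.HasZeroObject.zero (C := CMod k C)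
  refine (hcot.right_iff _).2 fun (D : ModuleCat.{u} (R.Alg x)) hD => ?_
  refine extOneVanishes_of_linear_split (A := R.Alg x) (X := D) fun E j p hj hp hjp => ?_
  obtain ⟨g, -, hg⟩ := Match.exists_lift (0 : Y ⟶ O) hproj
    (fun y hy => relMatchSurjective_of_isZero h0 _ (hY y hy).1) hj hp hjp
    (fun y hy => by
      rw [ker_relMatch_of_isZero h0]
      exact hcot.ext_vanishes hD (h𝒮 x y _ (hY y hy).2))
    LinearMap.id 0 (fun w => Match.ext fun y hy m =>
      (eq_zero_of_isZero (R := R) h0 y _).trans (eq_zero_of_isZero h0 y _).symm)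
  have h := hjp.split_tfae'.out 1 0
  exact (h.1 ⟨hp, g, LinearMap.ext hg⟩).2

end

section

variable {Y E X : CMod k C} {j : Y ⟶ E} {π : E ⟶ X}
    (hj : ∀ x, Function.Injective (R.valueMap j x)) (hπ : ∀ x, Function.Surjective (R.valueMap π x))
    (hjπ : ∀ x, Function.Exact (R.valueMap j x) (R.valueMap π x)) {x : C}

include hj hjπ in
/-- The matching object is left exact. -/
lemma exists_match_map_eq (φ : Match (R.stage E (R.deg x)))
    (hφ : Match.map (R.stageMap π _) φ = 0) : ∃ ψ, Match.map (R.stageMap j _) ψ = φ := by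
  have h1 : ∀ (z : C) (hz : R.deg z < R.deg x) (m : R.Mi x z), ∃ w : R.Value Y z,
      R.valueMap j z w = φ.eval hz m := fun z hz m =>
    (hjπ z _).1 (congrArg (fun ψ => Match.eval ψ hz m) hφ)
  choose g hg using h1
  refine ⟨Match.mk
    (fun z hz => AddMonoidHom.mk' (g z hz) fun m m' => hj z <| by
      rw [map_add, hg, hg, hg, map_add])
    (fun z hz a m => hj z <| by
      refine (hg z hz _).trans (Eq.trans ?_ (map_smul (R.valueMap j z) a (g z hz m)).symm)
      rw [hg]
      exact Match.eval_smul _ hz a m)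
    (fun z w hw hz m n => hj w <| by
      refine (hg w _ _).trans (Eq.trans ?_ (valueMap_act j n.hom (g z hz m)).symm)
      rw [hg]
      exact Match.eval_comp _ hw hz m n), Match.ext hg⟩

include hj hπ hjπ in
lemma relMatchSurjective_of_exact (hY : Function.Surjective (R.matching Y x)) :
    R.RelMatchSurjective π x := by
  intro φ z hz
  obtain ⟨e, rfl⟩ := hπ x z
  obtain ⟨ψ, hψ⟩ := exists_match_map_eq hj hjπ (φ - R.matching E x e) (by
    rw [map_sub, hz, matching_map, sub_self])
  obtain ⟨y, rfl⟩ := hY ψ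
  rw [matching_map, eq_sub_iff_add_eq, add_comm, ← map_add] at hψ
  exact ⟨_, hψ, by rw [map_add, (hjπ x).apply_apply_eq_zero, add_zero]⟩

end

end PreReedyStructure

namespace GeneralizedReedyStructure

open PreReedyStructure

variable {k : Type u} [CommRing k] {C : Type u} [SmallCategory C] [Preadditive C] [Linear k C]
  {R : GeneralizedReedyStructure k C}

/-! ### Splitting of extensions -/

/-- By the factorization axiom, a family of maps is natural below `α` as soon as it is natural with
respect to the degree-raising morphisms of `C⁺`, the degree-lowering morphisms of `C⁻`, and the
algebras `A_y^0`. -/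
lemma natural_of_natural {X E : CMod k C} {α : Ordinal.{u}}
    (t : ∀ y, R.deg y < α → R.Value X y →+ R.Value E y)
    (smul : ∀ y hy (a : R.Alg y) v, t y hy (a • v) = a • t y hy v)
    (pl : ∀ z y (h : R.deg z < R.deg y) (hy : R.deg y < α) (p : R.Pl z y) v,
      t y hy (R.act X p.hom v) = R.act E p.hom (t z (h.trans hy) v))
    (mi : ∀ z y (h : R.deg z < R.deg y) (hy : R.deg y < α) (m : R.Mi y z) v,
      t z (h.trans hy) (R.act X m.hom v) = R.act E m.hom (t y hy v))
    {z y : C} (hz : R.deg z < α) (hy : R.deg y < α) (f : z ⟶ y) (v : R.Value X z) :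
    t y hy (R.act X f v) = R.act E f (t z hz v) := by
  induction f using R.hom_induction with
  | zero => rw [act_zero, act_zero, map_zero]
  | add f g hf hg => rw [act_add, act_add, map_add, hf, hg]
  | comp u h h' m p =>
    have hu : R.deg u < α := by
      rcases h with rfl | h
      exacts [hz, h.trans hz]
    rw [act_comp, act_comp]
    have h1 : t u hu (R.act X m.hom v) = R.act E m.hom (t z hz v) := by
      rcases h with rfl | h
      · exact smul _ hz m.toAlg v
      · exact mi u z h hz m v
    rw [← h1]
    rcases h' with rfl | h'
    · exact smul _ hy p.toAlg _
    · exact pl u y h' hy p _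

lemma exists_forall_deg_lt (R : PreReedyStructure k C) : ∃ α : Ordinal.{u}, ∀ x, R.deg x < α := by
  obtain ⟨β, hβ⟩ := Ordinal.bddAbove_of_small (s := Set.range R.deg)
  exact ⟨Order.succ β, fun x => Order.lt_succ_of_le (hβ ⟨x, rfl⟩)⟩

/-- An extension `0 ⟶ Y ⟶ E ⟶ X ⟶ 0` of `C`-modules splits if the cokernels of the latching maps
of `X` are `Ext¹`-orthogonal to the kernels of the matching maps of `Y`. -/
theorem exists_section {Y E X : CMod k C} (j : Y ⟶ E) (π : E ⟶ X)
    (hj : ∀ x, Function.Injective (R.valueMap j x)) (hπ : ∀ x, Function.Surjective (R.valueMap π x))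
    (hjπ : ∀ x, Function.Exact (R.valueMap j x) (R.valueMap π x))
    (hX : ∀ x, Function.Injective (R.latch X x)) (hY : ∀ x, Function.Surjective (R.matching Y x))
    (hext : ∀ x, ExtOneVanishes
      (ModuleCat.of (R.Alg x) (R.Value X x ⧸ LinearMap.range (R.latch X x)))
      (ModuleCat.of (R.Alg x) (LinearMap.ker (R.matching Y x)))) :
    ∃ s : X ⟶ E, s ≫ π = 𝟙 X := by
  refine Exists.elim (exists_forall_of_exists_extension R.deg
    (T := fun y => R.Value X y →+ R.Value E y)
    (fun x t s => ((∀ (a : R.Alg x) v, s (a • v) = a • s v) ∧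
      (∀ z (hz : R.deg z < R.deg x) (p : R.Pl z x) v,
        s (R.act X p.hom v) = R.act E p.hom (t z hz v)) ∧
      (∀ z (hz : R.deg z < R.deg x) (m : R.Mi x z) v,
        t z hz (R.act X m.hom v) = R.act E m.hom (s v))) ∧
      (∀ v, R.valueMap π x (s v) = v)) ?_) fun t ht => ?_
  · intro x t ht
    have hnat : ∀ {z y : C} (hz : R.deg z < R.deg x) (hy : R.deg y < R.deg x) (f : z ⟶ y)
        (v : R.Value X z), t y hy (R.act X f v) = R.act E f (t z hz v) :=
      natural_of_natural t (fun y hy => (ht y hy).1.1) (fun z y h hy => (ht y hy).1.2.1 z h)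
        (fun z y h hy => (ht y hy).1.2.2 z h)
    -- The section constructed below `x` gives maps `c` from `L_x X` to `E(x)` and `V` from `X(x)`
    -- to the pullback of `M_x E` and `X(x)` over `M_x X`; a section at `x` is a diagonal filler.
    let c : Cone (R.stage X (R.deg x)) (R.Value E x) :=
      { φ := fun z hz => AddMonoidHom.mk' (fun p => (R.act E p.hom).comp (t z hz)) fun p p' => by
          ext v; rw [map_add]; exact act_add E p.hom p'.hom _
        smul := fun z hz a p v => act_comp E p.hom a.hom _
        bal := fun z hz a p v => (act_comp E a.hom p.hom _).trans
          (congrArg (R.act E p.hom) ((ht z hz).1.1 a v).symm)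
        comp := fun w z hw hz q p v => (act_comp E q.hom p.hom _).trans
          (congrArg (R.act E p.hom) ((ht z hz).1.2.1 w hw q v).symm) }
    let μ : R.Value X x →ₗ[R.Alg x] Match (R.stage E (R.deg x)) :=
      { toFun := fun v => Match.mk
          (fun z hz => (t z hz).comp (((R.actHom X x z).comp Mi.hom).flip v))
          (fun z hz a m => (congrArg (t z hz) (act_comp X m.hom a.hom v)).trans
            ((ht z hz).1.1 a _))
          (fun z w hw hz m n => (congrArg (t w _) (act_comp X m.hom n.hom v)).trans
            ((ht z hz).1.2.2 w hw n _))
        map_add' := fun v w => Match.ext fun z hz m => (congrArg (t z hz)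
          (map_add (R.act X m.hom) v w)).trans (map_add (t z hz) _ _)
        map_smul' := fun a v => Match.ext fun z hz m => congrArg (t z hz)
          (act_comp X a.hom m.hom v).symm }
    have hrange : ∀ v, (μ v, v) ∈ LinearMap.range (R.relMatch π x) := fun v => by
      obtain ⟨e, he, he'⟩ := relMatchSurjective_of_exact hj hπ hjπ (hY x) (μ v) v
        (Match.ext fun z hz m => (ht z hz).2 _)
      exact ⟨e, Prod.ext he he'⟩
    let V : R.Value X x →ₗ[R.Alg x] LinearMap.range (R.relMatch π x) :=
      (μ.prod LinearMap.id).codRestrict _ hrange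
    let κ : LinearMap.ker (R.matching Y x) →ₗ[R.Alg x] R.Value E x :=
      R.valueMap j x ∘ₗ (LinearMap.ker (R.matching Y x)).subtype
    have hκ : Function.Exact κ (R.relMatch π x).rangeRestrict := by
      intro e
      rw [← LinearMap.mem_ker, LinearMap.ker_rangeRestrict, relMatch, LinearMap.ker_prod]
      constructor
      · rintro ⟨h1, h2⟩
        obtain ⟨y, rfl⟩ := (hjπ x e).1 h2
        refine ⟨⟨y, Match.ext fun z hz m => hj z ?_⟩, rfl⟩
        exact (valueMap_act j m.hom y).trans ((congrArg (fun ψ => Match.eval ψ hz m) h1).trans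
          (map_zero (R.valueMap j z)).symm)
      · rintro ⟨⟨y, hy⟩, rfl⟩
        refine ⟨Match.ext fun z hz m => ?_, (hjπ x).apply_apply_eq_zero y⟩
        exact (valueMap_act j m.hom y).symm.trans ((congrArg (R.valueMap j z)
          (congrArg (fun ψ => Match.eval ψ hz m) hy)).trans (map_zero (R.valueMap j z)))
    obtain ⟨s, hs, hs'⟩ := exists_filler (hX x) (Submodule.mkQ_surjective _)
      (LinearMap.exact_map_mkQ_range (R.latch X x))
      ((hj x).comp Subtype.val_injective : Function.Injective κ)
      (R.relMatch π x).surjective_rangeRestrict hκ (hext x) (Latch.lift c) V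
      (Latch.hom_ext fun z hz p v => by
        rw [LinearMap.comp_apply, LinearMap.comp_apply, Latch.lift_cone, latch_cone]
        refine Subtype.ext (Prod.ext (Match.ext fun w hw m => ?_) ?_)
        · change R.act E m.hom (R.act E p.hom (t z hz v)) =
            t w hw (R.act X m.hom (R.act X p.hom v))
          rw [← act_comp, ← act_comp, hnat hz hw]
        · change R.valueMap π x (R.act E p.hom (t z hz v)) = R.act X p.hom v
          rw [valueMap_act, (ht z hz).2])
    have hs'' : ∀ v, R.relMatch π x (s v) = (μ v, v) := fun v =>
      congrArg Subtype.val (LinearMap.congr_fun hs' v)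
    refine ⟨s.toAddMonoidHom, ⟨fun a v => map_smul s a v, fun z hz p v => ?_, fun z hz m v => ?_⟩,
      fun v => congrArg Prod.snd (hs'' v)⟩
    · have := LinearMap.congr_fun hs ((Latch.cone _).φ z hz p v)
      rw [LinearMap.comp_apply, Latch.lift_cone, latch_cone] at this
      exact this
    · exact (congrArg (fun ψ => Match.eval ψ.1 hz m) (hs'' v)).symm
  · obtain ⟨α, hα⟩ := exists_forall_deg_lt R.toPreReedyStructure
    refine ⟨homMk (R := R.toPreReedyStructure)
      (fun x => { toFun := t x, map_add' := map_add (t x), map_smul' := (ht x).1.1 })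
      (fun x y f v => natural_of_natural (fun x _ => t x) (fun x _ => (ht x).1.1)
        (fun z y h _ => (ht y).1.2.1 z h) (fun z y h _ => (ht y).1.2.2 z h) (hα x) (hα y) f v),
      hom_ext (R := R.toPreReedyStructure) fun x v => (ht x).2 v⟩

end GeneralizedReedyStructure

namespace PreReedyStructure

variable {k : Type u} [CommRing k] {C : Type u} [SmallCategory C] [Preadditive C] [Linear k C]
  {R : PreReedyStructure k C}

/-! ### Modules on the objects below a given degree -/

namespace Stage

section

variable {α : Ordinal.{u}} (S : R.Stage α)

/-- The action of `C⁺(x, x) = A_x^0`. -/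
def plSelf {x : C} (M : Type*) [AddCommGroup M] [Module (R.Alg x) M] : R.Pl x x →+ M →+ M :=
  AddMonoidHom.mk' (fun p => DistribSMul.toAddMonoidHom M p.toAlg) fun p p' => by
    ext v; exact (congrArg (· • v) (map_add Pl.toAlg p p')).trans (add_smul _ _ v)

/-- The action of `C⁻(x, x) = A_x^0`. -/
def miSelf {x : C} (M : Type*) [AddCommGroup M] [Module (R.Alg x) M] : R.Mi x x →+ M →+ M :=
  AddMonoidHom.mk' (fun m => DistribSMul.toAddMonoidHom M m.toAlg) fun p p' => by
    ext v; exact (congrArg (· • v) (map_add Mi.toAlg p p')).trans (add_smul _ _ v)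

open Classical in
/-- The action of all of `C⁺` on a stage, including that of the algebras `A_x^0`. The value `0` is
used only where `C⁺(y, z)` vanishes. -/
def plTotal {y z : C} (hy : R.deg y < α) (hz : R.deg z < α) :
    R.Pl y z →+ S.obj y hy →+ S.obj z hz :=
  if h : R.deg y < R.deg z then S.pl y z h hz
  else if e : y = z then e ▸ plSelf (S.obj y hy) else 0

open Classical in
/-- The action of all of `C⁻` on a stage, including that of the algebras `A_x^0`. The value `0` is
used only where `C⁻(y, z)` vanishes. -/
def miTotal {y z : C} (hy : R.deg y < α) (hz : R.deg z < α) :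
    R.Mi y z →+ S.obj y hy →+ S.obj z hz :=
  if h : R.deg z < R.deg y then S.mi y z h hy
  else if e : y = z then e ▸ miSelf (S.obj y hy) else 0

variable {S}

lemma plTotal_of_lt {y z : C} (h : R.deg y < R.deg z) (hz : R.deg z < α) (p : R.Pl y z)
    (v : S.obj y (h.trans hz)) : S.plTotal (h.trans hz) hz p v = S.pl y z h hz p v := by
  rw [plTotal, dif_pos h]

lemma plTotal_self {y : C} (hy : R.deg y < α) (p : R.Pl y y) (v : S.obj y hy) :
    S.plTotal hy hy p v = p.toAlg • v := by
  rw [plTotal, dif_neg (lt_irrefl _), dif_pos rfl]; rfl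

lemma miTotal_of_lt {y z : C} (h : R.deg z < R.deg y) (hy : R.deg y < α) (m : R.Mi y z)
    (v : S.obj y hy) : S.miTotal hy (h.trans hy) m v = S.mi y z h hy m v := by
  rw [miTotal, dif_pos h]

lemma miTotal_self {y : C} (hy : R.deg y < α) (m : R.Mi y y) (v : S.obj y hy) :
    S.miTotal hy hy m v = m.toAlg • v := by
  rw [miTotal, dif_neg (lt_irrefl _), dif_pos rfl]; rfl

lemma plTotal_eq_zero {y z : C} (hy : R.deg y < α) (hz : R.deg z < α) (h : ¬ R.deg y < R.deg z)
    (h' : y ≠ z) : S.plTotal hy hz = 0 := by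
  rw [plTotal, dif_neg h, dif_neg h']

lemma miTotal_eq_zero {y z : C} (hy : R.deg y < α) (hz : R.deg z < α) (h : ¬ R.deg z < R.deg y)
    (h' : y ≠ z) : S.miTotal hy hz = 0 := by
  rw [miTotal, dif_neg h, dif_neg h']

variable (S) in
/-- The restriction of a stage to objects of smaller degree. -/
abbrev restrict {β : Ordinal.{u}} (h : β ≤ α) : R.Stage β where
  obj y hy := S.obj y (hy.trans_le h)
  pl z y hz hy := S.pl z y hz (hy.trans_le h)
  mi y z hz hy := S.mi y z hz (hy.trans_le h)

variable (S) in
lemma plTotal_restrict {β : Ordinal.{u}} (h : β ≤ α) {y z : C} (hy : R.deg y < β)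
    (hz : R.deg z < β) (p : R.Pl y z) (v : S.obj y (hy.trans_le h)) :
    (S.restrict h).plTotal hy hz p v = S.plTotal (hy.trans_le h) (hz.trans_le h) p v := by
  by_cases hyz : R.deg y < R.deg z
  · exact (plTotal_of_lt (S := S.restrict h) hyz hz p v).trans (plTotal_of_lt hyz _ p v).symm
  by_cases e : y = z
  · subst e
    exact (plTotal_self (S := S.restrict h) hy p v).trans (plTotal_self _ p v).symm
  · rw [plTotal_eq_zero _ _ hyz e, plTotal_eq_zero _ _ hyz e]

variable (S) in
lemma miTotal_restrict {β : Ordinal.{u}} (h : β ≤ α) {y z : C} (hy : R.deg y < β)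
    (hz : R.deg z < β) (p : R.Mi y z) (v : S.obj y (hy.trans_le h)) :
    (S.restrict h).miTotal hy hz p v = S.miTotal (hy.trans_le h) (hz.trans_le h) p v := by
  by_cases hyz : R.deg z < R.deg y
  · exact (miTotal_of_lt (S := S.restrict h) hyz hy p v).trans (miTotal_of_lt hyz _ p v).symm
  by_cases e : y = z
  · subst e
    exact (miTotal_self (S := S.restrict h) hy p v).trans (miTotal_self _ p v).symm
  · rw [miTotal_eq_zero _ _ hyz e, miTotal_eq_zero _ _ hyz e]

variable (S)

/-- `ρ : C(y, z) ⟶ S(z)` describes the action of the morphisms of `C` on `v ∈ S(y)`: it is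
compatible with the actions of `C⁺` and `C⁻`. -/
def IsActionOn {y z : C} (hy : R.deg y < α) (hz : R.deg z < α) (v : S.obj y hy)
    (ρ : (y ⟶ z) →+ S.obj z hz) : Prop :=
  ∀ u (hu : R.deg u ≤ R.deg y) (_hu' : R.deg u ≤ R.deg z) (m : R.Mi y u) (p : R.Pl u z),
    ρ (m.hom ≫ p.hom) = S.plTotal (hu.trans_lt hy) hz p (S.miTotal hy (hu.trans_lt hy) m v)

/-- The axioms for a stage to be a module on the full subcategory `C_α`: the actions of `C⁺` and
`C⁻` are compatible with composition, and a morphism `p` of `C⁺` followed by a morphism `m` of `C⁻`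
acts as prescribed by the factorization of their composition. The last condition is stated for all
`ρ` describing the action on `v`; there is exactly one, but its existence rests on the other
conditions. -/
structure IsModule : Prop where
  pl_smul z y (h : R.deg z < R.deg y) (hy : R.deg y < α) (a : R.Alg y) (p : R.Pl z y) v :
    S.pl z y h hy (a • p) v = a • S.pl z y h hy p v
  pl_bal z y (h : R.deg z < R.deg y) (hy : R.deg y < α) (a : R.Alg z) (p : R.Pl z y) v :
    S.pl z y h hy (op a • p) v = S.pl z y h hy p (a • v)
  pl_comp w z y (h : R.deg w < R.deg z) (h' : R.deg z < R.deg y) (hy : R.deg y < α)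
    (q : R.Pl w z) (p : R.Pl z y) v :
    S.pl w y (h.trans h') hy (q.comp p) v = S.pl z y h' hy p (S.pl w z h (h'.trans hy) q v)
  mi_smul z y (h : R.deg z < R.deg y) (hy : R.deg y < α) (a : R.Alg z) (m : R.Mi y z) v :
    S.mi y z h hy (a • m) v = a • S.mi y z h hy m v
  mi_bal z y (h : R.deg z < R.deg y) (hy : R.deg y < α) (a : R.Alg y) (m : R.Mi y z) v :
    S.mi y z h hy (op a • m) v = S.mi y z h hy m (a • v)
  mi_comp w z y (h : R.deg w < R.deg z) (h' : R.deg z < R.deg y) (hy : R.deg y < α)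
    (m : R.Mi y z) (n : R.Mi z w) v :
    S.mi y w (h.trans h') hy (m.comp n) v = S.mi z w h (h'.trans hy) n (S.mi y z h' hy m v)
  exchange z y w (hz : R.deg z < R.deg y) (hw : R.deg w < R.deg y) (hy : R.deg y < α)
    (p : R.Pl z y) (m : R.Mi y w) v (ρ : (z ⟶ w) →+ S.obj w (hw.trans hy))
    (hρ : S.IsActionOn (hz.trans hy) (hw.trans hy) v ρ) :
    S.mi y w hw hy m (S.pl z y hz hy p v) = ρ (p.hom ≫ m.hom)

variable {S}

namespace IsModule

lemma plTotal_smul (hS : S.IsModule) {y z : C} (hy : R.deg y < α) (hz : R.deg z < α)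
    (a : R.Alg z) (p : R.Pl y z) (v : S.obj y hy) :
    S.plTotal hy hz (a • p) v = a • S.plTotal hy hz p v := by
  by_cases h : R.deg y < R.deg z
  · rw [plTotal_of_lt h, plTotal_of_lt h, hS.pl_smul]
  by_cases e : y = z
  · subst e
    rw [plTotal_self, plTotal_self, ← mul_smul]; rfl
  · rw [plTotal_eq_zero hy hz h e]; exact (smul_zero a).symm

lemma plTotal_bal (hS : S.IsModule) {y z : C} (hy : R.deg y < α) (hz : R.deg z < α)
    (a : R.Alg y) (p : R.Pl y z) (v : S.obj y hy) :
    S.plTotal hy hz (op a • p) v = S.plTotal hy hz p (a • v) := by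
  by_cases h : R.deg y < R.deg z
  · rw [plTotal_of_lt h, plTotal_of_lt h, hS.pl_bal]
  by_cases e : y = z
  · subst e
    rw [plTotal_self, plTotal_self, ← mul_smul]; rfl
  · rw [plTotal_eq_zero hy hz h e]; rfl

lemma miTotal_smul (hS : S.IsModule) {y z : C} (hy : R.deg y < α) (hz : R.deg z < α)
    (a : R.Alg z) (m : R.Mi y z) (v : S.obj y hy) :
    S.miTotal hy hz (a • m) v = a • S.miTotal hy hz m v := by
  by_cases h : R.deg z < R.deg y
  · rw [miTotal_of_lt h, miTotal_of_lt h, hS.mi_smul]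
  by_cases e : y = z
  · subst e
    rw [miTotal_self, miTotal_self, ← mul_smul]; rfl
  · rw [miTotal_eq_zero hy hz h e]; exact (smul_zero a).symm

lemma plTotal_comp (hS : S.IsModule) {w z y : C} (hw : R.deg w < α) (hz : R.deg z < α)
    (hy : R.deg y < α) (h : w = z ∨ R.deg w < R.deg z) (h' : z = y ∨ R.deg z < R.deg y)
    (q : R.Pl w z) (p : R.Pl z y) (v : S.obj w hw) :
    S.plTotal hw hy (q.comp p) v = S.plTotal hz hy p (S.plTotal hw hz q v) := by
  rcases h with rfl | h
  · rw [plTotal_self, ← hS.plTotal_bal]; rfl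
  rcases h' with rfl | h'
  · rw [plTotal_self, ← hS.plTotal_smul]; rfl
  rw [plTotal_of_lt (h.trans h'), plTotal_of_lt h', plTotal_of_lt h, hS.pl_comp]

lemma miTotal_bal (hS : S.IsModule) {y z : C} (hy : R.deg y < α) (hz : R.deg z < α)
    (a : R.Alg y) (m : R.Mi y z) (v : S.obj y hy) :
    S.miTotal hy hz (op a • m) v = S.miTotal hy hz m (a • v) := by
  by_cases h : R.deg z < R.deg y
  · rw [miTotal_of_lt h, miTotal_of_lt h, hS.mi_bal]
  by_cases e : y = z
  · subst e
    rw [miTotal_self, miTotal_self, ← mul_smul]; rfl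
  · rw [miTotal_eq_zero hy hz h e]; rfl

lemma miTotal_comp (hS : S.IsModule) {w z y : C} (hw : R.deg w < α) (hz : R.deg z < α)
    (hy : R.deg y < α) (h : z = w ∨ R.deg w < R.deg z) (h' : y = z ∨ R.deg z < R.deg y)
    (m : R.Mi y z) (n : R.Mi z w) (v : S.obj y hy) :
    S.miTotal hy hw (m.comp n) v = S.miTotal hz hw n (S.miTotal hy hz m v) := by
  rcases h' with rfl | h'
  · rw [miTotal_self, ← hS.miTotal_bal]; rfl
  rcases h with rfl | h
  · rw [miTotal_self, ← hS.miTotal_smul]; rfl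
  rw [miTotal_of_lt (h.trans h'), miTotal_of_lt h', miTotal_of_lt h, hS.mi_comp]

end IsModule

end

end Stage

end PreReedyStructure

namespace GeneralizedReedyStructure

open PreReedyStructure

variable {k : Type u} [CommRing k] {C : Type u} [SmallCategory C] [Preadditive C] [Linear k C]
  {R : GeneralizedReedyStructure k C}

section action

variable {α : Ordinal.{u}} {S : R.Stage α} (hS : S.IsModule)

/-- The action of the morphisms of `C_α` on a stage that is a module. -/
def action {y z : C} (hy : R.deg y < α) (hz : R.deg z < α) :
    (y ⟶ z) →+ S.obj y hy →+ S.obj z hz :=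
  R.homLift (E := S.obj y hy →+ S.obj z hz)
    (fun u hu _ => AddMonoidHom.mk' (fun p =>
      (AddMonoidHom.compHom (S.plTotal (hu.trans_lt hy) hz p)).comp
        (S.miTotal hy (hu.trans_lt hy))) fun p p' => by
      ext m v
      exact DFunLike.congr_fun (map_add (S.plTotal (hu.trans_lt hy) hz) p p') _)
    (fun u hu _ p a m => by
      ext v
      exact (hS.plTotal_bal (hu.trans_lt hy) hz a p _).trans
        (congrArg _ (hS.miTotal_smul hy (hu.trans_lt hy) a m v).symm))

lemma action_comp_hom {y z u : C} (hy : R.deg y < α) (hz : R.deg z < α) (hu : R.deg u ≤ R.deg y)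
    (hu' : R.deg u ≤ R.deg z) (m : R.Mi y u) (p : R.Pl u z) (v : S.obj y hy) :
    action hS hy hz (m.hom ≫ p.hom) v =
      S.plTotal (hu.trans_lt hy) hz p (S.miTotal hy (hu.trans_lt hy) m v) := by
  rw [action, R.homLift_comp _ _ hu hu']; rfl

lemma isActionOn_action {y z : C} (hy : R.deg y < α) (hz : R.deg z < α) (v : S.obj y hy) :
    S.IsActionOn hy hz v ((action hS hy hz).flip v) :=
  fun _ hu hu' m p => action_comp_hom hS hy hz hu hu' m p v

lemma deg_le_of_eq_or_lt {R : PreReedyStructure k C} {y z : C} (h : y = z ∨ R.deg y < R.deg z) :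
    R.deg y ≤ R.deg z := by
  rcases h with rfl | h
  exacts [le_rfl, h.le]

lemma deg_le_of_eq_or_gt {R : PreReedyStructure k C} {y z : C} (h : z = y ∨ R.deg y < R.deg z) :
    R.deg y ≤ R.deg z := by
  rcases h with rfl | h
  exacts [le_rfl, h.le]

lemma action_pl {y z : C} (hy : R.deg y < α) (hz : R.deg z < α)
    (h : y = z ∨ R.deg y < R.deg z) (p : R.Pl y z) (v : S.obj y hy) :
    action hS hy hz p.hom v = S.plTotal hy hz p v := by
  have := action_comp_hom hS hy hz le_rfl (deg_le_of_eq_or_lt h) (Mi.id _ y) p v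
  rw [Mi.hom_id, Category.id_comp, Stage.miTotal_self] at this
  rw [this]
  exact congrArg _ (one_smul (R.Alg y) v)

lemma action_mi {y z : C} (hy : R.deg y < α) (hz : R.deg z < α)
    (h : y = z ∨ R.deg z < R.deg y) (m : R.Mi y z) (v : S.obj y hy) :
    action hS hy hz m.hom v = S.miTotal hy hz m v := by
  have := action_comp_hom hS hy hz (deg_le_of_eq_or_gt h) le_rfl m (Pl.id _ z) v
  rw [Pl.hom_id, Category.comp_id, Stage.plTotal_self] at this
  rw [this]
  exact one_smul (R.Alg z) _

lemma action_alg {y : C} (hy : R.deg y < α) (a : R.Alg y) (v : S.obj y hy) :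
    action hS hy hy a.hom v = a • v := by
  have := action_pl hS hy hy (Or.inl rfl) (show R.Pl y y from a) v
  rw [Stage.plTotal_self] at this
  exact this

lemma action_comp_pl {x y z : C} (hx : R.deg x < α) (hy : R.deg y < α) (hz : R.deg z < α)
    (f : x ⟶ y) (h : y = z ∨ R.deg y < R.deg z) (p : R.Pl y z) (v : S.obj x hx) :
    action hS hx hz (f ≫ p.hom) v = S.plTotal hy hz p (action hS hx hy f v) := by
  induction f using R.hom_induction with
  | zero => rw [Limits.zero_comp, map_zero, map_zero]; exact (map_zero _).symm
  | add f g hf hg =>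
    rw [Preadditive.add_comp, map_add, map_add]
    exact (congrArg₂ (· + ·) hf hg).trans (map_add _ _ _).symm
  | comp u h1 h2 m q =>
    have h3 := deg_le_of_eq_or_gt h1
    have h4 := deg_le_of_eq_or_lt h2
    rw [Category.assoc, ← Pl.hom_comp, action_comp_hom hS hx hz h3
      (h4.trans (deg_le_of_eq_or_lt h)), action_comp_hom hS hx hy h3 h4,
      hS.plTotal_comp _ hy _ h2 h]

lemma action_mi_comp {x y z : C} (hx : R.deg x < α) (hy : R.deg y < α) (hz : R.deg z < α)
    (h : x = y ∨ R.deg y < R.deg x) (m : R.Mi x y) (f : y ⟶ z) (v : S.obj x hx) :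
    action hS hx hz (m.hom ≫ f) v = action hS hy hz f (S.miTotal hx hy m v) := by
  induction f using R.hom_induction with
  | zero => rw [Limits.comp_zero, map_zero, map_zero]; rfl
  | add f g hf hg =>
    rw [Preadditive.comp_add, map_add, map_add]
    exact congrArg₂ (· + ·) hf hg
  | comp u h1 h2 n q =>
    have h3 := deg_le_of_eq_or_gt h1
    have h4 := deg_le_of_eq_or_lt h2
    rw [← Category.assoc, ← Mi.hom_comp, action_comp_hom hS hx hz
      (h3.trans (deg_le_of_eq_or_gt h)) h4, action_comp_hom hS hy hz h3 h4,
      hS.miTotal_comp _ hy _ h1 h]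

/-- The exchange axiom, including the cases where the object in the middle is the source or the
target. -/
lemma action_pl_mi {x y z : C} (hx : R.deg x < α) (hy : R.deg y < α) (hz : R.deg z < α)
    (h : x = y ∨ R.deg x < R.deg y) (h' : y = z ∨ R.deg z < R.deg y) (p : R.Pl x y) (m : R.Mi y z)
    (v : S.obj x hx) :
    action hS hx hz (p.hom ≫ m.hom) v = S.miTotal hy hz m (S.plTotal hx hy p v) := by
  rcases h with rfl | h
  · rw [Stage.plTotal_self, ← hS.miTotal_bal, ← action_mi hS hx hz h']; rfl
  rcases h' with rfl | h'
  · rw [Stage.miTotal_self, ← hS.plTotal_smul, ← action_pl hS hx hy (Or.inr h)]; rfl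
  rw [Stage.plTotal_of_lt h, Stage.miTotal_of_lt h',
    hS.exchange x y z h h' hy p m v _ (isActionOn_action hS hx hz v)]
  rfl

/-- The action is functorial: by the factorization axiom this reduces to the exchange axiom. -/
lemma action_comp {x y z : C} (hx : R.deg x < α) (hy : R.deg y < α) (hz : R.deg z < α)
    (f : x ⟶ y) (g : y ⟶ z) (v : S.obj x hx) :
    action hS hx hz (f ≫ g) v = action hS hy hz g (action hS hx hy f v) := by
  induction f using R.hom_induction with
  | zero => rw [Limits.zero_comp, map_zero, map_zero]; exact (map_zero _).symm
  | add f f' hf hf' =>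
    rw [Preadditive.add_comp, map_add, map_add]
    exact (congrArg₂ (· + ·) hf hf').trans (map_add _ _ _).symm
  | comp u h1 h2 m p =>
    have h3 := deg_le_of_eq_or_gt h1
    have hu := h3.trans_lt hx
    rw [Category.assoc, action_mi_comp hS hx hu hz h1, action_comp_hom hS hx hy h3
      (deg_le_of_eq_or_lt h2)]
    generalize S.miTotal hx hu m v = w
    induction g using R.hom_induction with
    | zero => rw [Limits.comp_zero, map_zero, map_zero]; rfl
    | add g g' hg hg' =>
      rw [Preadditive.comp_add, map_add, map_add]
      exact congrArg₂ (· + ·) hg hg'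
    | comp t h5 h6 n q =>
      have h7 := deg_le_of_eq_or_gt h5
      rw [← Category.assoc, action_comp_pl hS hu (h7.trans_lt hy) hz _ h6,
        action_pl_mi hS hu hy _ h2 h5, action_comp_hom hS hy hz h7 (deg_le_of_eq_or_lt h6)]

lemma action_id {x : C} (hx : R.deg x < α) (v : S.obj x hx) : action hS hx hx (𝟙 x) v = v :=
  (action_alg hS hx (1 : R.Alg x) v).trans (one_smul _ v)

/-- A morphism of stages from a `C`-module is compatible with all of `C`. -/
lemma app_act {Y : CMod k C} (φ : (R.stage Y α).Hom S) {x y : C} (hx : R.deg x < α)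
    (hy : R.deg y < α) (f : x ⟶ y) (v : R.Value Y x) :
    φ.app y hy (R.act Y f v) = action hS hx hy f (φ.app x hx v) := by
  induction f using R.hom_induction with
  | zero => rw [act_zero, map_zero, map_zero]; rfl
  | add f g hf hg =>
    rw [act_add, map_add, map_add]
    exact congrArg₂ (· + ·) hf hg
  | comp u h h' m p =>
    have h3 := deg_le_of_eq_or_gt h
    have hu := h3.trans_lt hx
    rw [act_comp, action_comp_hom hS hx hy h3 (deg_le_of_eq_or_lt h')]
    have h1 : φ.app u hu (R.act Y m.hom v) = S.miTotal hx hu m (φ.app x hx v) := by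
      rcases h with rfl | h
      · rw [Stage.miTotal_self, ← map_smul]; rfl
      · rw [Stage.miTotal_of_lt h]; exact φ.mi_app x u h hx m v
    rw [← h1]
    rcases h' with rfl | h'
    · rw [Stage.plTotal_self, ← map_smul]; rfl
    · rw [Stage.plTotal_of_lt h']; exact φ.pl_app u y h' hy p _

/-- A morphism of stages to a `C`-module is compatible with all of `C`. -/
lemma app_action {Z : CMod k C} (φ : S.Hom (R.stage Z α)) {x y : C} (hx : R.deg x < α)
    (hy : R.deg y < α) (f : x ⟶ y) (v : S.obj x hx) :
    φ.app y hy (action hS hx hy f v) = R.act Z f (φ.app x hx v) := by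
  induction f using R.hom_induction with
  | zero => rw [act_zero, map_zero]; exact map_zero (φ.app y hy)
  | add f g hf hg =>
    rw [act_add, map_add]
    exact (map_add (φ.app y hy) _ _).trans (congrArg₂ (· + ·) hf hg)
  | comp u h h' m p =>
    have h3 := deg_le_of_eq_or_gt h
    have hu := h3.trans_lt hx
    rw [act_comp, action_comp_hom hS hx hy h3 (deg_le_of_eq_or_lt h')]
    have h1 : R.act Z m.hom (φ.app x hx v) = φ.app u hu (S.miTotal hx hu m v) := by
      rcases h with rfl | h
      · rw [Stage.miTotal_self, map_smul]; rfl
      · rw [Stage.miTotal_of_lt h]; exact (φ.mi_app x u h hx m v).symm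
    rw [h1]
    rcases h' with rfl | h'
    · rw [Stage.plTotal_self, map_smul]; rfl
    · rw [Stage.plTotal_of_lt h']; exact φ.pl_app u y h' hy p _

end action

section toModule

variable {α : Ordinal.{u}} {S : R.Stage α} (hS : S.IsModule) (hα : ∀ x, R.deg x < α)

instance (x : C) : Algebra k (R.Alg x) := inferInstanceAs (Algebra k (R.A x))

lemma hom_algebraMap (x : C) (r : k) : (algebraMap k (R.Alg x) r).hom = r • 𝟙 x := by
  rw [Algebra.algebraMap_eq_smul_one]; rfl

lemma action_smul_id {x : C} (hx : R.deg x < α) (r : k) (v : S.obj x hx) :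
    action hS hx hx (r • 𝟙 x) v = algebraMap k (R.Alg x) r • v := by
  rw [← hom_algebraMap, action_alg]

/-- A stage containing all objects, if it is a module, as a `k`-linear functor. -/
def toCMod : CMod k C where
  obj :=
    { obj := fun x =>
        letI := Module.compHom (S.obj x (hα x)) (algebraMap k (R.Alg x))
        ModuleCat.of k (S.obj x (hα x))
      map := fun {x y} f =>
        letI := Module.compHom (S.obj x (hα x)) (algebraMap k (R.Alg x))
        letI := Module.compHom (S.obj y (hα y)) (algebraMap k (R.Alg y))
        ModuleCat.ofHom
          { toFun := action hS (hα x) (hα y) f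
            map_add' := map_add _
            map_smul' := fun r v => by
              change action hS (hα x) (hα y) f (algebraMap k (R.Alg x) r • v) =
                algebraMap k (R.Alg y) r • action hS (hα x) (hα y) f v
              rw [← action_smul_id hS, ← action_smul_id hS, ← action_comp, ← action_comp,
                Linear.smul_comp, Linear.comp_smul, Category.id_comp, Category.comp_id] }
      map_id := fun x => by
        ext v
        exact action_id hS (hα x) v
      map_comp := fun {x y z} f g => by
        ext v
        exact action_comp hS (hα x) (hα y) (hα z) f g v }
  property := by
    refine ⟨⟨fun {x y f g} => ?_⟩, ⟨fun {x y} f r => ?_⟩⟩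
    · ext v
      exact DFunLike.congr_fun (map_add (action hS (hα x) (hα y)) f g) v
    · ext v
      change action hS (hα x) (hα y) (r • f) v =
        algebraMap k (R.Alg y) r • action hS (hα x) (hα y) f v
      rw [← action_smul_id hS, ← action_comp, Linear.comp_smul, Category.comp_id]

/-- The values of the module given by a stage are those of the stage. -/
def toCModValue (x : C) : S.obj x (hα x) ≃ₗ[R.Alg x] R.Value (toCMod hS hα) x where
  toFun v := v
  invFun v := v
  left_inv _ := rfl
  right_inv _ := rfl
  map_add' _ _ := rfl
  map_smul' a v := (action_alg hS (hα x) a v).symm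

end toModule

end GeneralizedReedyStructure

/-! ### Factorization of morphisms -/

/-- Recursive choice of elements `t x` together with structure `h x y` relating `t x` to the
previous elements `t y`: it is possible as soon as every such choice below `x` extends to `x`. -/
lemma exists_forall_of_exists_extension_pairs {C : Type*} {α : Type*} [Preorder α]
    [WellFoundedLT α] (deg : C → α) {T : C → Type*} {H : ∀ x y, T x → T y → Type*}
    [∀ x, Nonempty (T x)] [∀ x y t s, Nonempty (H x y t s)]
    (P : ∀ x (t : ∀ y, deg y < deg x → T y)
      (_h : ∀ y z (hz : deg z < deg y) (hy : deg y < deg x), H y z (t y hy) (t z (hz.trans hy)))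
      (s : T x) (_c : ∀ y (hy : deg y < deg x), H x y s (t y hy)), Prop)
    (step : ∀ x t h, (∀ y (hy : deg y < deg x), P y (fun z hz => t z (hz.trans hy))
        (fun z w hw hz => h z w hw (hz.trans hy)) (t y hy) (fun z hz => h y z hz hy)) →
      ∃ s c, P x t h s c) :
    ∃ (t : ∀ x, T x) (h : ∀ x y, deg y < deg x → H x y (t x) (t y)), ∀ x,
      P x (fun y _ => t y) (fun y z hz _ => h y z hz) (t x) (fun y hy => h x y hy) := by
  classical
  have wf : WellFounded fun y x : C => deg y < deg x := InvImage.wf deg wellFounded_lt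
  let M : C → Type _ := fun x => Σ t : T x, ∀ y, deg y < deg x → ∀ s : T y, H x y t s
  let F : ∀ x, (∀ y, deg y < deg x → M y) → M x := fun x ih =>
    if hx : ∃ s c, P x (fun y hy => (ih y hy).1)
      (fun y z hz hy => (ih y hy).2 z hz (ih z (hz.trans hy)).1) s c
    then ⟨hx.choose, fun y hy s => if e : (ih y hy).1 = s then e ▸ hx.choose_spec.choose y hy
      else Classical.arbitrary _⟩
    else ⟨Classical.arbitrary _, fun _ _ _ => Classical.arbitrary _⟩
  let G : ∀ x, M x := wf.fix F
  refine ⟨fun x => (G x).1, fun x y hy => (G x).2 y hy (G y).1, fun x => ?_⟩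
  refine wf.induction (C := fun x => P x (fun y _ => (G y).1)
    (fun y z hz _ => (G y).2 z hz (G z).1) (G x).1 (fun y hy => (G x).2 y hy (G y).1)) x
    fun x ih => ?_
  have hx := step x (fun y _ => (G y).1) (fun y z hz _ => (G y).2 z hz (G z).1) ih
  have hG : G x = ⟨hx.choose, fun y hy s => if e : (G y).1 = s then
      e ▸ hx.choose_spec.choose y hy else Classical.arbitrary _⟩ := by
    change wf.fix F x = _
    rw [wf.fix_eq]
    exact dif_pos hx
  rw [hG]
  have := hx.choose_spec.choose_spec
  convert this using 3 with y hy
  exact dif_pos rfl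

namespace GeneralizedReedyStructure

open PreReedyStructure

variable {k : Type u} [CommRing k] {C : Type u} [SmallCategory C] [Preadditive C] [Linear k C]
  {R : GeneralizedReedyStructure k C} {Y Z : CMod k C} (f : Y ⟶ Z)

section

variable (R)

/-- A module over `A_x^0` with maps from `Y(x)` and to `Z(x)`. -/
structure FactorObj (Y Z : CMod k C) (x : C) where
  obj : ModuleCat.{u} (R.Alg x)
  ι : R.Value Y x →ₗ[R.Alg x] obj
  π : obj →ₗ[R.Alg x] R.Value Z x

variable {R}

/-- Actions of `C⁺(y, x)` and `C⁻(x, y)` between the modules at `x` and `y`. -/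
abbrev FactorHom {x y : C} (s : R.FactorObj Y Z x) (t : R.FactorObj Y Z y) : Type u :=
  (R.Pl y x →+ t.obj →+ s.obj) × (R.Mi x y →+ s.obj →+ t.obj)

instance (x : C) : Nonempty (R.FactorObj Y Z x) := ⟨⟨ModuleCat.of _ PUnit, 0, 0⟩⟩

variable {α : Ordinal.{u}} (t : ∀ y, R.deg y < α → R.FactorObj Y Z y)
  (h : ∀ y z (hz : R.deg z < R.deg y) (hy : R.deg y < α), FactorHom (t y hy) (t z (hz.trans hy)))

/-- The stage with the given modules and actions. -/
abbrev stageOf : R.Stage α where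
  obj y hy := (t y hy).obj
  pl z y hz hy := (h y z hz hy).1
  mi y z hz hy := (h y z hz hy).2

end

section

variable (𝒬 𝒱 : R.ClassFamily)

/-- The conditions on the value at `x` of a factorization `Y ⟶ X ⟶ Z` of `f`, relatively to the
values at the objects of smaller degree: the module axioms for the actions between `x` and those
objects, naturality of the two maps, and the conditions on the relative latching and matching maps
at `x`. The latter involve the maps out of the latching object and into the matching object, and the
morphisms of stages, which the data define on account of the former conditions; they are quantified
over, together with the equations that determine them, in order to be independent of proofs. -/
structure IsStep {x : C} (t : ∀ y, R.deg y < R.deg x → R.FactorObj Y Z y)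
    (h : ∀ y z (hz : R.deg z < R.deg y) (hy : R.deg y < R.deg x),
      FactorHom (t y hy) (t z (hz.trans hy)))
    (s : R.FactorObj Y Z x) (c : ∀ y (hy : R.deg y < R.deg x), FactorHom s (t y hy)) : Prop where
  pl_smul z hz (a : R.Alg x) p v : (c z hz).1 (a • p) v = a • (c z hz).1 p v
  pl_bal z hz (a : R.Alg z) p v : (c z hz).1 (op a • p) v = (c z hz).1 p (a • v)
  pl_comp w z (hw : R.deg w < R.deg z) hz (q : R.Pl w z) (p : R.Pl z x) v :
    (c w (hw.trans hz)).1 (q.comp p) v = (c z hz).1 p ((h z w hw hz).1 q v)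
  mi_smul z hz (a : R.Alg z) m v : (c z hz).2 (a • m) v = a • (c z hz).2 m v
  mi_bal z hz (a : R.Alg x) m v : (c z hz).2 (op a • m) v = (c z hz).2 m (a • v)
  mi_comp w z (hw : R.deg w < R.deg z) hz (m : R.Mi x z) (n : R.Mi z w) v :
    (c w (hw.trans hz)).2 (m.comp n) v = (h z w hw hz).2 n ((c z hz).2 m v)
  exchange z w hz hw (p : R.Pl z x) (m : R.Mi x w) v (ρ : (z ⟶ w) →+ (t w hw).obj)
    (hρ : (stageOf t h).IsActionOn hz hw v ρ) :
    (c w hw).2 m ((c z hz).1 p v) = ρ (p.hom ≫ m.hom)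
  ι_pl z hz (p : R.Pl z x) v : s.ι (R.act Y p.hom v) = (c z hz).1 p ((t z hz).ι v)
  ι_mi z hz (m : R.Mi x z) v : (t z hz).ι (R.act Y m.hom v) = (c z hz).2 m (s.ι v)
  π_pl z hz (p : R.Pl z x) v : s.π ((c z hz).1 p v) = R.act Z p.hom ((t z hz).π v)
  π_mi z hz (m : R.Mi x z) v : (t z hz).π ((c z hz).2 m v) = R.act Z m.hom (s.π v)
  fac v : s.π (s.ι v) = R.valueMap f x v
  injective (c' : Cone (stageOf t h) s.obj) (_ : ∀ z hz p v, c'.φ z hz p v = (c z hz).1 p v)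
    (ιS : (R.stage Y (R.deg x)).Hom (stageOf t h)) (_ : ∀ z hz, ιS.app z hz = (t z hz).ι) b a :
    Latch.lift c' b + s.ι a = 0 → ∃ b', Latch.map ιS b' = b ∧ R.latch Y x b' = -a
  cokernel (c' : Cone (stageOf t h) s.obj) (_ : ∀ z hz p v, c'.φ z hz p v = (c z hz).1 p v) :
    𝒬 x (ModuleCat.of (R.Alg x) (s.obj ⧸ LinearMap.range ((Latch.lift c').coprod s.ι)))
  surjective (μ : s.obj →ₗ[R.Alg x] Match (stageOf t h))
    (_ : ∀ v z hz m, (μ v).eval hz m = (c z hz).2 m v)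
    (πS : (stageOf t h).Hom (R.stage Z (R.deg x))) (_ : ∀ z hz, πS.app z hz = (t z hz).π) φ z :
    Match.map πS φ = R.matching Z x z → ∃ v, μ v = φ ∧ s.π v = z
  kernel (μ : s.obj →ₗ[R.Alg x] Match (stageOf t h))
    (_ : ∀ v z hz m, (μ v).eval hz m = (c z hz).2 m v) :
    𝒱 x (ModuleCat.of (R.Alg x) (LinearMap.ker (μ.prod s.π)))

variable {f 𝒬 𝒱}

section

variable {α : Ordinal.{u}} {t : ∀ y, R.deg y < α → R.FactorObj Y Z y}
  {h : ∀ y z (hz : R.deg z < R.deg y) (hy : R.deg y < α), FactorHom (t y hy) (t z (hz.trans hy))}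
  (H : ∀ y (hy : R.deg y < α), IsStep f 𝒬 𝒱 (fun z hz => t z (hz.trans hy))
    (fun z w hw hz => h z w hw (hz.trans hy)) (t y hy) (fun z hz => h y z hz hy))

include H

lemma isModule_stageOf : (stageOf t h).IsModule where
  pl_smul z y hz hy := (H y hy).pl_smul z hz
  pl_bal z y hz hy := (H y hy).pl_bal z hz
  pl_comp w z y hw hz hy := (H y hy).pl_comp w z hw hz
  mi_smul z y hz hy := (H y hy).mi_smul z hz
  mi_bal z y hz hy := (H y hy).mi_bal z hz
  mi_comp w z y hw hz hy := (H y hy).mi_comp w z hw hz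
  exchange z y w hz hw hy p m v ρ hρ := (H y hy).exchange z w hz hw p m v ρ
    fun u hu hu' m p => by
      refine (hρ u hu hu' m p).trans ?_
      exact (((stageOf t h).plTotal_restrict hy.le _ hw p _).trans (congrArg _
        ((stageOf t h).miTotal_restrict hy.le hz _ m v))).symm

lemma exists_stageOf_ι : ∃ ιS : (R.stage Y α).Hom (stageOf t h), ∀ z hz, ιS.app z hz = (t z hz).ι :=
  ⟨{ app := fun y hy => (t y hy).ι
     pl_app := fun z y hz hy p v => (H y hy).ι_pl z hz p v
     mi_app := fun y z hz hy m v => (H y hy).ι_mi z hz m v }, fun _ _ => rfl⟩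

lemma exists_stageOf_π : ∃ πS : (stageOf t h).Hom (R.stage Z α), ∀ z hz, πS.app z hz = (t z hz).π :=
  ⟨{ app := fun y hy => (t y hy).π
     pl_app := fun z y hz hy p v => (H y hy).π_pl z hz p v
     mi_app := fun y z hz hy m v => (H y hy).π_mi z hz m v }, fun _ _ => rfl⟩

end

/-- The element `m ↦ (m ∘ g) v` of the matching object of a stage that is a module. -/
def actMatch {x : C} {S : R.Stage (R.deg x)} (hS : S.IsModule) {z : C} (hz : R.deg z < R.deg x)
    (g : z ⟶ x) (v : S.obj z hz) : Match S :=
  Match.mk (fun w hw => AddMonoidHom.mk' (fun m => action hS hz hw (g ≫ m.hom) v)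
      fun m m' => by
        rw [map_add, Preadditive.comp_add, map_add]; rfl)
    (fun w hw a m => by
      change action hS hz hw (g ≫ m.hom ≫ a.hom) v = _
      rw [← Category.assoc, action_comp hS hz hw hw]
      exact action_alg hS hw a _)
    (fun w w' hw' hw m n => by
      change action hS hz _ (g ≫ m.hom ≫ n.hom) v = _
      rw [← Category.assoc, action_comp hS hz hw (hw'.trans hw),
        action_mi hS hw _ (Or.inr hw'), Stage.miTotal_of_lt hw']
      rfl)

lemma actMatch_eval {x : C} {S : R.Stage (R.deg x)} (hS : S.IsModule) {z w : C}
    (hz : R.deg z < R.deg x) (hw : R.deg w < R.deg x) (g : z ⟶ x) (v : S.obj z hz)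
    (m : R.Mi x w) : (actMatch hS hz g v).eval hw m = action hS hz hw (g ≫ m.hom) v := rfl

/-- The canonical map from the latching to the matching object of a stage that is a module,
`p ⊗ v ↦ (m ↦ (m ∘ p) v)`. -/
def latchToMatch {x : C} {S : R.Stage (R.deg x)} (hS : S.IsModule) :
    Latch S →ₗ[R.Alg x] Match S :=
  Latch.lift
    { φ := fun z hz => AddMonoidHom.mk' (fun p => AddMonoidHom.mk' (fun v =>
          actMatch hS hz p.hom v) fun v v' => Match.ext fun w hw m => by
            rw [Match.add_eval, actMatch_eval, actMatch_eval, actMatch_eval, map_add])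
        fun p p' => AddMonoidHom.ext fun v => Match.ext fun w hw m => by
          change (actMatch hS hz (p + p').hom v).eval hw m =
            (actMatch hS hz p.hom v + actMatch hS hz p'.hom v).eval hw m
          rw [Match.add_eval, actMatch_eval, actMatch_eval, actMatch_eval, map_add,
            Preadditive.add_comp, map_add]
          rfl
      smul := fun z hz a p v => Match.ext fun w hw m =>
        congrArg (fun f => action hS hz hw f v) (Category.assoc p.hom a.hom m.hom)
      bal := fun z hz a p v => Match.ext fun w hw m => by
        change (actMatch hS hz (op a • p).hom v).eval hw m =
          (actMatch hS hz p.hom (a • v)).eval hw m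
        rw [actMatch_eval, actMatch_eval, Pl.hom_op_smul, Category.assoc,
          action_comp hS hz hz hw, action_alg]
      comp := fun z y hz hy q p v => Match.ext fun w hw m => by
        change (actMatch hS (hz.trans hy) (q.comp p).hom v).eval hw m =
          (actMatch hS hy p.hom (S.pl z y hz hy q v)).eval hw m
        rw [actMatch_eval, actMatch_eval, Pl.hom_comp, Category.assoc,
          action_comp hS (hz.trans hy) hy hw, action_pl hS (hz.trans hy) hy (Or.inr hz),
          Stage.plTotal_of_lt hz] }

lemma latchToMatch_cone {x : C} {S : R.Stage (R.deg x)} (hS : S.IsModule) {z w : C}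
    (hz : R.deg z < R.deg x) (hw : R.deg w < R.deg x) (p : R.Pl z x) (v : S.obj z hz)
    (m : R.Mi x w) : (latchToMatch hS ((Latch.cone S).φ z hz p v)).eval hw m =
      action hS hz hw (p.hom ≫ m.hom) v := by
  rw [latchToMatch, Latch.lift_cone]
  exact actMatch_eval hS hz hw p.hom v m

end

end GeneralizedReedyStructure

namespace PreReedyStructure

variable {k : Type u} [CommRing k] {C : Type u} [SmallCategory C] [Preadditive C] [Linear k C]
  {R : PreReedyStructure k C} {x : C} {S S' S'' : R.Stage (R.deg x)}

lemma Latch.map_map (f : S.Hom S') (g : S'.Hom S'') (t : Latch S) :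
    Latch.map g (Latch.map f t) = Latch.map (f.comp g) t := by
  induction t using Latch.induction_on with
  | zero => simp only [map_zero]
  | add s t hs ht => simp only [map_add, hs, ht]
  | cone y hy p v => rw [Latch.map_cone, Latch.map_cone, Latch.map_cone]; rfl

lemma Latch.map_eq_self (f : S.Hom S) (hf : ∀ y hy v, f.app y hy v = v) (t : Latch S) :
    Latch.map f t = t := by
  induction t using Latch.induction_on with
  | zero => simp only [map_zero]
  | add s t hs ht => simp only [map_add, hs, ht]
  | cone y hy p v => rw [Latch.map_cone, hf]

lemma Latch.map_congr (f g : S.Hom S') (h : ∀ y hy v, f.app y hy v = g.app y hy v) (t : Latch S) :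
    Latch.map f t = Latch.map g t := by
  induction t using Latch.induction_on with
  | zero => simp only [map_zero]
  | add s t hs ht => simp only [map_add, hs, ht]
  | cone y hy p v => rw [Latch.map_cone, Latch.map_cone, h]

lemma mem_of_linearEquiv (𝒮 : R.ClassFamily) (h : (𝒮 x).IsStableUnderRetracts) {M N : Type u}
    [AddCommGroup M] [AddCommGroup N] [Module (R.Alg x) M] [Module (R.Alg x) N]
    (e : M ≃ₗ[R.Alg x] N) (hM : 𝒮 x (ModuleCat.of (R.Alg x) M)) :
    𝒮 x (ModuleCat.of (R.Alg x) N) := by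
  let 𝒮' : ObjectProperty (ModuleCat.{u} (R.Alg x)) := 𝒮 x
  have h' : 𝒮'.IsStableUnderRetracts := h
  exact ObjectProperty.IsStableUnderRetracts.of_linearEquiv h' e hM

lemma mem_of_linear_retract (𝒮 : R.ClassFamily) (h : (𝒮 x).IsStableUnderRetracts) {M N : Type u}
    [AddCommGroup M] [AddCommGroup N] [Module (R.Alg x) M] [Module (R.Alg x) N]
    (i : N →ₗ[R.Alg x] M) (r : M →ₗ[R.Alg x] N) (hir : ∀ n, r (i n) = n)
    (hM : 𝒮 x (ModuleCat.of (R.Alg x) M)) : 𝒮 x (ModuleCat.of (R.Alg x) N) := by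
  let 𝒮' : ObjectProperty (ModuleCat.{u} (R.Alg x)) := 𝒮 x
  have h' : 𝒮'.IsStableUnderRetracts := h
  exact ObjectProperty.IsStableUnderRetracts.of_linear_retract h' i r hir hM

end PreReedyStructure

namespace GeneralizedReedyStructure

open PreReedyStructure

variable {k : Type u} [CommRing k] {C : Type u} [SmallCategory C] [Preadditive C] [Linear k C]
  {R : GeneralizedReedyStructure k C} {Y Z : CMod k C} {f : Y ⟶ Z} {𝒬 𝒱 : R.ClassFamily}

lemma eq_action_of_isActionOn {α : Ordinal.{u}} {S : R.Stage α} (hS : S.IsModule) {y z : C}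
    (hy : R.deg y < α) (hz : R.deg z < α) (v : S.obj y hy) {ρ : (y ⟶ z) →+ S.obj z hz}
    (hρ : S.IsActionOn hy hz v ρ) (g : y ⟶ z) : action hS hy hz g v = ρ g := by
  induction g using R.hom_induction with
  | zero => rw [map_zero, map_zero]; rfl
  | add f g hf hg => rw [map_add, map_add, ← hf, ← hg]; rfl
  | comp u h h' m p =>
    rw [hρ u (deg_le_of_eq_or_gt h) (deg_le_of_eq_or_lt h'),
      action_comp_hom hS hy hz (deg_le_of_eq_or_gt h) (deg_le_of_eq_or_lt h')]

section step

variable {x : C} {t : ∀ y, R.deg y < R.deg x → R.FactorObj Y Z y}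
  {h : ∀ y z (hz : R.deg z < R.deg y) (hy : R.deg y < R.deg x),
    FactorHom (t y hy) (t z (hz.trans hy))}

lemma map_latchToMatch (hS : (stageOf t h).IsModule)
    (πS : (stageOf t h).Hom (R.stage Z (R.deg x))) (b : Latch (stageOf t h)) :
    Match.map πS (latchToMatch hS b) = R.matching Z x (R.latch Z x (Latch.map πS b)) := by
  induction b using Latch.induction_on with
  | zero => simp only [map_zero]
  | add s t hs ht => simp only [map_add, hs, ht]
  | cone y hy p v =>
    refine Match.ext fun w hw m => ?_
    rw [Match.map_eval, latchToMatch_cone, app_action hS πS hy hw, Latch.map_cone, matching_eval,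
      latch_cone, act_comp]

lemma latchToMatch_map (hS : (stageOf t h).IsModule)
    (ιS : (R.stage Y (R.deg x)).Hom (stageOf t h)) (b : Latch (R.stage Y (R.deg x))) :
    latchToMatch hS (Latch.map ιS b) = Match.map ιS (R.matching Y x (R.latch Y x b)) := by
  induction b using Latch.induction_on with
  | zero => simp only [map_zero]
  | add s t hs ht => simp only [map_add, hs, ht]
  | cone y hy p v =>
    refine Match.ext fun w hw m => ?_
    rw [Latch.map_cone, latchToMatch_cone, Match.map_eval, matching_eval, latch_cone, ← act_comp]
    exact (app_act hS ιS hy hw _ v).symm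

/-- The inductive step: the value at `x` is a factorization, with respect to the cotorsion pair
at `x`, of the canonical map from the relative latching to the relative matching object. -/
lemma exists_isStep (hcot : ∀ x, IsCompleteCotorsionPair (𝒬 x) (𝒱 x))
    (H : ∀ y (hy : R.deg y < R.deg x), IsStep f 𝒬 𝒱 (fun z hz => t z (hz.trans hy))
      (fun z w hw hz => h z w hw (hz.trans hy)) (t y hy) (fun z hz => h y z hz hy)) :
    ∃ s c, IsStep f 𝒬 𝒱 t h s c := by
  have hS := isModule_stageOf H
  obtain ⟨ιS, hιS⟩ := exists_stageOf_ι H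
  obtain ⟨πS, hπS⟩ := exists_stageOf_π H
  have hfac : ∀ y hy v, πS.app y hy (ιS.app y hy v) = R.valueMap f y v := fun y hy v => by
    rw [hιS, hπS]; exact (H y hy).fac v
  -- `c₀` induces a map from the pushout of `L_x X` and `Y(x)` over `L_x Y`, the quotient by `K`, to
  -- the pullback `W` of `M_x X` and `Z(x)` over `M_x Z`.
  let c₀ : (Latch (stageOf t h) × R.Value Y x) →ₗ[R.Alg x] Match (stageOf t h) × R.Value Z x :=
    ((latchToMatch hS).prod (R.latch Z x ∘ₗ Latch.map πS)).coprod
      ((Match.map ιS ∘ₗ R.matching Y x).prod (R.valueMap f x))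
  have hc₀ : ∀ b a, c₀ (b, a) = (latchToMatch hS b + Match.map ιS (R.matching Y x a),
    R.latch Z x (Latch.map πS b) + R.valueMap f x a) := fun _ _ => rfl
  let W : Submodule (R.Alg x) (Match (stageOf t h) × R.Value Z x) :=
    LinearMap.eqLocus (Match.map πS ∘ₗ LinearMap.fst _ _ _) (R.matching Z x ∘ₗ LinearMap.snd _ _ _)
  have hW : ∀ r, c₀ r ∈ W := by
    rintro ⟨b, a⟩
    rw [hc₀]
    change Match.map πS (_ + _) = R.matching Z x (_ + _)
    rw [map_add, map_add, map_latchToMatch]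
    congr 1
    refine Match.ext fun w hw m => ?_
    rw [Match.map_eval, Match.map_eval, matching_eval, matching_eval, hfac, valueMap_act]
  let K : Submodule (R.Alg x) (Latch (stageOf t h) × R.Value Y x) :=
    LinearMap.range ((Latch.map ιS).prod (-R.latch Y x))
  have hK : K ≤ LinearMap.ker (c₀.codRestrict W hW) := by
    rintro _ ⟨b, rfl⟩
    refine Subtype.ext ?_
    change c₀ (Latch.map ιS b, -R.latch Y x b) = 0
    rw [hc₀, latchToMatch_map, map_neg, map_neg, add_neg_cancel, map_neg, Latch.map_map,
      Latch.map_congr _ (R.stageMap f _) hfac, latch_map, add_neg_cancel]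
    rfl
  let 𝒬' : ObjectProperty (ModuleCat.{u} (R.Alg x)) := 𝒬 x
  let 𝒱' : ObjectProperty (ModuleCat.{u} (R.Alg x)) := 𝒱 x
  have hcot' : IsCompleteCotorsionPair 𝒬' 𝒱' := hcot x
  obtain ⟨T, i, q, hqi, hi, hi', hq, hq'⟩ := hcot'.exists_factorization
    (K.liftQ (c₀.codRestrict W hW) hK)
  let ι' : (Latch (stageOf t h) × R.Value Y x) →ₗ[R.Alg x] T := i ∘ₗ K.mkQ
  let κ : T →ₗ[R.Alg x] Match (stageOf t h) × R.Value Z x := W.subtype ∘ₗ q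
  have hκι : ∀ r, κ (ι' r) = c₀ r := fun r =>
    congrArg Subtype.val (LinearMap.congr_fun hqi (K.mkQ r))
  have hι' : ∀ r, ι' r = 0 ↔ ∃ b, (Latch.map ιS b, -R.latch Y x b) = r := fun r => by
    change i (K.mkQ r) = 0 ↔ _
    rw [map_eq_zero_iff i hi, Submodule.mkQ_apply, Submodule.Quotient.mk_eq_zero]
    rfl
  have hκW : ∀ v, Match.map πS (κ v).1 = R.matching Z x (κ v).2 := fun v => (q v).2
  let s : R.FactorObj Y Z x :=
    ⟨T, ι' ∘ₗ LinearMap.inr _ _ _, LinearMap.snd _ _ _ ∘ₗ κ⟩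
  let ιL : Latch (stageOf t h) →ₗ[R.Alg x] T := ι' ∘ₗ LinearMap.inl _ _ _
  let κM : T →ₗ[R.Alg x] Match (stageOf t h) := LinearMap.fst _ _ _ ∘ₗ κ
  let c : ∀ y (hy : R.deg y < R.deg x), FactorHom s (t y hy) := fun y hy =>
    (((Latch.cone (stageOf t h)).postcomp ιL).φ y hy,
      AddMonoidHom.mk' (fun m => AddMonoidHom.mk' (fun v => (κM v).eval hy m)
        fun v v' => by rw [map_add]; rfl)
        fun m m' => AddMonoidHom.ext fun v => map_add ((κM v).eval hy) m m')
  have hιL : ∀ r : Latch (stageOf t h) × R.Value Y x, ι' r = ιL r.1 + s.ι r.2 := fun r => by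
    change _ = ι' (r.1, 0) + ι' (0, r.2)
    rw [← map_add, Prod.mk_add_mk, add_zero, zero_add]
  have hlift : ∀ c' : Cone (stageOf t h) s.obj, (∀ z hz p v, c'.φ z hz p v = (c z hz).1 p v) →
      Latch.lift c' = ιL := fun c' hc' => Latch.hom_ext fun y hy p v => by
    rw [Latch.lift_cone, hc']; rfl
  have hκM : ∀ μ : s.obj →ₗ[R.Alg x] Match (stageOf t h),
      (∀ v z hz m, (μ v).eval hz m = (c z hz).2 m v) → μ = κM := fun μ hμ =>
    LinearMap.ext fun v => Match.ext fun z hz m => hμ v z hz m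
  refine ⟨s, c, ?_⟩
  exact
    { pl_smul := ((Latch.cone (stageOf t h)).postcomp ιL).smul
      pl_bal := ((Latch.cone (stageOf t h)).postcomp ιL).bal
      pl_comp := fun w z hw hz q p v =>
        ((Latch.cone (stageOf t h)).postcomp ιL).comp w z hw hz q p v
      mi_smul := fun z hz a m v => (κM v).eval_smul hz a m
      mi_bal := fun z hz a m v => (congrArg (fun φ => Match.eval φ hz m) (map_smul κM a v)).symm
      mi_comp := fun w z hw hz m n v => (κM v).eval_comp hw hz m n
      exchange := fun z w hz hw p m v ρ hρ => by
        have h1 : (κM (ιL ((Latch.cone _).φ z hz p v))).eval hw m =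
            (latchToMatch hS ((Latch.cone _).φ z hz p v)).eval hw m := by
          have : κM (ιL ((Latch.cone _).φ z hz p v)) =
              latchToMatch hS ((Latch.cone _).φ z hz p v) + Match.map ιS (R.matching Y x 0) :=
            congrArg Prod.fst (hκι _)
          rw [this, map_zero, map_zero, add_zero]
        refine h1.trans ?_
        rw [latchToMatch_cone, eq_action_of_isActionOn hS hz hw v hρ]
      ι_pl := fun z hz p v => by
        have h1 : ι' ((Latch.cone _).φ z hz p (ιS.app z hz v), - R.act Y p.hom v) = 0 :=
          (hι' _).2 ⟨(Latch.cone _).φ z hz p v, by rw [Latch.map_cone, latch_cone]⟩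
        rw [hιL, map_neg, ← sub_eq_add_neg, sub_eq_zero] at h1
        rw [← hιS]
        exact h1.symm
      ι_mi := fun z hz m v => by
        have : κM (s.ι v) = latchToMatch hS 0 + Match.map ιS (R.matching Y x v) :=
          congrArg Prod.fst (hκι _)
        rw [map_zero, zero_add] at this
        refine Eq.trans ?_ (congrArg (fun φ => Match.eval φ hz m) this).symm
        rw [← hιS, Match.map_eval, matching_eval]
      π_pl := fun z hz p v => by
        have : s.π (ιL ((Latch.cone _).φ z hz p v)) =
            R.latch Z x (Latch.map πS ((Latch.cone _).φ z hz p v)) + R.valueMap f x 0 :=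
          congrArg Prod.snd (hκι _)
        rw [map_zero, add_zero, Latch.map_cone, latch_cone, hπS] at this
        exact this
      π_mi := fun z hz m v => by
        rw [← hπS]
        exact congrArg (fun φ => Match.eval φ hz m) (hκW v)
      fac := fun v => by
        have : s.π (s.ι v) = R.latch Z x (Latch.map πS 0) + R.valueMap f x v :=
          congrArg Prod.snd (hκι _)
        rw [this, map_zero, map_zero, zero_add]
      injective := fun c' hc' ιS' hιS' b a hba => by
        rw [hlift c' hc', ← hιL (b, a), hι'] at hba
        obtain ⟨b', hb'⟩ := hba
        obtain ⟨rfl, rfl⟩ := Prod.mk.inj hb'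
        exact ⟨b', Latch.map_congr ιS' ιS (fun y hy v => by rw [hιS', hιS]) b', (neg_neg _).symm⟩
      cokernel := fun c' hc' => by
        have : LinearMap.range ((Latch.lift c').coprod s.ι) = LinearMap.range i := by
          rw [hlift c' hc']
          have h1 : ιL.coprod s.ι = i ∘ₗ K.mkQ := LinearMap.ext fun r => (hιL r).symm
          rw [h1, LinearMap.range_comp, Submodule.range_mkQ, Submodule.map_top]
        rw [this]
        exact hi'
      surjective := fun μ hμ πS' hπS' φ z hφ => by
        have hmem : (φ, z) ∈ W := by
          refine Eq.trans (Match.ext fun y hy m => ?_) hφ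
          exact LinearMap.congr_fun ((hπS y hy).trans (hπS' y hy).symm) (φ.eval hy m)
        obtain ⟨v, hv⟩ := hq ⟨_, hmem⟩
        rw [hκM μ hμ]
        exact ⟨v, congrArg (fun w => w.1.1) hv, congrArg (fun w => w.1.2) hv⟩
      kernel := fun μ hμ => by
        have : LinearMap.ker (μ.prod s.π) = LinearMap.ker q := by
          rw [hκM μ hμ]
          have h1 : κM.prod s.π = W.subtype ∘ₗ q := rfl
          rw [h1, LinearMap.ker_comp, Submodule.ker_subtype]
          rfl
        rw [this]
        exact hq' }

end step

/-- Every morphism of `C`-modules factors into one whose relative latching maps are injective with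
cokernels in `𝒬`, followed by one whose relative matching maps are surjective with kernels
in `𝒱`. -/
theorem exists_factorization (hcot : ∀ x, IsCompleteCotorsionPair (𝒬 x) (𝒱 x)) (f : Y ⟶ Z) :
    ∃ (X : CMod k C) (i : Y ⟶ X) (q : X ⟶ Z), i ≫ q = f ∧ ∀ x,
      (R.RelLatchInjective i x ∧
        𝒬 x (ModuleCat.of (R.Alg x) (R.Value X x ⧸ LinearMap.range (R.relLatch i x)))) ∧
      (R.RelMatchSurjective q x ∧
        𝒱 x (ModuleCat.of (R.Alg x) (LinearMap.ker (R.relMatch q x)))) := by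
  obtain ⟨t, h, H⟩ := exists_forall_of_exists_extension_pairs R.deg
    (H := fun x y s t => FactorHom s t) (fun x t h s c => IsStep f 𝒬 𝒱 t h s c)
    (fun x t h H => exists_isStep hcot H)
  obtain ⟨α, hα⟩ := exists_forall_deg_lt R.toPreReedyStructure
  have hS : (stageOf (α := α) (fun y _ => t y) fun y z hz _ => h y z hz).IsModule :=
    isModule_stageOf fun y _ => H y
  obtain ⟨ιS, hιS⟩ := exists_stageOf_ι (α := α) (t := fun y _ => t y)
    (h := fun y z hz _ => h y z hz) fun y _ => H y
  obtain ⟨πS, hπS⟩ := exists_stageOf_π (α := α) (t := fun y _ => t y)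
    (h := fun y z hz _ => h y z hz) fun y _ => H y
  let e := toCModValue hS hα
  let i : Y ⟶ toCMod hS hα := homMk (R := R.toPreReedyStructure)
    (fun x => (e x).toLinearMap ∘ₗ ιS.app x (hα x))
    (fun x y g v => app_act hS ιS (hα x) (hα y) g v)
  let q : toCMod hS hα ⟶ Z := homMk (R := R.toPreReedyStructure)
    (fun x => πS.app x (hα x) ∘ₗ (e x).symm.toLinearMap)
    (fun x y g v => app_action hS πS (hα x) (hα y) g v)
  have hi : ∀ x v, (e x).symm (R.valueMap i x v) = (t x).ι v := fun x v =>
    LinearMap.congr_fun (hιS x (hα x)) v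
  have hq : ∀ x v, (t x).π ((e x).symm v) = R.valueMap q x v := fun x v =>
    (LinearMap.congr_fun (hπS x (hα x)) ((e x).symm v)).symm
  have hpl : ∀ x z (hz : R.deg z < R.deg x) (p : R.Pl z x) v,
      (e x).symm (R.act (toCMod hS hα) p.hom v) = (h x z hz).1 p ((e z).symm v) := by
    intro x z hz p v
    refine (action_pl hS (hα z) (hα x) (Or.inr hz) p v).trans ?_
    exact Stage.plTotal_of_lt hz (hα x) p ((e z).symm v)
  have hmi : ∀ x z (hz : R.deg z < R.deg x) (m : R.Mi x z) v,
      (e z).symm (R.act (toCMod hS hα) m.hom v) = (h x z hz).2 m ((e x).symm v) := by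
    intro x z hz m v
    refine (action_mi hS (hα x) (hα z) (Or.inr hz) m v).trans ?_
    exact Stage.miTotal_of_lt hz (hα x) m ((e x).symm v)
  refine ⟨toCMod hS hα, i, q, hom_ext (R := R.toPreReedyStructure) fun x v => ?_, fun x => ?_⟩
  · rw [valueMap_comp, ← hq, hi]
    exact (H x).fac v
  -- The restriction of the constructed module to the objects below `x` is the stage it comes from.
  let S := stageOf (α := R.deg x) (fun y _ => t y) fun y z hz _ => h y z hz
  let E : (R.stage (toCMod hS hα) (R.deg x)).Hom S :=
    { app := fun y _ => (e y).symm.toLinearMap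
      pl_app := fun z y hz _ => hpl y z hz
      mi_app := fun y z hz _ => hmi y z hz }
  let E' : S.Hom (R.stage (toCMod hS hα) (R.deg x)) :=
    { app := fun y _ => (e y).toLinearMap
      pl_app := fun z y hz _ p v => (e y).symm.injective
        (((e y).symm_apply_apply _).trans (hpl y z hz p (e z v)).symm)
      mi_app := fun y z hz _ m v => (e z).symm.injective
        (((e z).symm_apply_apply _).trans (hmi y z hz m (e y v)).symm) }
  obtain ⟨ιx, hιx⟩ := exists_stageOf_ι (α := R.deg x) (t := fun y _ => t y)
    (h := fun y z hz _ => h y z hz) fun y _ => H y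
  obtain ⟨πx, hπx⟩ := exists_stageOf_π (α := R.deg x) (t := fun y _ => t y)
    (h := fun y z hz _ => h y z hz) fun y _ => H y
  let c : Cone S (t x).obj :=
    { φ := fun z hz => (h x z hz).1
      smul := (H x).pl_smul
      bal := (H x).pl_bal
      comp := (H x).pl_comp }
  let μ : (t x).obj →ₗ[R.Alg x] Match S :=
    { toFun := fun v => Match.mk (fun z hz => (h x z hz).2.flip v)
        (fun z hz a m => (H x).mi_smul z hz a m v)
        (fun z w hw hz m n => (H x).mi_comp w z hw hz m n v)
      map_add' := fun v w => Match.ext fun z hz m => map_add ((h x z hz).2 m) v w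
      map_smul' := fun a v => Match.ext fun z hz m => ((H x).mi_bal z hz a m v).symm }
  have hEE' : ∀ b, Latch.map E' (Latch.map E b) = b := fun b => by
    rw [Latch.map_map]
    exact Latch.map_eq_self _ (fun y hy v => (e y).apply_symm_apply v) b
  have hE'E : ∀ b, Latch.map E (Latch.map E' b) = b := fun b => by
    rw [Latch.map_map]
    exact Latch.map_eq_self _ (fun y hy v => (e y).symm_apply_apply v) b
  have hlatch : ∀ b, (e x).symm (R.latch (toCMod hS hα) x b) = Latch.lift c (Latch.map E b) := by
    intro b
    induction b using Latch.induction_on with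
    | zero => simp only [map_zero]
    | add s t hs ht => simp only [map_add, hs, ht]
    | cone y hy p v =>
      rw [Latch.map_cone, Latch.lift_cone, latch_cone]
      exact hpl x y hy p v
  have hmatch : ∀ v, μ ((e x).symm v) = Match.map E (R.matching (toCMod hS hα) x v) := fun v =>
    Match.ext fun z hz m => (hmi x z hz m v).symm
  have hrel : ∀ b a, (e x).symm (R.relLatch i x (b, a)) =
      (Latch.lift c).coprod (t x).ι (Latch.map E b, a) := fun b a => by
    rw [LinearMap.coprod_apply, ← hlatch, ← hi, ← map_add]; rfl
  refine ⟨⟨fun b a hba => ?_, ?_⟩, fun φ z hφ => ?_, ?_⟩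
  · obtain ⟨b', hb', ha⟩ := (H x).injective c (fun _ _ _ _ => rfl) ιx hιx (Latch.map E b) a (by
      rw [← hlatch, ← hi, ← map_add, hba, map_zero])
    refine ⟨b', ?_, ha⟩
    rw [← hEE' b, ← hb', Latch.map_map]
    refine Latch.map_congr _ _ (fun y hy v => ?_) b'
    exact (e y).symm.injective ((hi y v).trans ((LinearMap.congr_fun (hιx y hy) v).symm.trans
      ((e y).symm_apply_apply _).symm))
  · refine mem_of_linearEquiv 𝒬 (hcot x).left_retract (Submodule.Quotient.equiv _ _ (e x) ?_)
      ((H x).cokernel c fun _ _ _ _ => rfl)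
    ext v
    constructor
    · rintro ⟨_, ⟨⟨b, a⟩, rfl⟩, rfl⟩
      refine ⟨(Latch.map E' b, a), (e x).symm.injective ?_⟩
      rw [hrel, hE'E]
      exact ((e x).symm_apply_apply _).symm
    · rintro ⟨⟨b, a⟩, rfl⟩
      exact ⟨_, ⟨(Latch.map E b, a), rfl⟩, by rw [← hrel]; exact (e x).apply_symm_apply _⟩
  · obtain ⟨v, hv, hv'⟩ := (H x).surjective μ (fun _ _ _ _ => rfl) πx hπx (Match.map E φ) z (by
      rw [← hφ]
      refine Match.ext fun y hy m => ?_
      exact (LinearMap.congr_fun (hπx y hy) _).trans (hq y _))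
    refine ⟨e x v, Match.ext fun y hy m => (e y).symm.injective ?_, ?_⟩
    · refine (hmi x y hy m (e x v)).trans ?_
      exact congrArg (fun ψ => Match.eval ψ hy m) hv
    · rw [← hq, ← hv']
      exact congrArg (t x).π ((e x).symm_apply_apply v)
  · refine mem_of_linearEquiv 𝒱 (hcot x).right_retract ((e x).ofSubmodules _ _ ?_)
      ((H x).kernel μ fun _ _ _ _ => rfl)
    ext v
    have h1 : v ∈ LinearMap.ker (R.relMatch q x) ↔
        (e x).symm v ∈ LinearMap.ker (μ.prod (t x).π) := by
      rw [relMatch, LinearMap.ker_prod, LinearMap.ker_prod, Submodule.mem_inf, Submodule.mem_inf]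
      refine and_congr ?_ (by rw [LinearMap.mem_ker, LinearMap.mem_ker, hq])
      rw [LinearMap.mem_ker, LinearMap.mem_ker, hmatch]
      refine ⟨fun h => by rw [h, map_zero], fun h => Match.ext fun y hy m =>
        (e y).symm.injective ?_⟩
      exact (congrArg (fun ψ => Match.eval ψ hy m) h).trans (map_zero _).symm
    rw [h1]
    constructor
    · rintro ⟨w, hw, rfl⟩
      refine (congrArg (· ∈ LinearMap.ker (μ.prod (t x).π)) ?_).mpr hw
      exact (e x).symm_apply_apply w
    · exact fun hv => ⟨_, hv, (e x).apply_symm_apply v⟩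

end GeneralizedReedyStructure

namespace PreReedyStructure

variable {k : Type u} [CommRing k] {C : Type u} [SmallCategory C] [Preadditive C] [Linear k C]
  {R : PreReedyStructure k C} {x : C}

/-! ### Closure properties of the classes -/

section

variable {M₁ M₂ M₃ : Type u} [AddCommGroup M₁] [AddCommGroup M₂] [AddCommGroup M₃]
  [Module (R.Alg x) M₁] [Module (R.Alg x) M₂] [Module (R.Alg x) M₃]
  {i : M₁ →ₗ[R.Alg x] M₂} {p : M₂ →ₗ[R.Alg x] M₃}

lemma mem_of_closedUnderKernelsOfEpis {𝒮 : R.ClassFamily} (h : ClosedUnderKernelsOfEpis (𝒮 x))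
    (hi : Function.Injective i) (hp : Function.Surjective p) (hip : Function.Exact i p)
    (h₂ : 𝒮 x (ModuleCat.of (R.Alg x) M₂)) (h₃ : 𝒮 x (ModuleCat.of (R.Alg x) M₃)) :
    𝒮 x (ModuleCat.of (R.Alg x) M₁) :=
  h _ (moduleCat_shortExact (A := R.Alg x) hi hp hip) h₂ h₃

lemma mem_of_closedUnderCokernelsOfMonos {𝒮 : R.ClassFamily}
    (h : ClosedUnderCokernelsOfMonos (𝒮 x))
    (hi : Function.Injective i) (hp : Function.Surjective p) (hip : Function.Exact i p)
    (h₁ : 𝒮 x (ModuleCat.of (R.Alg x) M₁)) (h₂ : 𝒮 x (ModuleCat.of (R.Alg x) M₂)) :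
    𝒮 x (ModuleCat.of (R.Alg x) M₃) :=
  h _ (moduleCat_shortExact (A := R.Alg x) hi hp hip) h₁ h₂

lemma mem_of_isClosedUnderExtensions {𝒮 : R.ClassFamily} (h : (𝒮 x).IsClosedUnderExtensions)
    (hi : Function.Injective i) (hp : Function.Surjective p) (hip : Function.Exact i p)
    (h₁ : 𝒮 x (ModuleCat.of (R.Alg x) M₁)) (h₃ : 𝒮 x (ModuleCat.of (R.Alg x) M₃)) :
    𝒮 x (ModuleCat.of (R.Alg x) M₂) :=
  h.prop_X₂_of_shortExact (moduleCat_shortExact (A := R.Alg x) hi hp hip) h₁ h₃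

end

section Retract

variable {X Y : CMod k C} (r : Retract X Y)

include r in
lemma valueMap_retract (v : R.Value X x) : R.valueMap r.r x (R.valueMap r.i x v) = v := by
  rw [← valueMap_comp, r.retract, valueMap_id]

include r in
lemma injective_latch_of_retract (h : Function.Injective (R.latch Y x)) :
    Function.Injective (R.latch X x) := by
  have : Function.LeftInverse (Latch.map (R.stageMap r.r (R.deg x)))
      (Latch.map (R.stageMap r.i (R.deg x))) := fun b => by
    rw [Latch.map_map]
    exact Latch.map_eq_self _ (fun y _ v => valueMap_retract r v) b
  refine Function.Injective.of_comp (f := R.valueMap r.i x) ?_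
  have h1 : R.valueMap r.i x ∘ R.latch X x = R.latch Y x ∘ Latch.map (R.stageMap r.i _) :=
    funext fun b => (latch_map r.i b).symm
  rw [h1]
  exact h.comp this.injective

include r in
lemma surjective_matching_of_retract (h : Function.Surjective (R.matching Y x)) :
    Function.Surjective (R.matching X x) := by
  intro φ
  obtain ⟨v, hv⟩ := h (Match.map (R.stageMap r.i _) φ)
  refine ⟨R.valueMap r.r x v, ?_⟩
  rw [← matching_map, hv]
  exact Match.ext fun y hy m => valueMap_retract (R := R) r (φ.eval hy m)

lemma range_latch_le_comap (f : X ⟶ Y) :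
    LinearMap.range (R.latch X x) ≤ (LinearMap.range (R.latch Y x)).comap (R.valueMap f x) := by
  rintro _ ⟨b, rfl⟩
  exact ⟨_, latch_map f b⟩

lemma valueMap_mem_ker_matching (f : X ⟶ Y) :
    ∀ v ∈ LinearMap.ker (R.matching X x), R.valueMap f x v ∈ LinearMap.ker (R.matching Y x) := by
  intro v hv
  rw [LinearMap.mem_ker] at hv
  rw [LinearMap.mem_ker, ← matching_map, hv, map_zero]

end Retract

/-! ### Latching and matching objects in short exact sequences -/

section ShortExact

variable {X₁ X₂ X₃ : CMod k C} {i : X₁ ⟶ X₂} {p : X₂ ⟶ X₃}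
    (hi : ∀ x, Function.Injective (R.valueMap i x)) (hp : ∀ x, Function.Surjective (R.valueMap p x))
    (hip : ∀ x, Function.Exact (R.valueMap i x) (R.valueMap p x))

include hi in
lemma match_map_injective : Function.Injective (Match.map (R.stageMap i (R.deg x))) :=
  fun _ _ h => Match.ext fun y hy m => hi y (congrArg (fun χ => Match.eval χ hy m) h)

include hi hip in
lemma surjective_matching_kernel (h : R.RelMatchSurjective p x) :
    Function.Surjective (R.matching X₁ x) := by
  intro ψ
  obtain ⟨v, hv, hv'⟩ := h (Match.map (R.stageMap i _) ψ) 0 (Match.ext fun y hy m =>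
    ((hip y).apply_apply_eq_zero (ψ.eval hy m)).trans (by rw [map_zero]; rfl))
  obtain ⟨d, rfl⟩ := (hip x v).1 hv'
  exact ⟨d, match_map_injective hi ((matching_map i d).trans hv)⟩

include hi hip in
lemma mem_ker_matching_kernel (𝒮 : R.ClassFamily) (h𝒮 : (𝒮 x).IsStableUnderRetracts)
    (h : 𝒮 x (ModuleCat.of (R.Alg x) (LinearMap.ker (R.relMatch p x)))) :
    𝒮 x (ModuleCat.of (R.Alg x) (LinearMap.ker (R.matching X₁ x))) := by
  have hmem : ∀ v ∈ LinearMap.ker (R.matching X₁ x),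
      R.valueMap i x v ∈ LinearMap.ker (R.relMatch p x) := fun v hv => by
    rw [relMatch, LinearMap.ker_prod]
    exact ⟨valueMap_mem_ker_matching i v hv, (hip x).apply_apply_eq_zero v⟩
  refine mem_of_linearEquiv 𝒮 h𝒮 (LinearEquiv.ofBijective
    ((R.valueMap i x).restrict hmem) ⟨?_, ?_⟩).symm h
  · exact fun v w hvw => Subtype.ext (hi x (congrArg Subtype.val hvw))
  · rintro ⟨v, hv⟩
    rw [relMatch, LinearMap.ker_prod] at hv
    obtain ⟨w, rfl⟩ := (hip x v).1 hv.2
    refine ⟨⟨w, match_map_injective hi ?_⟩, rfl⟩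
    rw [matching_map, map_zero]
    exact hv.1

include hp in
lemma latch_map_surjective : Function.Surjective (Latch.map (R.stageMap p (R.deg x))) := by
  intro t
  induction t using Latch.induction_on with
  | zero => exact ⟨0, map_zero _⟩
  | add s t hs ht =>
    obtain ⟨a, rfl⟩ := hs
    obtain ⟨b, rfl⟩ := ht
    exact ⟨a + b, map_add _ _ _⟩
  | cone y hy q v =>
    obtain ⟨w, rfl⟩ := hp y v
    exact ⟨(Latch.cone (R.stage X₂ (R.deg x))).φ y hy q w, Latch.map_cone (R.stageMap p _) hy q w⟩

include hip in
lemma latch_map_map_eq_zero (b : Latch (R.stage X₁ (R.deg x))) :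
    Latch.map (R.stageMap p _) (Latch.map (R.stageMap i _) b) = 0 := by
  induction b using Latch.induction_on with
  | zero => simp only [map_zero]
  | add s t hs ht => simp only [map_add, hs, ht, add_zero]
  | cone y hy q v =>
    rw [Latch.map_cone, Latch.map_cone]
    exact (congrArg _ ((hip y).apply_apply_eq_zero v)).trans (map_zero _)

include hp hip in
/-- The latching object is right exact. -/
lemma exists_latch_map_eq (b : Latch (R.stage X₂ (R.deg x)))
    (hb : Latch.map (R.stageMap p _) b = 0) : ∃ a, Latch.map (R.stageMap i _) a = b := by
  -- The quotient map of `L X₂` by the image of `L X₁` factors through `L X₃`.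
  let N := LinearMap.range (Latch.map (R.stageMap i (R.deg x)))
  choose σ hσ using hp
  have key : ∀ (y : C) (hy : R.deg y < R.deg x) (q : R.Pl y x) (v w : R.Value X₂ y),
      R.valueMap p y v = R.valueMap p y w →
      N.mkQ ((Latch.cone _).φ y hy q v) = N.mkQ ((Latch.cone _).φ y hy q w) := by
    intro y hy q v w hvw
    obtain ⟨u, hu⟩ := (hip y (v - w)).1 (by rw [map_sub, hvw, sub_self])
    refine (Submodule.Quotient.eq _).2 ⟨(Latch.cone _).φ y hy q u, ?_⟩
    rw [Latch.map_cone, ← map_sub]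
    exact congrArg _ hu
  let c : Cone (R.stage X₃ (R.deg x)) (Latch (R.stage X₂ (R.deg x)) ⧸ N) :=
    { φ := fun y hy => AddMonoidHom.mk' (fun q => AddMonoidHom.mk'
          (fun v => N.mkQ ((Latch.cone _).φ y hy q (σ y v))) fun v w => by
            rw [← map_add, ← map_add]
            exact key y hy q _ _ (by rw [map_add, hσ, hσ, hσ]))
          fun q q' => AddMonoidHom.ext fun v => by
            change N.mkQ _ = N.mkQ _ + N.mkQ _
            rw [map_add, AddMonoidHom.add_apply, map_add]
      smul := fun y hy a q v => by
        change N.mkQ _ = a • N.mkQ _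
        rw [(Latch.cone _).smul, map_smul]
      bal := fun y hy a q v => by
        change N.mkQ _ = N.mkQ _
        rw [(Latch.cone _).bal]
        exact key y hy q _ _ (by
          rw [hσ]
          exact (map_smul (R.valueMap p y) a (σ y v)).trans (by rw [hσ]))
      comp := fun z y hz hy q q' v => by
        change N.mkQ _ = N.mkQ _
        rw [(Latch.cone _).comp z y hz hy]
        exact key y hy q' _ _ (by
          rw [hσ]
          exact (valueMap_act p q.hom (σ z v)).trans (by rw [hσ]; rfl)) }
  have h1 : Latch.lift c ∘ₗ Latch.map (R.stageMap p _) = N.mkQ := by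
    refine Latch.hom_ext fun y hy q v => ?_
    rw [LinearMap.comp_apply, Latch.map_cone, Latch.lift_cone]
    exact key y hy q _ _ (hσ y _)
  have h2 := LinearMap.congr_fun h1 b
  rw [LinearMap.comp_apply, hb, map_zero] at h2
  exact (Submodule.Quotient.mk_eq_zero _).1 h2.symm

include hp hip in
lemma injective_latch_cokernel (h : R.RelLatchInjective i x) :
    Function.Injective (R.latch X₃ x) := by
  rw [injective_iff_map_eq_zero]
  intro c hc
  obtain ⟨b, rfl⟩ := latch_map_surjective hp c
  rw [latch_map] at hc
  obtain ⟨a, ha⟩ := (hip x _).1 hc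
  obtain ⟨b', rfl, -⟩ := h b (-a) (by rw [map_neg, ha, add_neg_cancel])
  exact latch_map_map_eq_zero hip b'

include hp hip in
lemma mem_cokernel_latch_cokernel (𝒮 : R.ClassFamily) (h𝒮 : (𝒮 x).IsStableUnderRetracts)
    (h : 𝒮 x (ModuleCat.of (R.Alg x) (R.Value X₂ x ⧸ LinearMap.range (R.relLatch i x)))) :
    𝒮 x (ModuleCat.of (R.Alg x) (R.Value X₃ x ⧸ LinearMap.range (R.latch X₃ x))) := by
  let f := (LinearMap.range (R.latch X₃ x)).mkQ ∘ₗ R.valueMap p x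
  have hf : LinearMap.range (R.relLatch i x) = LinearMap.ker f := by
    ext v
    rw [LinearMap.ker_comp, Submodule.ker_mkQ]
    constructor
    · rintro ⟨⟨b, a⟩, rfl⟩
      refine ⟨Latch.map (R.stageMap p _) b, ?_⟩
      rw [latch_map, relLatch, LinearMap.coprod_apply, map_add, (hip x).apply_apply_eq_zero,
        add_zero]
    · rintro ⟨c, hc⟩
      obtain ⟨b, rfl⟩ := latch_map_surjective hp c
      rw [latch_map, ← sub_eq_zero, ← map_sub] at hc
      obtain ⟨a, ha⟩ := (hip x _).1 hc
      refine ⟨(b, -a), ?_⟩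
      rw [relLatch, LinearMap.coprod_apply, map_neg, ha, neg_sub, add_sub_cancel]
  exact mem_of_linearEquiv 𝒮 h𝒮 ((Submodule.quotEquivOfEq _ _ hf).trans
    (f.quotKerEquivOfSurjective ((Submodule.mkQ_surjective _).comp (hp x)))) h

include hi hp hip in
lemma relLatchInjective_of_exact (h : Function.Injective (R.latch X₃ x)) :
    R.RelLatchInjective i x := by
  intro b a hba
  obtain ⟨b', rfl⟩ := exists_latch_map_eq hp hip b (by
    have := congrArg (R.valueMap p x) hba
    rw [map_add, (hip x).apply_apply_eq_zero, add_zero, ← latch_map, map_zero] at this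
    exact (map_eq_zero_iff _ h).1 this)
  rw [latch_map, ← map_add, map_eq_zero_iff _ (hi x)] at hba
  exact ⟨b', rfl, eq_neg_of_add_eq_zero_left hba⟩

include hp hip in
/-- If the relative latching map of `i` is injective, the cokernels of the latching maps of a short
exact sequence `0 ⟶ X₁ ⟶ X₂ ⟶ X₃ ⟶ 0` form a short exact sequence, to which closure properties
apply. -/
lemma mem_cokernel_latch_of_shortExact {𝒮 : R.ClassFamily}
    (h𝒮 : ClosedUnderKernelsOfEpis (𝒮 x)) (h : R.RelLatchInjective i x)
    (h₂ : 𝒮 x (ModuleCat.of (R.Alg x) (R.Value X₂ x ⧸ LinearMap.range (R.latch X₂ x))))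
    (h₃ : 𝒮 x (ModuleCat.of (R.Alg x) (R.Value X₃ x ⧸ LinearMap.range (R.latch X₃ x)))) :
    𝒮 x (ModuleCat.of (R.Alg x) (R.Value X₁ x ⧸ LinearMap.range (R.latch X₁ x))) := by
  refine mem_of_closedUnderKernelsOfEpis h𝒮
    (i := Submodule.mapQ _ _ (R.valueMap i x) (range_latch_le_comap i))
    (p := Submodule.mapQ _ _ (R.valueMap p x) (range_latch_le_comap p)) ?_ ?_ ?_ h₂ h₃
  · rw [injective_iff_map_eq_zero]
    intro v hv
    obtain ⟨v, rfl⟩ := Submodule.mkQ_surjective _ v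
    obtain ⟨b, hb⟩ := (Submodule.Quotient.mk_eq_zero _).1 hv
    obtain ⟨b', -, hb'⟩ := h b (-v) (by rw [map_neg, hb, add_neg_cancel])
    exact (Submodule.Quotient.mk_eq_zero _).2 ⟨b', hb'.trans (neg_neg v)⟩
  · intro v
    obtain ⟨v, rfl⟩ := Submodule.mkQ_surjective _ v
    obtain ⟨w, rfl⟩ := hp x v
    exact ⟨Submodule.mkQ _ w, rfl⟩
  · intro v
    constructor
    · intro hv
      obtain ⟨v, rfl⟩ := Submodule.mkQ_surjective _ v
      obtain ⟨c, hc⟩ := (Submodule.Quotient.mk_eq_zero _).1 hv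
      obtain ⟨b, rfl⟩ := latch_map_surjective hp c
      rw [latch_map, eq_comm, ← sub_eq_zero, ← map_sub] at hc
      obtain ⟨a, ha⟩ := (hip x _).1 hc
      refine ⟨Submodule.mkQ _ a, (Submodule.Quotient.eq _).2 ⟨-b, ?_⟩⟩
      rw [ha, map_neg]
      abel
    · rintro ⟨a, rfl⟩
      obtain ⟨a, rfl⟩ := Submodule.mkQ_surjective _ a
      exact congrArg (Submodule.mkQ _) ((hip x).apply_apply_eq_zero a)

include hi hip in
/-- If the relative matching map of `p` is surjective, the kernels of the matching maps of a short
exact sequence `0 ⟶ X₁ ⟶ X₂ ⟶ X₃ ⟶ 0` form a short exact sequence, to which closure properties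
apply. -/
lemma mem_ker_matching_of_shortExact {𝒮 : R.ClassFamily}
    (h𝒮 : ClosedUnderCokernelsOfMonos (𝒮 x)) (h : R.RelMatchSurjective p x)
    (h₁ : 𝒮 x (ModuleCat.of (R.Alg x) (LinearMap.ker (R.matching X₁ x))))
    (h₂ : 𝒮 x (ModuleCat.of (R.Alg x) (LinearMap.ker (R.matching X₂ x)))) :
    𝒮 x (ModuleCat.of (R.Alg x) (LinearMap.ker (R.matching X₃ x))) := by
  refine mem_of_closedUnderCokernelsOfMonos h𝒮
    (i := (R.valueMap i x).restrict (valueMap_mem_ker_matching i))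
    (p := (R.valueMap p x).restrict (valueMap_mem_ker_matching p)) ?_ ?_ ?_ h₁ h₂
  · exact fun v w hvw => Subtype.ext (hi x (congrArg Subtype.val hvw))
  · rintro ⟨z, hz⟩
    obtain ⟨v, hv, hv'⟩ := h 0 z (by rw [map_zero]; exact hz.symm)
    exact ⟨⟨v, hv⟩, Subtype.ext hv'⟩
  · rintro ⟨v, hv⟩
    constructor
    · intro hpv
      obtain ⟨w, rfl⟩ := (hip x v).1 (congrArg Subtype.val hpv)
      refine ⟨⟨w, match_map_injective hi ?_⟩, rfl⟩
      rw [matching_map, map_zero]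
      exact hv
    · rintro ⟨w, hw⟩
      rw [← hw]
      exact Subtype.ext ((hip x).apply_apply_eq_zero w.1)

end ShortExact

end PreReedyStructure

namespace GeneralizedReedyStructure

open PreReedyStructure

variable {k : Type u} [CommRing k] {C : Type u} [SmallCategory C] [Preadditive C] [Linear k C]
  (R : GeneralizedReedyStructure k C)

/-! ### The induced cotorsion pairs and the induced Hovey triple -/

lemma phi_isStableUnderRetracts {𝒬 : R.ClassFamily} (h : ∀ x, (𝒬 x).IsStableUnderRetracts) :
    (R.Phi 𝒬).IsStableUnderRetracts where
  of_retract {X Y} r hY := by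
    rw [R.phi_iff] at hY ⊢
    intro x
    refine ⟨injective_latch_of_retract r (hY x).1, mem_of_linear_retract 𝒬 (h x)
      (Submodule.mapQ _ _ (R.valueMap r.i x) (range_latch_le_comap r.i))
      (Submodule.mapQ _ _ (R.valueMap r.r x) (range_latch_le_comap r.r)) ?_ (hY x).2⟩
    intro v
    obtain ⟨v, rfl⟩ := Submodule.mkQ_surjective _ v
    exact congrArg (Submodule.mkQ _) (valueMap_retract r v)

lemma psi_isStableUnderRetracts {𝒱 : R.ClassFamily} (h : ∀ x, (𝒱 x).IsStableUnderRetracts) :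
    (R.Psi 𝒱).IsStableUnderRetracts where
  of_retract {X Y} r hY := by
    rw [R.psi_iff] at hY ⊢
    intro x
    exact ⟨surjective_matching_of_retract r (hY x).1, mem_of_linear_retract 𝒱 (h x)
      ((R.valueMap r.i x).restrict (valueMap_mem_ker_matching r.i))
      ((R.valueMap r.r x).restrict (valueMap_mem_ker_matching r.r))
      (fun v => Subtype.ext (valueMap_retract r v.1)) (hY x).2⟩

variable (hplus : R.PlusRightProjective) (hminus : R.MinusLeftProjective)

include hplus hminus in
/-- A family of complete cotorsion pairs `(𝒬_x, 𝒱_x)` induces the complete cotorsion pair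
`(Φ(𝒬), Ψ(𝒱))`. -/
theorem isCompleteCotorsionPair_phi_psi {𝒬 𝒱 : R.ClassFamily}
    (hcot : ∀ x, IsCompleteCotorsionPair (𝒬 x) (𝒱 x)) :
    IsCompleteCotorsionPair (R.Phi 𝒬) (R.Psi 𝒱) := by
  obtain ⟨O, h0⟩ := Limits.HasZeroObject.zero (C := CMod k C)
  refine .of_approximations (R.phi_isStableUnderRetracts fun x => (hcot x).left_retract)
    (R.psi_isStableUnderRetracts fun x => (hcot x).right_retract) (fun X Y hX hY => ?_)
    (fun M => ?_) (fun M => ?_)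
  · rw [R.phi_iff] at hX
    rw [R.psi_iff] at hY
    refine extOneVanishes_of_split fun E j π w hS => ?_
    have h := (R.shortExact_iff _).1 hS
    exact exists_section j π (fun x => (h x).1) (fun x => (h x).2.1) (fun x => (h x).2.2)
      (fun x => (hX x).1) (fun x => (hY x).1) fun x =>
        (hcot x).ext_vanishes (hX x).2 (hY x).2
  · -- A factorization of `0 ⟶ M` is a special precover of `M`.
    obtain ⟨X, i, q, -, h⟩ := exists_factorization hcot (0 : O ⟶ M)
    have : Epi q := ⟨fun f g hfg => hom_ext (R := R.toPreReedyStructure) fun x v => by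
      obtain ⟨w, rfl⟩ := valueMap_surjective q (fun y => hminus x y) (fun y => (h y).2.1) v
      exact congrArg (fun f => R.valueMap f x w) hfg⟩
    have hS : (ShortComplex.mk _ q (Limits.kernel.condition q)).ShortExact :=
      { exact := ShortComplex.exact_of_f_is_kernel _ (Limits.kernelIsKernel q)
        mono_f := inferInstanceAs (Mono (Limits.kernel.ι q)) }
    have hS' := (R.shortExact_iff _).1 hS
    refine ⟨_, X, _, q, _, hS, ?_, ?_⟩
    · rw [R.psi_iff]
      exact fun x => ⟨surjective_matching_kernel (fun x => (hS' x).1) (fun x => (hS' x).2.2)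
        (h x).2.1, mem_ker_matching_kernel (fun x => (hS' x).1) (fun x => (hS' x).2.2) 𝒱
        (hcot x).right_retract (h x).2.2⟩
    · rw [R.phi_iff]
      intro x
      refine ⟨injective_latch_of_isZero h0 i (h x).1.1, ?_⟩
      rw [← range_relLatch_of_isZero h0 i]
      exact (h x).1.2
  · -- A factorization of `M ⟶ 0` is a special preenvelope of `M`.
    obtain ⟨X, i, q, -, h⟩ := exists_factorization hcot (0 : M ⟶ O)
    have : Mono i := ⟨fun f g hfg => hom_ext (R := R.toPreReedyStructure) fun x v =>
      valueMap_injective i (fun y => hplus y x) (fun y => (h y).1.1)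
        (congrArg (fun f => R.valueMap f x v) hfg)⟩
    have hS : (ShortComplex.mk i _ (Limits.cokernel.condition i)).ShortExact :=
      { exact := ShortComplex.exact_of_g_is_cokernel _ (Limits.cokernelIsCokernel i)
        epi_g := inferInstanceAs (Epi (Limits.cokernel.π i)) }
    have hS' := (R.shortExact_iff _).1 hS
    refine ⟨X, _, i, _, _, hS, ?_, ?_⟩
    · rw [R.psi_iff]
      intro x
      refine ⟨surjective_matching_of_isZero h0 q (h x).2.1, ?_⟩
      rw [← ker_relMatch_of_isZero h0 q]
      exact (h x).2.2
    · rw [R.phi_iff]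
      exact fun x => ⟨injective_latch_cokernel (fun x => (hS' x).2.1) (fun x => (hS' x).2.2)
        (h x).1.1, mem_cokernel_latch_cokernel (fun x => (hS' x).2.1) (fun x => (hS' x).2.2) 𝒬
        (hcot x).left_retract (h x).1.2⟩

lemma isThick_pointwise {𝒲 : R.ClassFamily} (h : ∀ x, IsThick (𝒲 x)) :
    IsThick (R.Pointwise 𝒲) where
  summand := ⟨fun {X Y} r hY x => mem_of_linear_retract (R := R.toPreReedyStructure) 𝒲
    (h x).summand (R.valueMap r.i x) (R.valueMap r.r x) (valueMap_retract r) (hY x)⟩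
  extension := ⟨fun {S} hS h₁ h₃ x => by
    have := (R.shortExact_iff _).1 hS x
    exact mem_of_isClosedUnderExtensions (h x).extension this.1 this.2.1 this.2.2 (h₁ x) (h₃ x)⟩
  kernel S hS h₂ h₃ x := by
    have := (R.shortExact_iff _).1 hS x
    exact mem_of_closedUnderKernelsOfEpis (h x).kernel this.1 this.2.1 this.2.2 (h₂ x) (h₃ x)
  cokernel S hS h₁ h₂ x := by
    have := (R.shortExact_iff _).1 hS x
    exact mem_of_closedUnderCokernelsOfMonos (h x).cokernel this.1 this.2.1 this.2.2 (h₁ x) (h₂ x)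

include hplus in
/-- By induction on the degree the latching objects belong to `𝒬 ∩ 𝒲`, so that the values of a
module in `Φ(𝒬)` belong to `𝒲` if and only if the cokernels of its latching maps do. -/
lemma phi_inf {𝒬 𝒲 ℛ : R.ClassFamily} (hcot : ∀ x, IsCotorsionPair (𝒬 x ⊓ 𝒲 x) (ℛ x))
    (hthick : ∀ x, IsThick (𝒲 x)) (hQW : R.Cocompatible fun x => 𝒬 x ⊓ 𝒲 x) :
    R.Phi (fun x => 𝒬 x ⊓ 𝒲 x) = R.Phi 𝒬 ⊓ R.Pointwise 𝒲 := by
  have hlatch : ∀ (Y : CMod k C) (x : C), (∀ y, R.deg y < R.deg x →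
      Function.Injective (R.latch Y y) ∧ (𝒬 y ⊓ 𝒲 y)
        (ModuleCat.of (R.Alg y) (R.Value Y y ⧸ LinearMap.range (R.latch Y y)))) →
      𝒲 x (ModuleCat.of (R.Alg x) (Latch (R.stage Y (R.deg x)))) := fun Y x hY =>
    (latch_mem Y (fun y => hplus y x) (fun x => 𝒬 x ⊓ 𝒲 x) hQW (hcot x) hY).2
  have hexact : ∀ (Y : CMod k C) (x : C), Function.Exact (R.latch Y x)
      (LinearMap.range (R.latch Y x)).mkQ := fun Y x => LinearMap.exact_map_mkQ_range _
  ext Y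
  change _ ↔ R.Phi 𝒬 Y ∧ R.Pointwise 𝒲 Y
  rw [R.phi_iff, R.phi_iff]
  constructor
  · refine fun hY => ⟨fun x => ⟨(hY x).1, (hY x).2.1⟩, fun x => ?_⟩
    exact mem_of_isClosedUnderExtensions (R := R.toPreReedyStructure) (hthick x).extension (hY x).1
      (Submodule.mkQ_surjective _) (hexact Y x) (hlatch Y x fun y _ => hY y) (hY x).2.2
  · rintro ⟨hY, hW⟩ x
    refine (InvImage.wf R.deg wellFounded_lt).induction (C := fun x =>
      Function.Injective (R.latch Y x) ∧ (𝒬 x ⊓ 𝒲 x)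
        (ModuleCat.of (R.Alg x) (R.Value Y x ⧸ LinearMap.range (R.latch Y x)))) x
      fun x ih => ⟨(hY x).1, (hY x).2, ?_⟩
    exact mem_of_closedUnderCokernelsOfMonos (R := R.toPreReedyStructure) (hthick x).cokernel
      (hY x).1 (Submodule.mkQ_surjective _) (hexact Y x) (hlatch Y x ih) (hW x)

include hminus in
/-- By induction on the degree the matching objects belong to `𝒲 ∩ ℛ`, so that the values of a
module in `Ψ(ℛ)` belong to `𝒲` if and only if the kernels of its matching maps do. -/
lemma psi_inf {𝒬 𝒲 ℛ : R.ClassFamily} (hcot : ∀ x, IsCotorsionPair (𝒬 x) (𝒲 x ⊓ ℛ x))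
    (hthick : ∀ x, IsThick (𝒲 x)) (hWR : R.Compatible fun x => 𝒲 x ⊓ ℛ x) :
    R.Psi (fun x => 𝒲 x ⊓ ℛ x) = R.Pointwise 𝒲 ⊓ R.Psi ℛ := by
  have hmatch : ∀ (Y : CMod k C) (x : C), (∀ y, R.deg y < R.deg x →
      Function.Surjective (R.matching Y y) ∧ (𝒲 y ⊓ ℛ y)
        (ModuleCat.of (R.Alg y) (LinearMap.ker (R.matching Y y)))) →
      𝒲 x (ModuleCat.of (R.Alg x) (Match (R.stage Y (R.deg x)))) := fun Y x hY =>
    (match_mem Y (fun y => hminus x y) (fun x => 𝒲 x ⊓ ℛ x) hWR (hcot x) hY).1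
  have hexact : ∀ (Y : CMod k C) (x : C), Function.Exact (LinearMap.ker (R.matching Y x)).subtype
      (R.matching Y x) := fun Y x => LinearMap.exact_subtype_ker_map _
  ext Y
  change _ ↔ R.Pointwise 𝒲 Y ∧ R.Psi ℛ Y
  rw [R.psi_iff, R.psi_iff]
  constructor
  · refine fun hY => ⟨fun x => ?_, fun x => ⟨(hY x).1, (hY x).2.2⟩⟩
    exact mem_of_isClosedUnderExtensions (R := R.toPreReedyStructure) (hthick x).extension
      (Submodule.subtype_injective _) (hY x).1 (hexact Y x) (hY x).2.1 (hmatch Y x fun y _ => hY y)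
  · rintro ⟨hW, hY⟩ x
    refine (InvImage.wf R.deg wellFounded_lt).induction (C := fun x =>
      Function.Surjective (R.matching Y x) ∧ (𝒲 x ⊓ ℛ x)
        (ModuleCat.of (R.Alg x) (LinearMap.ker (R.matching Y x)))) x
      fun x ih => ⟨(hY x).1, ?_, (hY x).2⟩
    exact mem_of_closedUnderKernelsOfEpis (R := R.toPreReedyStructure) (hthick x).kernel
      (Submodule.subtype_injective _) (hY x).1 (hexact Y x) (hW x) (hmatch Y x ih)

include hplus hminus in
lemma isHereditaryPair_phi_psi {𝒬 𝒱 : R.ClassFamily}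
    (h : ∀ x, IsHereditaryPair (𝒬 x) (𝒱 x)) : IsHereditaryPair (R.Phi 𝒬) (R.Psi 𝒱) where
  resolving S hS h₂ h₃ := by
    rw [R.phi_iff] at h₂ h₃ ⊢
    have hS' := (R.shortExact_iff _).1 hS
    have hrel : ∀ x, R.RelLatchInjective S.f x := fun x => relLatchInjective_of_exact
      (fun x => (hS' x).1) (fun x => (hS' x).2.1) (fun x => (hS' x).2.2) (h₃ x).1
    refine fun x => ⟨?_, mem_cokernel_latch_of_shortExact (fun x => (hS' x).2.1)
      (fun x => (hS' x).2.2) (h x).resolving (hrel x) (h₂ x).2 (h₃ x).2⟩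
    refine Function.Injective.of_comp (f := R.valueMap S.f x) ?_
    have h1 : R.valueMap S.f x ∘ R.latch S.X₁ x =
        R.latch S.X₂ x ∘ Latch.map (R.stageMap S.f _) := funext fun b => (latch_map S.f b).symm
    rw [h1]
    exact (h₂ x).1.comp (latch_map_injective S.f (fun y => hplus y x) fun y _ => hrel y)
  coresolving S hS h₁ h₂ := by
    rw [R.psi_iff] at h₁ h₂ ⊢
    have hS' := (R.shortExact_iff _).1 hS
    have hrel : ∀ x, R.RelMatchSurjective S.g x := fun x => relMatchSurjective_of_exact
      (fun x => (hS' x).1) (fun x => (hS' x).2.1) (fun x => (hS' x).2.2) (h₁ x).1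
    refine fun x => ⟨fun φ => ?_, mem_ker_matching_of_shortExact (fun x => (hS' x).1)
      (fun x => (hS' x).2.2) (h x).coresolving (hrel x) (h₁ x).2 (h₂ x).2⟩
    obtain ⟨ψ, rfl⟩ := match_map_surjective S.g (fun y => hminus x y) (fun y _ => hrel y) φ
    obtain ⟨v, rfl⟩ := (h₂ x).1 ψ
    exact ⟨_, (matching_map S.g v).symm⟩

end GeneralizedReedyStructure

end

theorem theoremF {k : Type u} [CommRing k] {C : Type u} [SmallCategory C] [Preadditive C]
    [Linear k C] (R : GeneralizedReedyStructure k C)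
    (hplus : R.PlusRightProjective) (hminus : R.MinusLeftProjective)
    (𝒬 𝒲 ℛ : R.ClassFamily)
    (hovey : ∀ x : C, IsHoveyTriple (𝒬 x) (𝒲 x) (ℛ x))
    (hQW : R.Cocompatible fun x => 𝒬 x ⊓ 𝒲 x)
    (hWR : R.Compatible fun x => 𝒲 x ⊓ ℛ x) :
    IsHoveyTriple (R.Phi 𝒬) (R.Pointwise 𝒲) (R.Psi ℛ) ∧
      ((∀ x : C, IsHereditaryHoveyTriple (𝒬 x) (𝒲 x) (ℛ x)) →
        IsHereditaryHoveyTriple (R.Phi 𝒬) (R.Pointwise 𝒲) (R.Psi ℛ)) := by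
  have hΦ := R.phi_inf hplus (fun x => (hovey x).trivially_cofibrant.toIsCotorsionPair)
    (fun x => (hovey x).thick) hQW
  have hΨ := R.psi_inf hminus (fun x => (hovey x).cofibrant.toIsCotorsionPair)
    (fun x => (hovey x).thick) hWR
  have htriple : IsHoveyTriple (R.Phi 𝒬) (R.Pointwise 𝒲) (R.Psi ℛ) :=
    { cofibrant := hΨ ▸ R.isCompleteCotorsionPair_phi_psi hplus hminus fun x => (hovey x).cofibrant
      trivially_cofibrant := hΦ ▸
        R.isCompleteCotorsionPair_phi_psi hplus hminus fun x => (hovey x).trivially_cofibrant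
      thick := R.isThick_pointwise fun x => (hovey x).thick }
  refine ⟨htriple, fun h => { htriple with
    hereditary_cofibrant := ?_, hereditary_trivially_cofibrant := ?_ }⟩
  · exact hΨ ▸ R.isHereditaryPair_phi_psi hplus hminus fun x => (h x).hereditary_cofibrant
  · exact hΦ ▸ R.isHereditaryPair_phi_psi hplus hminus fun x => (h x).hereditary_trivially_cofibrant
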